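/- **Setting.** Let $k$ be a field of characteristic $0$. For $n\ge 0$ let $B_n$ be the braid group on $n$ strands with standard generators $\sigma_1,\dots,\sigma_{n-1}$. For $\tau\in S_n$ let $\widetilde\tau\in B_n$ be its Matsumoto lift (write $\tau$ as a minimal length word in the adjacent transpositions and replace each $(i\;i+1)$ by $\sigma_i$), and let $$\mathbf S_n=\sum_{\tau\in S_n}\widetilde\tau\in k[B_n]$$ be the quantum symmetrizer. The profinite braided associative operad $\widehat{\mathrm{BrAss}}$ has as $\widehat{\mathrm{BrAss}}(n)$ the pro-vector space $(k[Q])_Q$, where $Q$ runs over the finite quotients of $B_n$; $B_n$ acts by right multiplication, and the partial compositions $\circ_i:\widehat{\mathrm{BrAss}}(m)\otimes\widehat{\mathrm{BrAss}}(n)\to\widehat{\mathrm{BrAss}}(m+n-1)$, $1\le i\le m$, are induced by the cabling of braids. A *left ideal* is a family of subobjects $\mathcal I(n)\le\widehat{\mathrm{BrAss}}(n)$ which are stable under $B_n$ and satisfy $\widehat{\mathrm{BrAss}}(m)\circ_i\mathcal I(n)\subseteq\mathcal I(m+n-1)$ for all $m,n,i$. It is *strict* if all transition maps of the inverse systems $\mathcal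 I(n)$ are epimorphisms. The *Woronowicz ideal* $\mathfrak W$ and the *Nichols module* $\mathrm{Nic}$ are $$\mathfrak W(n)=\ker\bigl(\mathbf S_n\cdot:\widehat{\mathrm{BrAss}}(n)\to\widehat{\mathrm{BrAss}}(n)\bigr),\qquad \mathrm{Nic}(n)=\widehat{\mathrm{BrAss}}(n)/\mathfrak W(n),$$ kernels and quotients being formed levelwise in $Q$. Let $\mathbf C$ be a $k$-linear abelian braided monoidal category with bilinear tensor product, which has all coproducts indexed by sets of the size of the universe of $k$ and all countable coproducts, such that $\otimes$ preserves countable coproducts. An object $V$ of $\mathbf C$ is *finitely braided* if for every $n$ the action of $B_n$ on $V^{\otimes n}$ factors through a finite quotient of $B_n$. For a braided sequence $\mathcal S$ of pro-vector spaces, $\mathcal S(n)=(\mathcal S(n)_j)_{j\in J_n}$, with right actions of $B_n$, the *Artin functor* assigns to $V$ the pro-object $\mathcal S[V]=\bigoplus_n\mathcal S(n)\otimes_{B_n}V^{\otimes n}$ of $\mathbf C$, that is, the system $\bigoplus_n\mathcal S(n)_{j_n}\otimes_{B_n}V^{\otimes n}$ indexed by $(j_n)_n\in\prod_nJ_n$.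 An algebra structure on $\mathrm{Nic}[V]$ is called *operadic* if its unit is the canonical map $\mathbf 1=V^{\otimes 0}\to\mathrm{Nic}[V]$, and its product satisfies $(g\otimes v)(h\otimes w)=(g|h)\otimes(v\otimes w)$ for $g\in B_p$, $h\in B_q$, $v$ in $V^{\otimes p}$, $w$ in $V^{\otimes q}$, where $g|h\in B_{p+q}$ is the juxtaposition (the composite in the operad of the trivial braid on two strands with $g$ and $h$). Let $T(V)=\bigoplus_nV^{\otimes n}$ be the tensor algebra and $T^{co}(V)$ the same object with the quantum shuffle product, i.e. the product $V^{\otimes p}\otimes V^{\otimes q}\to V^{\otimes(p+q)}$ given by $\sum\widetilde\tau$, the sum over the $(p,q)$-shuffles $\tau$. The *Nichols algebra* $\mathfrak B(V)$ is the image of the map $T(V)\to T^{co}(V)$ which is the identity on $V$ and takes concatenation products to quantum shuffle products; its algebra structure is the one for which $T(V)\to\mathfrak B(V)$ and $\mathfrak B(V)\to T^{co}(V)$ preserve units and products. **Proposition.** 1. $\mathfrak W$ is a strict left ideal in $\widehat{\mathrm{BrAss}}$. 2. For all $\mathbf C$ as above and every finitely braided $V\in\mathbf C$, the algebra structure on $\mathfrak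 B(V)$ just described and an operadic algebra structure on $\mathrm{Nic}[V]$ exist, and there is an isomorphism of algebras $$\mathrm{Nic}[V]\cong\mathfrak B(V)$$ in the category of pro-objects of $\mathbf C$, where $\mathfrak B(V)$ is regarded as a constant pro-object. It is compatible with the canonical maps from the tensor powers $V^{\otimes n}$ to both sides. -/

import Mathlib

open CategoryTheory MonoidalCategory Limits

universe t w v u

noncomputable section

namespace BraidedNichols

/-! ### Braid groups -/

/-- The braid relations `σᵢ σᵢ₊₁ σᵢ = σᵢ₊₁ σᵢ σᵢ₊₁` and `σᵢ σⱼ = σⱼ σᵢ` for `|i - j| > 1`. -/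
def braidRels (n : ℕ) : Set (FreeGroup (Fin (n - 1))) :=
  {r | (∃ i j : Fin (n - 1), (i : ℕ) + 1 = j ∧
          r = FreeGroup.of i * FreeGroup.of j * FreeGroup.of i *
            (FreeGroup.of j * FreeGroup.of i * FreeGroup.of j)⁻¹) ∨
       (∃ i j : Fin (n - 1), (i : ℕ) + 1 < j ∧
          r = FreeGroup.of i * FreeGroup.of j * (FreeGroup.of j * FreeGroup.of i)⁻¹)}

/-- The braid group on `n` strands (trivial for `n = 0, 1`). Strands are numbered from `0`. -/
abbrev Braid (n : ℕ) : Type := PresentedGroup (braidRels n)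

/-- The generator `σᵢ` crossing the strands `i` and `i + 1`, for `i + 1 < n` (and `1` otherwise). -/
def braidGen (n i : ℕ) : Braid n :=
  if h : i < n - 1 then PresentedGroup.of ⟨i, h⟩ else 1

/-- A sequence of elements of a group satisfying the relations of the braid group on `n` strands. -/
structure IsBraiding {G : Type*} [Monoid G] (n : ℕ) (s : ℕ → G) : Prop where
  braid : ∀ i, i + 2 < n → s i * s (i + 1) * s i = s (i + 1) * s i * s (i + 1)
  comm : ∀ i j, i + 1 < j → j + 1 < n → s i * s j = s j * s i

/-- The homomorphism out of the braid group determined by the images of the generators. -/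
def braidLift {G : Type*} [Group G] {n : ℕ} (s : ℕ → G) (hs : IsBraiding n s) : Braid n →* G :=
  PresentedGroup.toGroup (f := fun i : Fin (n - 1) => s i) (by
    rintro r (⟨i, j, hij, rfl⟩ | ⟨i, j, hij, rfl⟩)
    · have hj := j.2
      have := hs.braid i (by omega)
      simp only [map_mul, map_inv, FreeGroup.lift_apply_of, ← hij]
      rw [mul_inv_eq_one]; exact this
    · have hj := j.2
      have := hs.comm i j hij (by omega)
      simp only [map_mul, map_inv, FreeGroup.lift_apply_of]
      rw [mul_inv_eq_one]; exact this)

theorem braidLift_gen {G : Type*} [Group G] {n : ℕ} (s : ℕ → G) (hs : IsBraiding n s) (i : ℕ)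
    (hi : i + 1 < n) : braidLift s hs (braidGen n i) = s i := by
  have h : i < n - 1 := by omega
  simp [braidGen, h, braidLift]

theorem isBraiding_gen (n : ℕ) : IsBraiding n (braidGen n) where
  braid i hi := by
    have h1 : i < n - 1 := by omega
    have h2 : i + 1 < n - 1 := by omega
    simp only [braidGen, h1, h2, dif_pos]
    exact PresentedGroup.mk_eq_mk_of_mul_inv_mem (x := _ * _ * _) (y := _ * _ * _)
      (Or.inl ⟨⟨i, h1⟩, ⟨i + 1, h2⟩, rfl, rfl⟩)
  comm i j hij hj := by
    have h1 : i < n - 1 := by omega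
    have h2 : j < n - 1 := by omega
    simp only [braidGen, h1, h2, dif_pos]
    exact PresentedGroup.mk_eq_mk_of_mul_inv_mem (x := _ * _) (y := _ * _)
      (Or.inr ⟨⟨i, h1⟩, ⟨j, h2⟩, hij, rfl⟩)

/-- Placing a braid on `n` strands onto the strands `a, …, a + n - 1` of a braid on `N` strands. -/
def shift {n N : ℕ} (a : ℕ) (h : a + n ≤ N) : Braid n →* Braid N :=
  braidLift (fun i => braidGen N (a + i))
    { braid := fun i hi => (isBraiding_gen N).braid (a + i) (by omega)
      comm := fun i j hij hj => (isBraiding_gen N).comm (a + i) (a + j) (by omega) (by omega) }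

/-- Juxtaposition of braids. -/
def juxt {p q : ℕ} (g : Braid p) (h : Braid q) : Braid (p + q) :=
  shift p (by omega) h * shift 0 (by omega) g

/-- The adjacent transposition of `i` and `i + 1`, for `i + 1 < n` (and `1` otherwise). -/
def adjSwap (n i : ℕ) : Equiv.Perm (Fin n) :=
  if h : i + 1 < n then Equiv.swap ⟨i, by omega⟩ ⟨i + 1, h⟩ else 1

theorem adjSwap_val {n i : ℕ} (h : i + 1 < n) (x : Fin n) :
    (adjSwap n i x : ℕ) = if (x : ℕ) = i then i + 1 else if (x : ℕ) = i + 1 then i else x := by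
  simp only [adjSwap, h, dif_pos, Equiv.swap_apply_def, Fin.ext_iff]
  split_ifs <;> rfl

theorem adjSwap_inv (n i : ℕ) : (adjSwap n i)⁻¹ = adjSwap n i := by
  unfold adjSwap; split_ifs <;> simp

theorem isBraiding_adjSwap (n : ℕ) : IsBraiding n (adjSwap n) where
  braid i hi := by
    ext x
    have h1 : i + 1 < n := by omega
    simp only [Equiv.Perm.mul_apply, adjSwap_val h1, adjSwap_val hi]
    split_ifs <;> omega
  comm i j hij hj := by
    ext x
    have h1 : i + 1 < n := by omega
    simp only [Equiv.Perm.mul_apply, adjSwap_val h1, adjSwap_val hj]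
    split_ifs <;> omega

/-- The homomorphism from the braid group to the symmetric group. -/
def toPerm (n : ℕ) : Braid n →* Equiv.Perm (Fin n) := braidLift (adjSwap n) (isBraiding_adjSwap n)

/-! ### Cabling -/

section Cable

variable {G : Type*} [Group G]

/-- `s a * s (a+1) * ⋯ * s (a+n-1)`: moving one strand across `n` strands lying to its left. -/
def ascProd (s : ℕ → G) (a : ℕ) : ℕ → G
  | 0 => 1
  | n + 1 => ascProd s a n * s (a + n)

/-- `s (a+n-1) * ⋯ * s (a+1) * s a`: moving one strand across `n` strands lying to its right. -/
def descProd (s : ℕ → G) (a : ℕ) : ℕ → G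
  | 0 => 1
  | n + 1 => s (a + n) * descProd s a n

/-- The effect of the generator `σⱼ` when the strand ending at position `e` is replaced by `n`
parallel strands. -/
def cableGen (s : ℕ → G) (n j e : ℕ) : G :=
  if e < j then s (j + n - 1)
  else if e = j then descProd s j n
  else if e = j + 1 then ascProd s j n
  else s j

variable {s : ℕ → G} {N : ℕ}

theorem IsBraiding.comm_asc (hs : IsBraiding N s) {b a n : ℕ}
    (h : (b + 1 < a ∧ a + n < N ∨ a + n < b ∧ b + 1 < N)) :
    Commute (s b) (ascProd s a n) := by
  induction n with
  | zero => exact Commute.one_right _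
  | succ n ih =>
    refine (ih (by omega)).mul_right ?_
    rcases h with h | h
    · exact hs.comm b (a + n) (by omega) (by omega)
    · exact (hs.comm (a + n) b (by omega) (by omega)).symm

theorem IsBraiding.comm_desc (hs : IsBraiding N s) {b a n : ℕ}
    (h : (b + 1 < a ∧ a + n < N ∨ a + n < b ∧ b + 1 < N)) :
    Commute (s b) (descProd s a n) := by
  induction n with
  | zero => exact Commute.one_right _
  | succ n ih =>
    refine Commute.mul_right ?_ (ih (by omega))
    rcases h with h | h
    · exact hs.comm b (a + n) (by omega) (by omega)
    · exact (hs.comm (a + n) b (by omega) (by omega)).symm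

theorem IsBraiding.cable_one (hs : IsBraiding N s) {a n : ℕ} (h : a + n + 1 < N) :
    descProd s a n * descProd s (a + 1) n * s a =
      s (a + n) * descProd s a n * descProd s (a + 1) n := by
  induction n with
  | zero => simp [descProd]
  | succ n ih =>
    have h1 := ih (by omega)
    have h2 : s (a + n + 1) * descProd s a n = descProd s a n * s (a + n + 1) :=
      hs.comm_desc (b := a + n + 1) (Or.inr ⟨by omega, by omega⟩)
    have h3 := hs.braid (a + n) (by omega)
    have e : a + 1 + n = a + n + 1 := by omega
    have e' : a + (n + 1) = a + n + 1 := by omega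
    simp only [descProd, e, e']
    calc s (a + n) * descProd s a n * (s (a + n + 1) * descProd s (a + 1) n) * s a
        = s (a + n) * (descProd s a n * s (a + n + 1)) * descProd s (a + 1) n * s a := by group
      _ = s (a + n) * s (a + n + 1) * (descProd s a n * descProd s (a + 1) n * s a) := by
          rw [← h2]; group
      _ = (s (a + n) * s (a + n + 1) * s (a + n)) * descProd s a n * descProd s (a + 1) n := by
          rw [h1]; group
      _ = s (a + n + 1) * s (a + n) * (s (a + n + 1) * descProd s a n)
            * descProd s (a + 1) n := by rw [h3]; group
      _ = _ := by rw [h2]; group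

theorem IsBraiding.cable_two (hs : IsBraiding N s) {a n : ℕ} (h : a + n + 1 < N) :
    ascProd s a n * s (a + n) * descProd s a n =
      descProd s (a + 1) n * s a * ascProd s (a + 1) n := by
  induction n with
  | zero => simp [descProd, ascProd]
  | succ n ih =>
    have h1 := ih (by omega)
    have h2 : s (a + n + 1) * descProd s a n = descProd s a n * s (a + n + 1) :=
      hs.comm_desc (b := a + n + 1) (Or.inr ⟨by omega, by omega⟩)
    have h2' : s (a + n + 1) * ascProd s a n = ascProd s a n * s (a + n + 1) :=
      hs.comm_asc (b := a + n + 1) (Or.inr ⟨by omega, by omega⟩)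
    have h3 := hs.braid (a + n) (by omega)
    have e : a + 1 + n = a + n + 1 := by omega
    have e' : a + (n + 1) = a + n + 1 := by omega
    simp only [descProd, ascProd, e, e']
    calc ascProd s a n * s (a + n) * s (a + n + 1) * (s (a + n) * descProd s a n)
        = ascProd s a n * (s (a + n) * s (a + n + 1) * s (a + n)) * descProd s a n := by group
      _ = (ascProd s a n * s (a + n + 1)) * s (a + n) * (s (a + n + 1) * descProd s a n) := by
          rw [h3]; group
      _ = s (a + n + 1) * (ascProd s a n * s (a + n) * descProd s a n) * s (a + n + 1) := by
          rw [h2, ← h2']; group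
      _ = _ := by rw [h1]; group

theorem IsBraiding.cable_three (hs : IsBraiding N s) {a n : ℕ} (h : a + n + 1 < N) :
    s a * ascProd s (a + 1) n * ascProd s a n =
      ascProd s (a + 1) n * ascProd s a n * s (a + n) := by
  induction n with
  | zero => simp [ascProd]
  | succ n ih =>
    have h1 := ih (by omega)
    have h2 : s (a + n + 1) * ascProd s a n = ascProd s a n * s (a + n + 1) :=
      hs.comm_asc (b := a + n + 1) (Or.inr ⟨by omega, by omega⟩)
    have h3 := hs.braid (a + n) (by omega)
    have e : a + 1 + n = a + n + 1 := by omega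
    have e' : a + (n + 1) = a + n + 1 := by omega
    simp only [ascProd, e, e']
    calc s a * (ascProd s (a + 1) n * s (a + n + 1)) * (ascProd s a n * s (a + n))
        = s a * ascProd s (a + 1) n * (s (a + n + 1) * ascProd s a n) * s (a + n) := by group
      _ = (s a * ascProd s (a + 1) n * ascProd s a n) * s (a + n + 1) * s (a + n) := by
          rw [h2]; group
      _ = ascProd s (a + 1) n * ascProd s a n * (s (a + n) * s (a + n + 1) * s (a + n)) := by
          rw [h1]; group
      _ = ascProd s (a + 1) n * (ascProd s a n * s (a + n + 1)) * s (a + n) * s (a + n + 1) := by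
          rw [h3]; group
      _ = _ := by rw [← h2]; group

/-- The pair (cabled braids, permutation) attached to a generator; the function component is
indexed by the end position of the cabled strand. -/
def wreathGen (s : ℕ → G) (m n j : ℕ) :
    (Fin m → G) ⋊[mulAutArrow] Equiv.Perm (Fin m) :=
  ⟨fun e => cableGen s n j e, adjSwap m j⟩

theorem wreath_mul_left {m : ℕ} (x y : (Fin m → G) ⋊[mulAutArrow] Equiv.Perm (Fin m)) (e : Fin m) :
    (x * y).left e = x.left e * y.left (x.right⁻¹ e) := rfl

theorem cableGen_lt {n j e : ℕ} (h : e < j) : cableGen s n j e = s (j + n - 1) := by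
  simp [cableGen, h]

theorem cableGen_eq {n j e : ℕ} (h : e = j) : cableGen s n j e = descProd s j n := by
  simp [cableGen, h]

theorem cableGen_succ {n j e : ℕ} (h : e = j + 1) : cableGen s n j e = ascProd s j n := by
  simp [cableGen, h]

theorem cableGen_gt {n j e : ℕ} (h : j + 1 < e) : cableGen s n j e = s j := by
  have h1 : ¬ e < j := by omega
  have h2 : ¬ e = j := by omega
  have h3 : ¬ e = j + 1 := by omega
  simp [cableGen, h1, h2, h3]

theorem IsBraiding.wreath {m n : ℕ} (hs : IsBraiding N s) (h : m + n = N + 1) :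
    IsBraiding m (wreathGen s m n) where
  braid i hi := by
    have hi1 : i + 1 < m := by omega
    refine SemidirectProduct.ext ?_ ((isBraiding_adjSwap m).braid i hi)
    funext e
    have he := e.2
    simp only [wreath_mul_left, SemidirectProduct.mul_right, wreathGen, mul_inv_rev, adjSwap_inv,
      Equiv.Perm.mul_apply, adjSwap_val hi1, adjSwap_val hi]
    generalize (e : ℕ) = x at he
    have hx : x < i ∨ x = i ∨ x = i + 1 ∨ x = i + 2 ∨ i + 2 < x := by omega
    rcases hx with hx | rfl | rfl | rfl | hx
    · simp (disch := omega) only [if_true, if_neg, cableGen_lt]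
      have := hs.braid (i + n - 1) (by omega)
      rwa [show i + n - 1 + 1 = i + 1 + n - 1 by omega] at this
    · simp (disch := omega) only [if_true, if_pos, if_neg, cableGen_lt, cableGen_eq, cableGen_gt]
      rw [show x + 1 + n - 1 = x + n by omega]
      exact hs.cable_one (by omega)
    · simp (disch := omega) only [if_true, if_pos, if_neg, cableGen_lt, cableGen_eq, cableGen_gt,
        cableGen_succ]
      rw [show i + 1 + n - 1 = i + n by omega]
      exact hs.cable_two (by omega)
    · simp (disch := omega) only [if_true, if_pos, if_neg, cableGen_lt, cableGen_gt, cableGen_succ]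
      rw [show i + 1 + n - 1 = i + n by omega]
      exact hs.cable_three (by omega)
    · simp (disch := omega) only [if_true, if_neg, cableGen_gt]
      exact hs.braid i (by omega)
  comm i j hij hj := by
    have hi1 : i + 1 < m := by omega
    refine SemidirectProduct.ext ?_ ((isBraiding_adjSwap m).comm i j hij hj)
    funext e
    have he := e.2
    simp only [wreath_mul_left, wreathGen, adjSwap_inv, adjSwap_val hi1, adjSwap_val hj]
    generalize (e : ℕ) = x at he
    have hx : x < i ∨ x = i ∨ x = i + 1 ∨ (i + 1 < x ∧ x < j) ∨ x = j ∨ x = j + 1 ∨ j + 1 < x := by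
      omega
    rcases hx with hx | rfl | rfl | hx | rfl | rfl | hx
    · simp (disch := omega) only [if_true, if_neg, cableGen_lt]
      exact hs.comm _ _ (by omega) (by omega)
    · simp (disch := omega) only [if_true, if_pos, if_neg, cableGen_lt, cableGen_eq]
      exact (hs.comm_desc (Or.inr ⟨by omega, by omega⟩)).symm
    · simp (disch := omega) only [if_true, if_pos, if_neg, cableGen_lt, cableGen_succ]
      exact (hs.comm_asc (Or.inr ⟨by omega, by omega⟩)).symm
    · simp (disch := omega) only [if_true, if_neg, cableGen_lt, cableGen_gt]
      exact hs.comm _ _ (by omega) (by omega)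
    · simp (disch := omega) only [if_true, if_pos, if_neg, cableGen_eq, cableGen_gt]
      exact hs.comm_desc (Or.inl ⟨by omega, by omega⟩)
    · simp (disch := omega) only [if_true, if_pos, if_neg, cableGen_succ, cableGen_gt]
      exact hs.comm_asc (Or.inl ⟨by omega, by omega⟩)
    · simp (disch := omega) only [if_true, if_neg, cableGen_gt]
      exact hs.comm _ _ (by omega) (by omega)

end Cable

/-- A braid together with all its cablings, as an element of a wreath product. -/
def wreath {m n N : ℕ} (h : m + n = N + 1) :
    Braid m →* (Fin m → Braid N) ⋊[mulAutArrow] Equiv.Perm (Fin m) :=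
  braidLift (wreathGen (braidGen N) m n) ((isBraiding_gen N).wreath h)

theorem wreath_right {m n N : ℕ} (h : m + n = N + 1) (γ : Braid m) :
    (wreath h γ).right = toPerm m γ := by
  have : SemidirectProduct.rightHom.comp (wreath h) = toPerm m := by
    refine PresentedGroup.ext fun i => ?_
    simp [wreath, toPerm, braidLift, wreathGen]
  exact DFunLike.congr_fun this γ

/-- The braid obtained from `γ` by replacing the strand starting at `i` by `n` parallel strands. -/
def cable {m n N : ℕ} (h : m + n = N + 1) (i : Fin m) (γ : Braid m) : Braid N :=
  (wreath h γ).left (toPerm m γ i)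

theorem cable_mul {m n N : ℕ} (h : m + n = N + 1) (i : Fin m) (γ δ : Braid m) :
    cable h i (γ * δ) = cable h (toPerm m δ i) γ * cable h i δ := by
  unfold cable
  rw [map_mul, wreath_mul_left, wreath_right, map_mul]
  simp [Equiv.Perm.mul_apply]

/-- The cabling `γ ∘ᵢ ρ` of braids: `ρ` is inserted in a tube around the strand of `γ` starting at
position `i`. -/
def cabling {m n N : ℕ} (h : m + n = N + 1) (i : Fin m) (γ : Braid m) (ρ : Braid n) : Braid N :=
  cable h i γ * shift i (by omega) ρ

theorem cable_one' {m n N : ℕ} (h : m + n = N + 1) (i : Fin m) : cable h i 1 = 1 := by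
  have := cable_mul h i 1 1
  simpa using this

theorem cable_gen {m n N : ℕ} (h : m + n = N + 1) (i : Fin m) (j : ℕ) (hj : j + 1 < m) :
    cable h i (braidGen m j) = cableGen (braidGen N) n j (adjSwap m j i) := by
  unfold cable wreath toPerm
  rw [braidLift_gen _ _ _ hj, braidLift_gen _ _ _ hj]
  rfl

theorem cable_shift_one {p q : ℕ} (h : q + 1 + p = p + q + 1) (x : Braid q) :
    toPerm (q + 1) (shift (N := q + 1) 1 (by omega) x) 0 = 0 ∧
      cable h 0 (shift (N := q + 1) 1 (by omega) x) = shift p le_rfl x := by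
  have hx : x ∈ Subgroup.closure (Set.range (PresentedGroup.of (rels := braidRels q))) := by
    rw [PresentedGroup.closure_range_of]; trivial
  induction hx using Subgroup.closure_induction with
  | mem x hx =>
    obtain ⟨j, rfl⟩ := hx
    have hj := j.2
    have e : PresentedGroup.of j = braidGen q j := by simp [braidGen]
    have e0 : adjSwap (q + 1) (1 + j) 0 = 0 := by
      ext; rw [adjSwap_val (by omega)]; simp; omega
    rw [e, shift, shift, braidLift_gen _ _ _ (by omega), braidLift_gen _ _ _ (by omega), toPerm,
      braidLift_gen _ _ _ (by omega), cable_gen _ _ _ (by omega), e0]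
    refine ⟨rfl, ?_⟩
    rw [cableGen_lt (by simp)]
    congr 1
    omega
  | one => simp [cable_one']
  | mul x y _ _ hx hy =>
    rw [map_mul, map_mul, map_mul, cable_mul, hy.1, hx.2, hy.2, Equiv.Perm.mul_apply, hy.1]
    exact ⟨hx.1, rfl⟩
  | inv x _ hx =>
    have h1 : toPerm (q + 1) (shift (N := q + 1) 1 (by omega) x⁻¹) 0 = 0 := by
      rw [map_inv, map_inv, Equiv.Perm.inv_eq_iff_eq]; exact hx.1.symm
    refine ⟨h1, ?_⟩
    have h2 := cable_mul h 0 (shift (N := q + 1) 1 (by omega) x) (shift (N := q + 1) 1 (by omega) x⁻¹)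
    rw [h1, hx.2, ← map_mul, mul_inv_cancel, map_one, cable_one'] at h2
    rw [map_inv (shift p le_rfl) x, eq_inv_of_mul_eq_one_right h2.symm]

/-- Juxtaposition is the operadic composite of the trivial braid on two strands with two braids. -/
theorem cabling_one_two {p q : ℕ} (g : Braid p) (h : Braid q) :
    cabling (N := p + q) (show q + 1 + p = p + q + 1 by omega) 0
      (cabling (N := q + 1) (show 2 + q = q + 1 + 1 by omega) 1 (1 : Braid 2) h) g =
      juxt g h := by
  have h1 := cable_shift_one (p := p) (show q + 1 + p = p + q + 1 by omega) h
  unfold cabling juxt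
  rw [cable_one', one_mul]
  exact congrArg (· * _) h1.2

/-- The subgroup of pure braids all of whose cablings lie in `R`. -/
def cableKer {m n N : ℕ} (h : m + n = N + 1) (R : FiniteIndexNormalSubgroup (Braid N)) :
    FiniteIndexNormalSubgroup (Braid m) :=
  let φ : (Fin m → Braid N) ⋊[mulAutArrow] Equiv.Perm (Fin m) →*
      (Fin m → Braid N ⧸ R.toSubgroup) ⋊[mulAutArrow] Equiv.Perm (Fin m) :=
    SemidirectProduct.map ((QuotientGroup.mk' R.toSubgroup).compLeft (Fin m)) (MonoidHom.id _)
      (fun _ => rfl)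
  haveI : Finite ((Fin m → Braid N ⧸ R.toSubgroup) ⋊[mulAutArrow] Equiv.Perm (Fin m)) :=
    Finite.of_equiv _ SemidirectProduct.equivProd.symm
  haveI : (φ.comp (wreath h)).ker.FiniteIndex := Subgroup.finiteIndex_ker _
  .ofSubgroup (φ.comp (wreath h)).ker

theorem mem_cableKer {m n N : ℕ} {h : m + n = N + 1} {R : FiniteIndexNormalSubgroup (Braid N)}
    {p : Braid m} : p ∈ (cableKer h R).toSubgroup ↔
      toPerm m p = 1 ∧ ∀ i, cable h i p ∈ R.toSubgroup := by
  simp only [cableKer, FiniteIndexNormalSubgroup.toSubgroup_ofSubgroup, MonoidHom.mem_ker,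
    MonoidHom.comp_apply]
  constructor
  · intro hp
    have h1 : toPerm m p = 1 := by
      rw [← wreath_right h]; exact congrArg SemidirectProduct.right hp
    refine ⟨h1, fun i => ?_⟩
    have h2 := congrFun (congrArg SemidirectProduct.left hp) i
    rw [cable, h1]
    exact (QuotientGroup.eq_one_iff _).1 h2
  · rintro ⟨h1, h2⟩
    refine SemidirectProduct.ext (funext fun i => (QuotientGroup.eq_one_iff _).2 ?_) ?_
    · have := h2 i
      rwa [cable, h1] at this
    · exact (wreath_right h p).trans h1

theorem cableKer_mono {m n N : ℕ} (h : m + n = N + 1) {R R' : FiniteIndexNormalSubgroup (Braid N)}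
    (hR : R ≤ R') : cableKer h R ≤ cableKer h R' := fun _ hp =>
  mem_cableKer.2 ⟨(mem_cableKer.1 hp).1, fun i => hR ((mem_cableKer.1 hp).2 i)⟩

theorem cabling_congr {m n N : ℕ} (h : m + n = N + 1) (i : Fin m)
    (R : FiniteIndexNormalSubgroup (Braid N)) {γ γ' : Braid m} {ρ ρ' : Braid n}
    (hγ : γ⁻¹ * γ' ∈ (cableKer h R).toSubgroup)
    (hρ : ρ⁻¹ * ρ' ∈ R.toSubgroup.comap (shift (N := N) i (by omega))) :
    (QuotientGroup.mk (cabling h i γ ρ) : Braid N ⧸ R.toSubgroup) =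
      QuotientGroup.mk (cabling h i γ' ρ') := by
  obtain ⟨h1, h2'⟩ := mem_cableKer.1 hγ
  have h2 := h2' i
  have e : cable h i γ' = cable h i γ * cable h i (γ⁻¹ * γ') := by
    conv_lhs => rw [show γ' = γ * (γ⁻¹ * γ') by group, cable_mul, h1]
    rfl
  unfold cabling
  rw [QuotientGroup.mk_mul, QuotientGroup.mk_mul, e, QuotientGroup.mk_mul,
    (QuotientGroup.eq_one_iff _).2 h2, mul_one]
  congr 1
  rw [QuotientGroup.eq, ← map_inv, ← map_mul]
  exact hρ

/-! ### The Matsumoto section and the quantum symmetrizer -/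

/-- The permutation of `Fin n` obtained from a permutation of `Fin (n + 1)` by forgetting the last
point and its image. -/
def restrictLast {n : ℕ} (τ : Equiv.Perm (Fin (n + 1))) : Equiv.Perm (Fin n) :=
  Equiv.removeNone
    ((finSuccEquiv' (Fin.last n)).symm.trans (τ.trans (finSuccEquiv' (τ (Fin.last n)))))

theorem restrictLast_spec {n : ℕ} (τ : Equiv.Perm (Fin (n + 1))) (a : Fin n) :
    (τ (Fin.last n)).succAbove (restrictLast τ a) = τ a.castSucc := by
  have h := Equiv.removeNone_some
    ((finSuccEquiv' (Fin.last n)).symm.trans (τ.trans (finSuccEquiv' (τ (Fin.last n))))) (x := a) (by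
      have : τ a.castSucc ≠ τ (Fin.last n) := fun h =>
        (Fin.castSucc_lt_last a).ne (τ.injective h)
      obtain ⟨b, hb⟩ := Fin.exists_succAbove_eq this
      exact ⟨b, by simp [← hb]⟩)
  have h2 := congrArg (finSuccEquiv' (τ (Fin.last n))).symm h
  simpa [restrictLast] using h2

/-- A reduced word for `τ`. -/
def matsumotoWord : (n : ℕ) → Equiv.Perm (Fin n) → List ℕ
  | 0, _ => []
  | n + 1, τ => List.range' (τ (Fin.last n)) (n - τ (Fin.last n)) ++ matsumotoWord n (restrictLast τ)

theorem matsumotoWord_lt : ∀ (n : ℕ) (τ : Equiv.Perm (Fin n)), ∀ i ∈ matsumotoWord n τ, i + 1 < n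
  | 0, _ => by simp [matsumotoWord]
  | n + 1, τ => by
    intro i hi
    rcases List.mem_append.1 hi with hi | hi
    · have := List.mem_range'_1.1 hi
      omega
    · have := matsumotoWord_lt n _ i hi
      omega

theorem succAbove_val {n : ℕ} (p : Fin (n + 1)) (x : Fin n) :
    (p.succAbove x : ℕ) = if (x : ℕ) < p then (x : ℕ) else x + 1 := by
  rw [Fin.succAbove]
  split_ifs with h1 h2 h2 <;> simp_all [Fin.lt_def]

theorem range'_prod_val {n : ℕ} : ∀ (l j : ℕ), j + l = n → ∀ x : Fin (n + 1),
    ((((List.range' j l).map (adjSwap (n + 1))).prod x : Fin (n + 1)) : ℕ) =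
      if (x : ℕ) = n then j else if j ≤ x then x + 1 else x
  | 0, j, h, x => by
    have := x.2
    simp only [List.range'_zero, List.map_nil, List.prod_nil, Equiv.Perm.one_apply]
    split_ifs <;> omega
  | l + 1, j, h, x => by
    have := x.2
    rw [List.range'_succ, List.map_cons, List.prod_cons, Equiv.Perm.mul_apply,
      adjSwap_val (by omega), range'_prod_val l (j + 1) (by omega) x]
    split_ifs <;> omega

theorem word_castSucc_val {n : ℕ} : ∀ (w : List ℕ), (∀ i ∈ w, i + 1 < n) → 
    (w.map (adjSwap (n + 1))).prod (Fin.last n) = Fin.last n ∧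
    ∀ x : Fin n, (w.map (adjSwap (n + 1))).prod x.castSucc = ((w.map (adjSwap n)).prod x).castSucc
  | [], _ => by simp
  | i :: w, hw => by
    obtain ⟨h1, h2⟩ := word_castSucc_val w (fun j hj => hw j (by simp [hj]))
    have hi : i + 1 < n := hw i (by simp)
    refine ⟨?_, fun x => ?_⟩
    · rw [List.map_cons, List.prod_cons, Equiv.Perm.mul_apply, h1]
      ext
      rw [adjSwap_val (by omega), Fin.val_last]
      split_ifs <;> omega
    · rw [List.map_cons, List.prod_cons, Equiv.Perm.mul_apply, h2, List.map_cons, List.prod_cons,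
        Equiv.Perm.mul_apply]
      ext
      rw [adjSwap_val (by omega), Fin.val_castSucc, Fin.val_castSucc, adjSwap_val hi]

/-- The word `matsumotoWord n τ` represents `τ`. -/
theorem matsumotoWord_prod : ∀ (n : ℕ) (τ : Equiv.Perm (Fin n)),
    ((matsumotoWord n τ).map (adjSwap n)).prod = τ
  | 0, _ => by ext x; exact x.elim0
  | n + 1, τ => by
    obtain ⟨h1, h2⟩ := word_castSucc_val (matsumotoWord n (restrictLast τ))
      (matsumotoWord_lt n (restrictLast τ))
    have ih := matsumotoWord_prod n (restrictLast τ)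
    have hl : (τ (Fin.last n) : ℕ) + (n - τ (Fin.last n)) = n := by omega
    ext x
    rw [matsumotoWord, List.map_append, List.prod_append, Equiv.Perm.mul_apply,
      range'_prod_val _ _ hl]
    refine Fin.lastCases ?_ (fun x => ?_) x
    · rw [h1]; simp
    · rw [h2, ih, ← restrictLast_spec, succAbove_val, Fin.val_castSucc]
      have := (restrictLast τ x).2
      split_ifs <;> omega

theorem matsumotoWord_length_adjSwap_mul : ∀ (n : ℕ) (τ : Equiv.Perm (Fin n)) (i : ℕ), i + 1 < n →
    (matsumotoWord n (adjSwap n i * τ)).length ≤ (matsumotoWord n τ).length + 1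
  | 0, _, _, hi => by omega
  | n + 1, τ, i, hi => by
    have key : ∀ (a : Fin n), (((adjSwap (n + 1) i * τ) (Fin.last n)).succAbove
        (restrictLast (adjSwap (n + 1) i * τ) a) : ℕ) = adjSwap (n + 1) i
          ((τ (Fin.last n)).succAbove (restrictLast τ a)) := fun a => by
      rw [restrictLast_spec, restrictLast_spec]; rfl
    simp only [succAbove_val, adjSwap_val hi, Equiv.Perm.mul_apply] at key
    have hj := (τ (Fin.last n)).2
    simp only [matsumotoWord, List.length_append, List.length_range', Equiv.Perm.mul_apply,
      adjSwap_val hi]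
    by_cases h1 : (τ (Fin.last n) : ℕ) = i ∨ (τ (Fin.last n) : ℕ) = i + 1
    · have : restrictLast (adjSwap (n + 1) i * τ) = restrictLast τ := by
        ext a
        have := key a
        split_ifs at this <;> omega
      rw [this]
      split_ifs <;> omega
    · rw [if_neg (by omega), if_neg (by omega)] at key ⊢
      obtain ⟨i', hi', hii⟩ : ∃ i', i' + 1 < n ∧
          (i < (τ (Fin.last n) : ℕ) ∧ i' = i ∨ (τ (Fin.last n) : ℕ) < i ∧ i = i' + 1) := by
        rcases Nat.lt_or_ge i (τ (Fin.last n)) with h | h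
        · exact ⟨i, by omega, Or.inl ⟨h, rfl⟩⟩
        · exact ⟨i - 1, by omega, Or.inr ⟨by omega, by omega⟩⟩
      have h2 : restrictLast (adjSwap (n + 1) i * τ) = adjSwap n i' * restrictLast τ := by
        ext a
        have h4 := key a
        rw [Equiv.Perm.mul_apply, adjSwap_val hi']
        clear key
        generalize ((restrictLast (adjSwap (n + 1) i * τ)) a : ℕ) = y at *
        generalize (restrictLast τ a : ℕ) = z at *
        generalize (τ (Fin.last n) : ℕ) = j at *
        split_ifs at h4 ⊢ <;> omega
      have h3 := matsumotoWord_length_adjSwap_mul n (restrictLast τ) i' hi'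
      rw [h2]
      omega

theorem matsumotoWord_one : ∀ n : ℕ, matsumotoWord n 1 = []
  | 0 => rfl
  | n + 1 => by
    have : restrictLast (1 : Equiv.Perm (Fin (n + 1))) = 1 := by
      ext a
      have h := congrArg Fin.val (restrictLast_spec 1 a)
      have := (restrictLast 1 a).2
      simp only [succAbove_val, Equiv.Perm.one_apply, Fin.val_last, Fin.val_castSucc] at h
      rw [if_pos this] at h
      simpa using h
    simp [matsumotoWord, this, matsumotoWord_one n]

/-- The word `matsumotoWord n τ` has minimal length among the words representing `τ`. -/
theorem matsumotoWord_minimal (n : ℕ) : ∀ (w : List ℕ), (∀ i ∈ w, i + 1 < n) →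
    (matsumotoWord n (w.map (adjSwap n)).prod).length ≤ w.length
  | [], _ => by simp [matsumotoWord_one]
  | i :: w, hw => by
    have h1 := matsumotoWord_minimal n w (fun j hj => hw j (by simp [hj]))
    have h2 := matsumotoWord_length_adjSwap_mul n (w.map (adjSwap n)).prod i (hw i (by simp))
    simp only [List.map_cons, List.prod_cons, List.length_cons]
    omega

/-- The Matsumoto lift of a permutation: replace the letters of a reduced word by braids. -/
def matsumoto (n : ℕ) (τ : Equiv.Perm (Fin n)) : Braid n :=
  ((matsumotoWord n τ).map (braidGen n)).prod

section Symmetrizers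

variable (k : Type w) [Field k]

/-- The quantum symmetrizer, the sum of the Matsumoto lifts of all permutations. -/
def quantumSymmetrizer (n : ℕ) : MonoidAlgebra k (Braid n) :=
  ∑ τ : Equiv.Perm (Fin n), MonoidAlgebra.single (matsumoto n τ) 1

/-- `(p, n - p)`-shuffles: permutations of `Fin n` that are increasing on the first `p` elements and
on the remaining ones. -/
def IsShuffle {n : ℕ} (p : ℕ) (τ : Equiv.Perm (Fin n)) : Prop :=
  ∀ i j : Fin n, i < j → ((j : ℕ) < p ∨ p ≤ (i : ℕ)) → τ i < τ j

open Classical in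
/-- The sum of the Matsumoto lifts of all `(p, n - p)`-shuffles. -/
def shuffleSum (n p : ℕ) : MonoidAlgebra k (Braid n) :=
  ∑ τ : Equiv.Perm (Fin n) with IsShuffle p τ, MonoidAlgebra.single (matsumoto n τ) 1

end Symmetrizers

/-! ### Pro-objects -/

/-- A pro-object: a diagram indexed by a small cofiltered category. -/
structure Pro (C : Type u) [Category.{v} C] where
  /-- The indexing category. -/
  ι : Type t
  [cat : SmallCategory ι]
  [cofiltered : IsCofiltered ι]
  /-- The diagram. -/
  diag : ι ⥤ C

namespace Pro

attribute [instance] Pro.cat Pro.cofiltered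

variable {C : Type u} [Category.{v} C]

/-- Two maps out of terms of a pro-object are identified if they agree after restriction to a common
refinement. -/
def germSetoid (X : Pro.{t} C) (c : C) : Setoid (Σ i : X.ι, X.diag.obj i ⟶ c) where
  r a b := ∃ (l : X.ι) (f : l ⟶ a.1) (g : l ⟶ b.1), X.diag.map f ≫ a.2 = X.diag.map g ≫ b.2
  iseqv :=
    { refl := fun a => ⟨a.1, 𝟙 _, 𝟙 _, rfl⟩
      symm := fun ⟨l, f, g, h⟩ => ⟨l, g, f, h.symm⟩
      trans := by
        rintro a b c ⟨l, f, g, h⟩ ⟨l', f', g', h'⟩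
        obtain ⟨m, p, q, e⟩ := IsCofiltered.cospan g f'
        refine ⟨m, p ≫ f, q ≫ g', ?_⟩
        rw [Functor.map_comp, Functor.map_comp, Category.assoc, Category.assoc, h, ← h',
          ← Category.assoc, ← Functor.map_comp, e, Functor.map_comp, Category.assoc] }

/-- The filtered colimit `colim_i Hom(X_i, c)`. -/
def Germ (X : Pro.{t} C) (c : C) : Type (max t v) := Quotient (germSetoid X c)

/-- The class of a map `X_i ⟶ c`. -/
def Germ.mk {X : Pro.{t} C} {c : C} (i : X.ι) (f : X.diag.obj i ⟶ c) : Germ X c :=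
  Quotient.mk (germSetoid X c) ⟨i, f⟩

theorem Germ.ind {X : Pro.{t} C} {c : C} {p : Germ X c → Prop} (h : ∀ i f, p (Germ.mk i f))
    (a : Germ X c) : p a := Quotient.ind (fun ⟨i, f⟩ => h i f) a

theorem Germ.sound {X : Pro.{t} C} {c : C} {i j l : X.ι} {f : X.diag.obj i ⟶ c}
    {g : X.diag.obj j ⟶ c} (a : l ⟶ i) (b : l ⟶ j) (h : X.diag.map a ≫ f = X.diag.map b ≫ g) :
    Germ.mk i f = Germ.mk j g := Quotient.sound ⟨l, a, b, h⟩

theorem Germ.mk_eq {X : Pro.{t} C} {c : C} {i j : X.ι} {f : X.diag.obj i ⟶ c}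
    {g : X.diag.obj j ⟶ c} (b : i ⟶ j) (h : f = X.diag.map b ≫ g) :
    Germ.mk i f = Germ.mk j g := Germ.sound (𝟙 i) b (by simpa using h)

/-- Postcomposition of a class with a map. -/
def Germ.postcomp {X : Pro.{t} C} {c d : C} (a : Germ X c) (h : c ⟶ d) : Germ X d :=
  Quotient.map (fun x => ⟨x.1, x.2 ≫ h⟩)
    (by rintro _ _ ⟨l, f, g, e⟩; exact ⟨l, f, g, by simp [reassoc_of% e]⟩) a

/-- Morphisms `X ⟶ Y` of pro-objects: elements of `lim_j colim_i Hom(X_i, Y_j)`. -/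
@[ext]
structure Hom (X Y : Pro.{t} C) where
  /-- The components. -/
  germ : ∀ j : Y.ι, Germ X (Y.diag.obj j)
  compat : ∀ {j j' : Y.ι} (f : j ⟶ j'), (germ j).postcomp (Y.diag.map f) = germ j'

/-- Substitution of a morphism of pro-objects in a class. -/
def Hom.precomp {X Y : Pro.{t} C} (f : Hom X Y) {c : C} (a : Germ Y c) : Germ X c :=
  Quotient.lift (fun x : Σ j : Y.ι, Y.diag.obj j ⟶ c => (f.germ x.1).postcomp x.2) (by
    rintro ⟨j, x⟩ ⟨j', x'⟩ ⟨l, p, q, e⟩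
    have h1 : ∀ (g : Germ X (Y.diag.obj l)), (g.postcomp (Y.diag.map p)).postcomp x =
        (g.postcomp (Y.diag.map q)).postcomp x' := by
      refine Germ.ind fun i g => ?_
      change Germ.mk i _ = Germ.mk i _
      simp only [Category.assoc]
      exact congrArg _ (congrArg _ e)
    have h2 := h1 (f.germ l)
    rwa [f.compat, f.compat] at h2) a

instance : Category (Pro.{t} C) where
  Hom X Y := Hom X Y
  id X :=
    { germ := fun j => Germ.mk j (𝟙 _)
      compat := fun {j j'} f => Germ.sound (𝟙 _) f (by simp) }
  comp {X Y Z} f g :=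
    { germ := fun l => Hom.precomp f (g.germ l)
      compat := fun {l l'} h => by
        rw [← g.compat h]
        generalize g.germ l = a
        induction a using Germ.ind with | h j a =>
        change ((f.germ j).postcomp a).postcomp _ = (f.germ j).postcomp (a ≫ _)
        generalize f.germ j = b
        induction b using Germ.ind with | h i b =>
        change Germ.mk i _ = Germ.mk i _
        simp }
  id_comp {X Y} f := by
    refine Hom.ext (funext fun j => ?_)
    change Hom.precomp _ (f.germ j) = f.germ j
    generalize f.germ j = a
    induction a using Germ.ind with | h i a =>
    change Germ.mk i (𝟙 _ ≫ a) = _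
    simp
  comp_id {X Y} f := by
    refine Hom.ext (funext fun j => ?_)
    change (f.germ j).postcomp (𝟙 _) = f.germ j
    generalize f.germ j = a
    induction a using Germ.ind with | h i a =>
    change Germ.mk i (a ≫ 𝟙 _) = _
    simp
  assoc {W X Y Z} f g h := by
    refine Hom.ext (funext fun j => ?_)
    change Hom.precomp _ (h.germ j) = Hom.precomp f (Hom.precomp g (h.germ j))
    generalize h.germ j = a
    induction a using Germ.ind with | h l a =>
    change (Hom.precomp f (g.germ l)).postcomp a = Hom.precomp f ((g.germ l).postcomp a)
    generalize g.germ l = b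
    induction b using Germ.ind with | h m b =>
    change ((f.germ m).postcomp b).postcomp a = (f.germ m).postcomp (b ≫ a)
    generalize f.germ m = c
    induction c using Germ.ind with | h n c =>
    change Germ.mk n _ = Germ.mk n _
    simp

@[ext]
theorem hom_ext {X Y : Pro.{t} C} {f g : X ⟶ Y} (h : ∀ j, f.germ j = g.germ j) : f = g :=
  Hom.ext (funext h)

theorem comp_germ {X Y Z : Pro.{t} C} (f : X ⟶ Y) (g : Y ⟶ Z) (l : Z.ι) :
    (f ≫ g).germ l = Hom.precomp f (g.germ l) := rfl

theorem id_germ {X : Pro.{t} C} (l : X.ι) : Hom.germ (𝟙 X) l = Germ.mk l (𝟙 _) := rfl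

/-- The morphism given by a functor between the indexing categories and a natural family of maps. -/
def homMk {X Y : Pro.{t} C} (φ : Y.ι ⥤ X.ι) (a : φ ⋙ X.diag ⟶ Y.diag) : X ⟶ Y where
  germ j := Germ.mk (φ.obj j) (a.app j)
  compat {j j'} f := Germ.sound (𝟙 _) (φ.map f) (by simpa using (a.naturality f).symm)

/-- A pro-object is strict if all the maps of its diagram are epimorphisms. -/
def IsStrict (X : Pro.{t} C) : Prop := ∀ ⦃i j : X.ι⦄ (f : i ⟶ j), Epi (X.diag.map f)

variable (C) in
/-- Constant pro-objects. -/
def const : C ⥤ Pro.{t} C where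
  obj c := { ι := Discrete PUnit.{t + 1}, diag := (Functor.const _).obj c }
  map f := homMk (𝟭 _) ((Functor.const _).map f)
  map_id c := rfl
  map_comp f g := rfl

section Monoidal

variable [MonoidalCategory C]

/-- The tensor product of pro-objects, indexed by the product of the indexing categories. -/
def tensor (X Y : Pro.{t} C) : Pro.{t} C where
  ι := X.ι × Y.ι
  diag := X.diag.prod Y.diag ⋙ MonoidalCategory.tensor C

/-- The tensor product of classes. -/
def Germ.tensor {X Y : Pro.{t} C} {c d : C} (a : Germ X c) (b : Germ Y d) :
    Germ (Pro.tensor X Y) (c ⊗ d) :=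
  Quotient.map₂ (fun x y => ⟨(x.1, y.1), x.2 ⊗ₘ y.2⟩) (by
    rintro _ _ ⟨l, f, g, e⟩ _ _ ⟨l', f', g', e'⟩
    refine ⟨(l, l'), (f, f'), (g, g'), ?_⟩
    change (X.diag.map f ⊗ₘ Y.diag.map f') ≫ _ = (X.diag.map g ⊗ₘ Y.diag.map g') ≫ _
    simp only [MonoidalCategory.tensorHom_comp_tensorHom]
    rw [e, e']) a b

/-- The tensor product of morphisms. -/
def tensorMap {X X' Y Y' : Pro.{t} C} (f : X ⟶ X') (g : Y ⟶ Y') :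
    Pro.tensor X Y ⟶ Pro.tensor X' Y' where
  germ j := (f.germ j.1).tensor (g.germ j.2)
  compat {j j'} h := by
    change ((f.germ j.1).tensor (g.germ j.2)).postcomp (X'.diag.map h.1 ⊗ₘ Y'.diag.map h.2) = _
    rw [← f.compat h.1, ← g.compat h.2]
    generalize f.germ j.1 = a
    generalize g.germ j.2 = b
    induction a using Germ.ind with | h i a =>
    induction b using Germ.ind with | h i' b =>
    exact congrArg (Germ.mk (X := Pro.tensor X Y) (i, i'))
      (MonoidalCategory.tensorHom_comp_tensorHom _ _ _ _)

instance : MonoidalCategoryStruct (Pro.{t} C) where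
  tensorObj := Pro.tensor
  whiskerLeft X _ _ f := tensorMap (𝟙 X) f
  whiskerRight f Y := tensorMap f (𝟙 Y)
  tensorHom := tensorMap
  tensorUnit := (const C).obj (𝟙_ C)
  associator X Y Z :=
    { hom := homMk (X := Pro.tensor (Pro.tensor X Y) Z) (Y := Pro.tensor X (Pro.tensor Y Z))
        (prod.inverseAssociator _ _ _)
        { app := fun j => (α_ (X.diag.obj j.1) (Y.diag.obj j.2.1) (Z.diag.obj j.2.2)).hom
          naturality := fun j j' f => MonoidalCategory.associator_naturality _ _ _ }
      inv := homMk (X := Pro.tensor X (Pro.tensor Y Z)) (Y := Pro.tensor (Pro.tensor X Y) Z)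
        (prod.associator _ _ _)
        { app := fun j => (α_ (X.diag.obj j.1.1) (Y.diag.obj j.1.2) (Z.diag.obj j.2)).inv
          naturality := fun j j' f => MonoidalCategory.associator_inv_naturality _ _ _ }
      hom_inv_id := hom_ext fun j => congrArg (Germ.mk j) (Iso.hom_inv_id _)
      inv_hom_id := hom_ext fun j => congrArg (Germ.mk j) (Iso.inv_hom_id _) }
  leftUnitor X :=
    { hom := homMk (X := Pro.tensor ((const C).obj (𝟙_ C)) X) (Y := X)
        (Prod.sectR (⟨⟨⟩⟩ : Discrete PUnit.{t + 1}) _)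
        { app := fun j => (λ_ (X.diag.obj j)).hom
          naturality := fun j j' f => by
            change (𝟙 (𝟙_ C) ⊗ₘ X.diag.map f) ≫ (λ_ _).hom = (λ_ _).hom ≫ X.diag.map f
            simp }
      inv := homMk (X := X) (Y := Pro.tensor ((const C).obj (𝟙_ C)) X)
        (CategoryTheory.Prod.snd (Discrete PUnit.{t + 1}) X.ι)
        { app := fun j => (λ_ (X.diag.obj j.2)).inv
          naturality := fun j j' f => by
            change X.diag.map f.2 ≫ (λ_ _).inv = (λ_ _).inv ≫ (𝟙 (𝟙_ C) ⊗ₘ X.diag.map f.2)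
            simp }
      hom_inv_id := hom_ext fun j => congrArg (Germ.mk (X := Pro.tensor ((const C).obj (𝟙_ C)) X) j)
        (Iso.hom_inv_id (λ_ (X.diag.obj j.2)))
      inv_hom_id := hom_ext fun j => congrArg (Germ.mk j) (Iso.inv_hom_id (λ_ (X.diag.obj j))) }
  rightUnitor X :=
    { hom := homMk (X := Pro.tensor X ((const C).obj (𝟙_ C))) (Y := X)
        (Prod.sectL _ (⟨⟨⟩⟩ : Discrete PUnit.{t + 1}))
        { app := fun j => (ρ_ (X.diag.obj j)).hom
          naturality := fun j j' f => by
            change (X.diag.map f ⊗ₘ 𝟙 (𝟙_ C)) ≫ (ρ_ _).hom = (ρ_ _).hom ≫ X.diag.map f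
            simp }
      inv := homMk (X := X) (Y := Pro.tensor X ((const C).obj (𝟙_ C)))
        (CategoryTheory.Prod.fst X.ι (Discrete PUnit.{t + 1}))
        { app := fun j => (ρ_ (X.diag.obj j.1)).inv
          naturality := fun j j' f => by
            change X.diag.map f.1 ≫ (ρ_ _).inv = (ρ_ _).inv ≫ (X.diag.map f.1 ⊗ₘ 𝟙 (𝟙_ C))
            simp }
      hom_inv_id := hom_ext fun j => congrArg (Germ.mk (X := Pro.tensor X ((const C).obj (𝟙_ C))) j)
        (Iso.hom_inv_id (ρ_ (X.diag.obj j.1)))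
      inv_hom_id := hom_ext fun j => congrArg (Germ.mk j) (Iso.inv_hom_id (ρ_ (X.diag.obj j))) }

instance : MonoidalCategory (Pro.{t} C) := MonoidalCategory.ofTensorHom
  (id_tensorHom_id := fun X Y => hom_ext fun j =>
    congrArg (Germ.mk (X := Pro.tensor X Y) j) (MonoidalCategory.id_tensorHom_id _ _))
  (id_tensorHom := fun _ _ _ _ => rfl)
  (tensorHom_id := fun _ _ => rfl)
  (tensorHom_comp_tensorHom := fun {X₁ Y₁ Z₁ X₂ Y₂ Z₂} f₁ f₂ g₁ g₂ => hom_ext fun ⟨j, j'⟩ => by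
    change Hom.precomp (tensorMap f₁ f₂) ((g₁.germ j).tensor (g₂.germ j')) =
      (Hom.precomp f₁ (g₁.germ j)).tensor (Hom.precomp f₂ (g₂.germ j'))
    generalize g₁.germ j = a
    generalize g₂.germ j' = b
    induction a using Germ.ind with | h i a =>
    induction b using Germ.ind with | h i' b =>
    change ((f₁.germ i).tensor (f₂.germ i')).postcomp (a ⊗ₘ b) =
      ((f₁.germ i).postcomp a).tensor ((f₂.germ i').postcomp b)
    generalize f₁.germ i = c
    generalize f₂.germ i' = d
    induction c using Germ.ind with | h l c =>
    induction d using Germ.ind with | h l' d =>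
    exact congrArg (Germ.mk (X := Pro.tensor X₁ X₂) (l, l'))
      (MonoidalCategory.tensorHom_comp_tensorHom _ _ _ _))
  (associator_naturality := fun {X₁ X₂ X₃ Y₁ Y₂ Y₃} f₁ f₂ f₃ => hom_ext fun ⟨j₁, j₂, j₃⟩ => by
    change (((f₁.germ j₁).tensor (f₂.germ j₂)).tensor (f₃.germ j₃)).postcomp (α_ _ _ _).hom =
      Hom.precomp (α_ X₁ X₂ X₃).hom ((f₁.germ j₁).tensor ((f₂.germ j₂).tensor (f₃.germ j₃)))
    generalize f₁.germ j₁ = a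
    generalize f₂.germ j₂ = b
    generalize f₃.germ j₃ = c
    induction a using Germ.ind with | h i₁ a =>
    induction b using Germ.ind with | h i₂ b =>
    induction c using Germ.ind with | h i₃ c =>
    exact congrArg (Germ.mk (X := Pro.tensor (Pro.tensor X₁ X₂) X₃) ((i₁, i₂), i₃))
      (MonoidalCategory.associator_naturality _ _ _))
  (leftUnitor_naturality := fun {X Y} f => hom_ext fun j => by
    change ((Germ.mk (X := (const.{t} C).obj (𝟙_ C)) ⟨⟨⟩⟩ (𝟙 (𝟙_ C))).tensor (f.germ j)).postcomp (λ_ _).hom =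
      Hom.precomp (λ_ X).hom (f.germ j)
    generalize f.germ j = a
    induction a using Germ.ind with | h i a =>
    refine congrArg (Germ.mk (X := Pro.tensor ((const C).obj (𝟙_ C)) X) (⟨⟨⟩⟩, i)) ?_
    change (𝟙 (𝟙_ C) ⊗ₘ a) ≫ (λ_ _).hom = (λ_ _).hom ≫ a
    simp)
  (rightUnitor_naturality := fun {X Y} f => hom_ext fun j => by
    change ((f.germ j).tensor (Germ.mk (X := (const.{t} C).obj (𝟙_ C)) ⟨⟨⟩⟩ (𝟙 (𝟙_ C)))).postcomp (ρ_ _).hom =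
      Hom.precomp (ρ_ X).hom (f.germ j)
    generalize f.germ j = a
    induction a using Germ.ind with | h i a =>
    refine congrArg (Germ.mk (X := Pro.tensor X ((const C).obj (𝟙_ C))) (i, ⟨⟨⟩⟩)) ?_
    change (a ⊗ₘ 𝟙 (𝟙_ C)) ≫ (ρ_ _).hom = (ρ_ _).hom ≫ a
    simp)
  (pentagon := fun W X Y Z => hom_ext fun ⟨j₁, j₂, j₃, j₄⟩ => by
    refine congrArg (Germ.mk (X := Pro.tensor (Pro.tensor (Pro.tensor W X) Y) Z)
      (((j₁, j₂), j₃), j₄)) ?_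
    change ((α_ _ _ _).hom ⊗ₘ 𝟙 _) ≫ (α_ _ _ _).hom ≫ (𝟙 _ ⊗ₘ (α_ _ _ _).hom) =
      (α_ _ _ _).hom ≫ (α_ _ _ _).hom
    simp)
  (triangle := fun X Y => hom_ext fun ⟨j₁, j₂⟩ => by
    refine congrArg (Germ.mk (X := Pro.tensor (Pro.tensor X ((const C).obj (𝟙_ C))) Y)
      ((j₁, ⟨⟨⟩⟩), j₂)) ?_
    change (α_ _ _ _).hom ≫ (𝟙 _ ⊗ₘ (λ_ _).hom) = ((ρ_ _).hom ⊗ₘ 𝟙 _)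
    simp)

/-- The inclusion of constant pro-objects is lax (in fact strongly) monoidal. -/
instance : (const.{t} C).LaxMonoidal where
  ε := 𝟙 ((const C).obj (𝟙_ C))
  μ X Y := homMk (X := Pro.tensor ((const C).obj X) ((const C).obj Y)) (Y := (const C).obj (X ⊗ Y))
    (Functor.diag _)
    { app := fun _ => 𝟙 (X ⊗ Y)
      naturality := fun _ _ _ => by
        change (𝟙 X ⊗ₘ 𝟙 Y) ≫ 𝟙 (X ⊗ Y) = 𝟙 (X ⊗ Y) ≫ 𝟙 (X ⊗ Y)
        simp }
  μ_natural_left {X Y} f Z := hom_ext fun j => by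
    refine congrArg (Germ.mk (X := Pro.tensor ((const C).obj X) ((const C).obj Z)) (j, j)) ?_
    change (f ⊗ₘ 𝟙 Z) ≫ 𝟙 _ = 𝟙 _ ≫ (f ▷ Z)
    simp
  μ_natural_right {X Y} Z f := hom_ext fun j => by
    refine congrArg (Germ.mk (X := Pro.tensor ((const C).obj Z) ((const C).obj X)) (j, j)) ?_
    change (𝟙 Z ⊗ₘ f) ≫ 𝟙 _ = 𝟙 _ ≫ (Z ◁ f)
    simp
  associativity X Y Z := hom_ext fun j => by
    refine congrArg (Germ.mk (X := Pro.tensor (Pro.tensor ((const C).obj X) ((const C).obj Y))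
      ((const C).obj Z)) ((j, j), j)) ?_
    change (𝟙 (X ⊗ Y) ⊗ₘ 𝟙 Z) ≫ 𝟙 _ ≫ (α_ X Y Z).hom =
      (α_ X Y Z).hom ≫ (𝟙 X ⊗ₘ 𝟙 (Y ⊗ Z)) ≫ 𝟙 _
    simp
  left_unitality X := hom_ext fun j => by
    refine congrArg (Germ.mk (X := Pro.tensor ((const C).obj (𝟙_ C)) ((const C).obj X)) (j, j)) ?_
    change (λ_ X).hom = (𝟙 (𝟙_ C) ⊗ₘ 𝟙 X) ≫ 𝟙 _ ≫ (λ_ X).hom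
    simp
  right_unitality X := hom_ext fun j => by
    refine congrArg (Germ.mk (X := Pro.tensor ((const C).obj X) ((const C).obj (𝟙_ C))) (j, j)) ?_
    change (ρ_ X).hom = (𝟙 X ⊗ₘ 𝟙 (𝟙_ C)) ≫ 𝟙 _ ≫ (ρ_ X).hom
    simp

end Monoidal

end Pro

/-! ### Braided sequences and left ideals in pro-vector spaces -/

section Sequences

variable (k : Type w) [Field k]

/-- A braided sequence of pro-vector spaces: for each `n` an inverse system of vector spaces with
compatible right actions of the braid group on `n` strands. -/
structure BraidedSeq where
  /-- The `n`-th pro-vector space. -/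
  obj : ℕ → Pro.{t} (ModuleCat.{w} k)
  /-- The action of a braid. -/
  act : ∀ n, Braid n → ((obj n).diag ⟶ (obj n).diag)
  act_one : ∀ n, act n 1 = 𝟙 _
  /-- It is a right action: `x · (g h) = (x · g) · h`. -/
  act_mul : ∀ n g h, act n (g * h) = act n g ≫ act n h

/-- A braided sequence together with partial composition maps `∘ᵢ`. -/
structure BraidedSeqWithComp extends BraidedSeq.{t} k where
  /-- The partial composition inserting an operation in the `i`-th input. -/
  circ : ∀ {m n N : ℕ}, m + n = N + 1 → Fin m → (obj m ⊗ obj n ⟶ obj N)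

variable {k}

/-- The action of a braid as a morphism of pro-vector spaces. -/
def BraidedSeq.actPro (S : BraidedSeq.{t} k) (n : ℕ) (g : Braid n) : S.obj n ⟶ S.obj n :=
  Pro.homMk (𝟭 _) (S.act n g)

/-- A braided sequence is strict if each of its pro-vector spaces is strict. -/
def BraidedSeq.IsStrict (S : BraidedSeq.{t} k) : Prop := ∀ n, (S.obj n).IsStrict

/-- The family of morphisms `φ` makes `I` a left ideal in `O`: it consists of equivariant
monomorphisms, and inserting operations of `I` in operations of `O` gives operations of `I`. -/
structure IsLeftIdeal (O : BraidedSeqWithComp.{t} k) (I : BraidedSeq.{t} k)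
    (φ : ∀ n, I.obj n ⟶ O.obj n) : Prop where
  mono : ∀ n, Mono (φ n)
  equivariant : ∀ n (g : Braid n), I.actPro n g ≫ φ n = φ n ≫ O.actPro n g
  circ_mem : ∀ {m n N : ℕ} (h : m + n = N + 1) (i : Fin m),
    ∃ c : O.obj m ⊗ I.obj n ⟶ I.obj N, c ≫ φ N = (O.obj m ◁ φ n) ≫ O.circ h i

end Sequences

/-! ### The profinite braided associative operad -/

section BrAssHat

variable (k : Type w) [Field k]

/-- Finite quotients of a group, indexed by their kernels. -/
abbrev FinQuot (n : ℕ) : Type := FiniteIndexNormalSubgroup (Braid n)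

instance (n : ℕ) : Nonempty (FinQuot n) := ⟨.ofSubgroup ⊤⟩

/-- The group ring of a finite quotient of the braid group. -/
abbrev QuotAlg {n : ℕ} (Q : FinQuot n) : Type w := MonoidAlgebra k (Braid n ⧸ Q.toSubgroup)

/-- The projection from the group ring of the braid group. -/
def toQuotAlg {n : ℕ} (Q : FinQuot n) : MonoidAlgebra k (Braid n) →ₐ[k] QuotAlg k Q :=
  MonoidAlgebra.mapDomainAlgHom k k (QuotientGroup.mk' Q.toSubgroup)

/-- The projection between group rings of finite quotients. -/
def quotAlgMap {n : ℕ} {P Q : FinQuot n} (h : P ≤ Q) : QuotAlg k P →ₐ[k] QuotAlg k Q :=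
  MonoidAlgebra.mapDomainAlgHom k k
    (QuotientGroup.map P.toSubgroup Q.toSubgroup (MonoidHom.id _) h)

theorem quotAlgMap_single {n : ℕ} {P Q : FinQuot n} (h : P ≤ Q) (g : Braid n) (c : k) :
    quotAlgMap k h (MonoidAlgebra.single (g : Braid n ⧸ P.toSubgroup) c) =
      MonoidAlgebra.single (g : Braid n ⧸ Q.toSubgroup) c := by
  exact MonoidAlgebra.mapDomain_single

theorem toQuotAlg_single {n : ℕ} (Q : FinQuot n) (g : Braid n) (c : k) :
    toQuotAlg k Q (MonoidAlgebra.single g c) =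
      MonoidAlgebra.single (g : Braid n ⧸ Q.toSubgroup) c := by
  exact MonoidAlgebra.mapDomain_single

variable {k} in
theorem quotAlg_hom_ext {n : ℕ} {Q : FinQuot n} {M : Type*} [AddCommGroup M] [Module k M]
    {f f' : QuotAlg k Q →ₗ[k] M}
    (h : ∀ g : Braid n, f (MonoidAlgebra.single (g : Braid n ⧸ Q.toSubgroup) 1) =
      f' (MonoidAlgebra.single (g : Braid n ⧸ Q.toSubgroup) 1)) : f = f' := by
  refine (MonoidAlgebra.basis _ k).ext fun x => ?_
  induction x using QuotientGroup.induction_on with | H g =>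
  simpa using h g

theorem quotAlgMap_toQuotAlg {n : ℕ} {P Q : FinQuot n} (h : P ≤ Q) (x : MonoidAlgebra k (Braid n)) :
    quotAlgMap k h (toQuotAlg k P x) = toQuotAlg k Q x := by
  change ((quotAlgMap k h).comp (toQuotAlg k P)) x = _
  refine LinearMap.congr_fun (f := ((quotAlgMap k h).comp (toQuotAlg k P)).toLinearMap)
    (g := (toQuotAlg k Q).toLinearMap) ((MonoidAlgebra.basis _ k).ext fun g => ?_) x
  rw [MonoidAlgebra.basis_apply]
  change quotAlgMap k h (toQuotAlg k P _) = toQuotAlg k Q _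
  rw [toQuotAlg_single, quotAlgMap_single, toQuotAlg_single]

/-- The inverse system `k[Q]` of group rings of finite quotients of the braid group. -/
def brAssHatDiag (n : ℕ) : FinQuot n ⥤ ModuleCat.{w} k where
  obj Q := ModuleCat.of k (QuotAlg k Q)
  map f := ModuleCat.ofHom (quotAlgMap k (leOfHom f)).toLinearMap
  map_id Q := ModuleCat.hom_ext (quotAlg_hom_ext fun g => quotAlgMap_single k _ g 1)
  map_comp f f' := ModuleCat.hom_ext (quotAlg_hom_ext fun g => by
    refine (quotAlgMap_single k _ g 1).trans ?_
    change _ = quotAlgMap k _ (quotAlgMap k _ _)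
    rw [quotAlgMap_single, quotAlgMap_single])

/-- Right multiplication by a braid on `k[Q]`. -/
def rightMul {n : ℕ} (Q : FinQuot n) (g : Braid n) : QuotAlg k Q →ₗ[k] QuotAlg k Q :=
  LinearMap.mulRight k (MonoidAlgebra.single (g : Braid n ⧸ Q.toSubgroup) 1)

theorem rightMul_apply {n : ℕ} (Q : FinQuot n) (g : Braid n) (x : QuotAlg k Q) :
    rightMul k Q g x = x * MonoidAlgebra.single (g : Braid n ⧸ Q.toSubgroup) 1 := rfl

theorem rightMul_one {n : ℕ} (Q : FinQuot n) (x : QuotAlg k Q) : rightMul k Q 1 x = x :=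
  mul_one x

theorem rightMul_mul {n : ℕ} (Q : FinQuot n) (g h : Braid n) (x : QuotAlg k Q) :
    rightMul k Q (g * h) x = rightMul k Q h (rightMul k Q g x) := by
  rw [rightMul_apply, rightMul_apply, rightMul_apply, mul_assoc, MonoidAlgebra.single_mul_single,
    one_mul]
  rfl

theorem quotAlgMap_rightMul {n : ℕ} {P Q : FinQuot n} (h : P ≤ Q) (g : Braid n) (x : QuotAlg k P) :
    quotAlgMap k h (rightMul k P g x) = rightMul k Q g (quotAlgMap k h x) := by
  rw [rightMul_apply, map_mul, quotAlgMap_single, rightMul_apply]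

/-- The braided sequence underlying the profinite braided associative operad. -/
def brAssHatSeq : BraidedSeq.{0} k where
  obj n := { ι := FinQuot n, diag := brAssHatDiag k n }
  act n g :=
    { app := fun Q => ModuleCat.ofHom (rightMul k Q g)
      naturality := fun P Q f => ModuleCat.hom_ext
        (LinearMap.ext fun x => (quotAlgMap_rightMul k (leOfHom f) g x).symm) }
  act_one n := NatTrans.ext (funext fun Q => ModuleCat.hom_ext
    (LinearMap.ext fun x => rightMul_one k Q x))
  act_mul n g h := NatTrans.ext (funext fun Q => ModuleCat.hom_ext
    (LinearMap.ext fun x => rightMul_mul k Q g h x))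

/-- Cabling of elements of finite quotients of the braid groups. -/
def quotCabling {m n N : ℕ} (h : m + n = N + 1) (i : Fin m) {P : FinQuot m} {Q : FinQuot n} {R : FinQuot N}
    (hP : P ≤ cableKer h R) (hQ : Q ≤ R.comap (shift (N := N) i (by omega))) :
    Braid m ⧸ P.toSubgroup → Braid n ⧸ Q.toSubgroup → Braid N ⧸ R.toSubgroup :=
  Quotient.map₂ (cabling h i) (fun _ _ hγ _ _ hρ => Quotient.exact
    (cabling_congr h i R (hP (QuotientGroup.leftRel_apply.1 hγ))
      (hQ (QuotientGroup.leftRel_apply.1 hρ))))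

/-- The bilinear extension `k[P] ⊗ k[Q] ⟶ k[R]` of the cabling. -/
def quotCirc {m n N : ℕ} (h : m + n = N + 1) (i : Fin m) {P : FinQuot m} {Q : FinQuot n} {R : FinQuot N}
    (hP : P ≤ cableKer h R) (hQ : Q ≤ R.comap (shift (N := N) i (by omega))) :
    TensorProduct k (QuotAlg k P) (QuotAlg k Q) →ₗ[k] QuotAlg k R :=
  TensorProduct.lift ((MonoidAlgebra.basis _ k).constr k fun γ =>
    MonoidAlgebra.mapDomainLinearMap k k (quotCabling h i hP hQ γ))

theorem quotCirc_single {m n N : ℕ} (h : m + n = N + 1) (i : Fin m) {P : FinQuot m} {Q : FinQuot n}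
    {R : FinQuot N} (hP : P ≤ cableKer h R) (hQ : Q ≤ R.comap (shift (N := N) i (by omega)))
    (γ : Braid m) (ρ : Braid n) :
    quotCirc k h i hP hQ (TensorProduct.tmul k
      (MonoidAlgebra.single (γ : Braid m ⧸ P.toSubgroup) 1)
      (MonoidAlgebra.single (ρ : Braid n ⧸ Q.toSubgroup) 1)) =
    MonoidAlgebra.single (cabling h i γ ρ : Braid N ⧸ R.toSubgroup) 1 := by
  have e : (MonoidAlgebra.single (γ : Braid m ⧸ P.toSubgroup) (1 : k)) =
    MonoidAlgebra.basis _ k (γ : Braid m ⧸ P.toSubgroup) := by simp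
  rw [quotCirc, TensorProduct.lift.tmul, e, Module.Basis.constr_basis,
    MonoidAlgebra.mapDomainLinearMap_single]
  rfl

/-- The partial composition `∘ᵢ` of the profinite braided associative operad. -/
def brAssHatCirc {m n N : ℕ} (h : m + n = N + 1) (i : Fin m) :
    (brAssHatSeq k).obj m ⊗ (brAssHatSeq k).obj n ⟶ (brAssHatSeq k).obj N where
  germ := fun R : FinQuot N => Pro.Germ.mk
    (X := Pro.tensor ((brAssHatSeq k).obj m) ((brAssHatSeq k).obj n))
    ((cableKer h R, R.comap (shift (N := N) i (by omega))) : FinQuot m × FinQuot n)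
    (ModuleCat.ofHom (quotCirc k h i le_rfl le_rfl))
  compat := fun {R R' : FinQuot N} f => by
    refine Pro.Germ.mk_eq (X := Pro.tensor ((brAssHatSeq k).obj m) ((brAssHatSeq k).obj n))
      ((homOfLE (cableKer_mono h (leOfHom f)) : cableKer h R ⟶ cableKer h R'),
        (homOfLE (FiniteIndexNormalSubgroup.comap_mono _ (leOfHom f)) :
          R.comap (shift (N := N) i (by omega)) ⟶ R'.comap (shift (N := N) i (by omega)))) ?_
    refine ModuleCat.hom_ext (TensorProduct.ext (quotAlg_hom_ext fun γ =>
      quotAlg_hom_ext fun ρ => ?_))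
    change quotAlgMap k (leOfHom f) (quotCirc k h i _ _ (TensorProduct.tmul k _ _)) =
      quotCirc k h i _ _ (TensorProduct.tmul k (quotAlgMap k _ _) (quotAlgMap k _ _))
    rw [quotAlgMap_single, quotAlgMap_single, quotCirc_single, quotCirc_single, quotAlgMap_single]

/-- The profinite braided associative operad: the inverse systems of group rings of the finite
quotients of the braid groups, with partial compositions given by cabling. -/
def brAssHat : BraidedSeqWithComp.{0} k where
  toBraidedSeq := brAssHatSeq k
  circ h i := brAssHatCirc k h i

/-- The action of the quantum symmetrizer on `k[Q]` by left multiplication. -/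
def symMul {n : ℕ} (Q : FinQuot n) : QuotAlg k Q →ₗ[k] QuotAlg k Q :=
  LinearMap.mulLeft k (toQuotAlg k Q (quantumSymmetrizer k n))

theorem quotAlgMap_symMul {n : ℕ} {P Q : FinQuot n} (h : P ≤ Q) (x : QuotAlg k P) :
    quotAlgMap k h (symMul k P x) = symMul k Q (quotAlgMap k h x) := by
  rw [symMul, symMul, LinearMap.mulLeft_apply, LinearMap.mulLeft_apply, map_mul,
    quotAlgMap_toQuotAlg]

theorem rightMul_symMul {n : ℕ} (Q : FinQuot n) (g : Braid n) (x : QuotAlg k Q) :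
    rightMul k Q g (symMul k Q x) = symMul k Q (rightMul k Q g x) := mul_assoc _ _ _

/-- The kernel of the quantum symmetrizer on `k[Q]`. -/
def worKer {n : ℕ} (Q : FinQuot n) : Submodule k (QuotAlg k Q) := LinearMap.ker (symMul k Q)

theorem quotAlgMap_mem {n : ℕ} {P Q : FinQuot n} (h : P ≤ Q) (x : QuotAlg k P)
    (hx : x ∈ worKer k P) : quotAlgMap k h x ∈ worKer k Q := by
  rw [worKer, LinearMap.mem_ker] at *
  rw [← quotAlgMap_symMul, hx, map_zero]

theorem rightMul_mem {n : ℕ} (Q : FinQuot n) (g : Braid n) (x : QuotAlg k Q)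
    (hx : x ∈ worKer k Q) : rightMul k Q g x ∈ worKer k Q := by
  rw [worKer, LinearMap.mem_ker] at *
  rw [← rightMul_symMul, hx, map_zero]

/-- The Woronowicz ideal: the kernel of left multiplication by the quantum symmetrizers on the
profinite braided associative operad. -/
def woronowicz : BraidedSeq.{0} k where
  obj n :=
    { ι := FinQuot n
      diag :=
        { obj := fun Q => ModuleCat.of k (worKer k Q)
          map := fun {P Q} f => ModuleCat.ofHom
            ((quotAlgMap k (leOfHom f)).toLinearMap.restrict (quotAlgMap_mem k (leOfHom f)))
          map_id := fun Q => ModuleCat.hom_ext (LinearMap.ext fun x => Subtype.ext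
            (congrArg (fun F => F.hom x.1) ((brAssHatDiag k n).map_id Q)))
          map_comp := fun f f' => ModuleCat.hom_ext (LinearMap.ext fun x => Subtype.ext
            (congrArg (fun F => F.hom x.1) ((brAssHatDiag k n).map_comp f f'))) } }
  act n g :=
    { app := fun Q => ModuleCat.ofHom ((rightMul k Q g).restrict (rightMul_mem k Q g))
      naturality := fun P Q f => ModuleCat.hom_ext (LinearMap.ext fun x => Subtype.ext
        (quotAlgMap_rightMul k (leOfHom f) g x.1).symm) }
  act_one n := NatTrans.ext (funext fun Q => ModuleCat.hom_ext
    (LinearMap.ext fun x => Subtype.ext (rightMul_one k Q x.1)))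
  act_mul n g h := NatTrans.ext (funext fun Q => ModuleCat.hom_ext
    (LinearMap.ext fun x => Subtype.ext (rightMul_mul k Q g h x.1)))

/-- The inclusion of the Woronowicz ideal. -/
def woronowiczIncl (n : ℕ) : (woronowicz k).obj n ⟶ (brAssHat k).obj n :=
  Pro.homMk (X := (woronowicz k).obj n) (Y := (brAssHat k).obj n) (𝟭 (FinQuot n))
    { app := fun Q => ModuleCat.ofHom (worKer k Q).subtype
      naturality := fun _ _ _ => rfl }

/-- The Nichols module: the quotient of the profinite braided associative operad by the Woronowicz
ideal. -/
def nic : BraidedSeq.{0} k where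
  obj n :=
    { ι := FinQuot n
      diag :=
        { obj := fun Q => ModuleCat.of k (QuotAlg k Q ⧸ worKer k Q)
          map := fun {P Q} f => ModuleCat.ofHom
            ((worKer k P).mapQ (worKer k Q) (quotAlgMap k (leOfHom f)).toLinearMap
              (quotAlgMap_mem k (leOfHom f)))
          map_id := fun Q => ModuleCat.hom_ext (Submodule.linearMap_qext _ (LinearMap.ext fun x =>
            congrArg (fun F => (worKer k Q).mkQ (F.hom x)) ((brAssHatDiag k n).map_id Q)))
          map_comp := fun {P Q R} f f' => ModuleCat.hom_ext (Submodule.linearMap_qext _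
            (LinearMap.ext fun x =>
              congrArg (fun F => (worKer k R).mkQ (F.hom x))
                ((brAssHatDiag k n).map_comp f f'))) } }
  act n g :=
    { app := fun Q => ModuleCat.ofHom
        ((worKer k Q).mapQ (worKer k Q) (rightMul k Q g) (rightMul_mem k Q g))
      naturality := fun P Q f => ModuleCat.hom_ext (Submodule.linearMap_qext _
        (LinearMap.ext fun x => congrArg (worKer k Q).mkQ
          (quotAlgMap_rightMul k (leOfHom f) g x).symm)) }
  act_one n := NatTrans.ext (funext fun Q => ModuleCat.hom_ext (Submodule.linearMap_qext _
    (LinearMap.ext fun x => congrArg (worKer k Q).mkQ (rightMul_one k Q x))))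
  act_mul n g h := NatTrans.ext (funext fun Q => ModuleCat.hom_ext (Submodule.linearMap_qext _
    (LinearMap.ext fun x => congrArg (worKer k Q).mkQ (rightMul_mul k Q g h x))))

end BrAssHat

/-! ### Tensor powers and the braid group action -/

section TensorPowers

variable {C : Type u} [Category.{v} C] [MonoidalCategory C]

/-- The tensor powers `V ⊗ ⋯ ⊗ V`, bracketed from the left. -/
def tensorPow (V : C) : ℕ → C
  | 0 => 𝟙_ C
  | n + 1 => tensorPow V n ⊗ V

/-- The concatenation isomorphisms. -/
def concat (V : C) (p : ℕ) : ∀ q, tensorPow V p ⊗ tensorPow V q ≅ tensorPow V (p + q)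
  | 0 => ρ_ (tensorPow V p)
  | q + 1 => (α_ (tensorPow V p) (tensorPow V q) V).symm ≪≫ whiskerRightIso (concat V p q) V

variable [BraidedCategory C]

/-- The braiding of the last two factors. -/
def lastBraid (X V : C) : Aut ((X ⊗ V) ⊗ V) :=
  α_ X V V ≪≫ whiskerLeftIso X (β_ V V) ≪≫ (α_ X V V).symm

/-- Tensoring automorphisms with the identity of `V`. -/
def whiskerAut (X V : C) : Aut X →* Aut (X ⊗ V) where
  toFun e := whiskerRightIso e V
  map_one' := Iso.ext (id_whiskerRight X V)
  map_mul' e f := Iso.ext (comp_whiskerRight f.hom e.hom V)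

/-- The braiding of the factors `i` and `i + 1` of a tensor power, for `i + 1 < n`; the factors are
numbered from `0`, beginning on the left. -/
def genAct (V : C) : ∀ n, ℕ → Aut (tensorPow V n)
  | 0, _ => 1
  | 1, _ => 1
  | n + 2, i =>
    if i = n then lastBraid (tensorPow V n) V else whiskerAut (tensorPow V (n + 1)) V (genAct V (n + 1) i)

theorem genAct_last (V : C) (n : ℕ) : genAct V (n + 2) n = lastBraid (tensorPow V n) V :=
  if_pos rfl

theorem genAct_of_ne (V : C) {n i : ℕ} (h : i ≠ n) :
    genAct V (n + 2) i = whiskerAut (tensorPow V (n + 1)) V (genAct V (n + 1) i) := if_neg h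

theorem lastBraid_comm (X V : C) (e : Aut X) :
    whiskerAut _ V (whiskerAut X V e) * lastBraid X V = lastBraid X V * whiskerAut _ V (whiskerAut X V e) := by
  refine Iso.ext ?_
  change (lastBraid X V).hom ≫ e.hom ▷ V ▷ V = e.hom ▷ V ▷ V ≫ (lastBraid X V).hom
  simp only [lastBraid, Iso.trans_hom, whiskerLeftIso_hom, Iso.symm_hom, Category.assoc]
  rw [← associator_inv_naturality_left, whisker_exchange_assoc, associator_naturality_left_assoc]

theorem lastBraid_braid (X V : C) :
    (lastBraid X V).hom ▷ V ≫ (lastBraid (X ⊗ V) V).hom ≫ (lastBraid X V).hom ▷ V =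
      (lastBraid (X ⊗ V) V).hom ≫ (lastBraid X V).hom ▷ V ≫ (lastBraid (X ⊗ V) V).hom := by
  have h := congrArg (fun f => X ◁ f) (BraidedCategory.yang_baxter V V V)
  simp only [lastBraid, Iso.trans_hom, whiskerLeftIso_hom, Iso.symm_hom]
  calc _ = 𝟙 _ ⊗≫ X ◁ ((α_ V V V).inv ≫ (β_ V V).hom ▷ V ≫ (α_ V V V).hom ≫ V ◁ (β_ V V).hom ≫
          (α_ V V V).inv ≫ (β_ V V).hom ▷ V ≫ (α_ V V V).hom) ⊗≫ 𝟙 _ := by monoidal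
    _ = _ := by rw [h]; monoidal

theorem isBraiding_genAct (V : C) : ∀ n, IsBraiding n (genAct V n)
  | 0 => ⟨fun _ h => absurd h (by omega), fun _ _ _ h => absurd h (by omega)⟩
  | 1 => ⟨fun _ h => absurd h (by omega), fun _ _ _ h => absurd h (by omega)⟩
  | n + 2 => by
    have ih := isBraiding_genAct V (n + 1)
    constructor
    · intro i hi
      by_cases h1 : i + 1 = n
      · subst h1
        rw [genAct_last, genAct_of_ne V (show i ≠ i + 1 by omega), genAct_last]
        exact Iso.ext (lastBraid_braid _ V)
      · rw [genAct_of_ne V h1, genAct_of_ne V (show i ≠ n by omega)]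
        have h := congrArg (whiskerAut (tensorPow V (n + 1)) V) (ih.braid i (by omega))
        simp only [map_mul] at h
        exact h
    · intro i j hij hj
      by_cases h1 : j = n
      · subst h1
        obtain ⟨m, rfl⟩ : ∃ m, j = m + 1 := ⟨j - 1, by omega⟩
        rw [genAct_last, genAct_of_ne V (show i ≠ m + 1 by omega),
          genAct_of_ne V (show i ≠ m by omega)]
        exact lastBraid_comm _ V _
      · rw [genAct_of_ne V h1, genAct_of_ne V (show i ≠ n by omega)]
        have h := congrArg (whiskerAut (tensorPow V (n + 1)) V) (ih.comm i j hij (by omega))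
        simp only [map_mul] at h
        exact h

/-- The left action of the braid group on a tensor power. (Multiplication in `Aut` is the
composition of maps in the usual order.) -/
def braidAct (V : C) (n : ℕ) : Braid n →* Aut (tensorPow V n) :=
  braidLift (genAct V n) (isBraiding_genAct V n)

/-- The action of a braid on a tensor power, as a map. -/
def braidMap (V : C) (n : ℕ) (g : Braid n) : tensorPow V n ⟶ tensorPow V n := (braidAct V n g).hom

/-- An object is finitely braided if for each `n` the action of the braid group on its `n`-th tensor
power factors through a finite quotient. -/
def FinitelyBraided (V : C) : Prop := ∀ n, (braidAct V n).ker.FiniteIndex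

variable (k : Type w) [Field k] [Preadditive C] [Linear k C]

/-- The linear extension of the action of the braid group on a tensor power. -/
def algAct (V : C) (n : ℕ) : MonoidAlgebra k (Braid n) →ₐ[k] End (tensorPow V n) :=
  MonoidAlgebra.lift k _ (Braid n)
    { toFun := braidMap V n
      map_one' := by rw [braidMap, map_one]; rfl
      map_mul' := fun g h => by rw [braidMap, map_mul]; rfl }

end TensorPowers

/-! ### Balanced tensor products and the Artin functor -/

section Balanced

variable {k : Type w} [Field k] {C : Type u} [Category.{v} C] [Preadditive C] [Linear k C]
  [HasCoproducts.{w} C] [HasCoequalizers C]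

section

variable {G : Type} (M : ModuleCat.{w} k) (ρ : G → (M ⟶ M)) {X : C} (a : G → (X ⟶ X))

/-- The first map in the presentation of the balanced tensor product. -/
def balL : ∐ (fun _ : (k × M × M) ⊕ (G × M) => X) ⟶ ∐ (fun _ : M => X) :=
  Sigma.desc fun
    | .inl x => Sigma.ι (fun _ : M => X) (x.1 • x.2.1 + x.2.2)
    | .inr x => Sigma.ι (fun _ : M => X) (ρ x.1 x.2)

/-- The second map in the presentation of the balanced tensor product. -/
def balR : ∐ (fun _ : (k × M × M) ⊕ (G × M) => X) ⟶ ∐ (fun _ : M => X) :=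
  Sigma.desc fun
    | .inl x => x.1 • Sigma.ι (fun _ : M => X) x.2.1 + Sigma.ι (fun _ : M => X) x.2.2
    | .inr x => a x.1 ≫ Sigma.ι (fun _ : M => X) x.2

/-- The balanced tensor product `M ⊗_G X` of a vector space `M` with a right action `ρ` of `G` and
an object `X` with a left action `a` of `G`: it is the quotient of the sum of copies of `X` indexed by
the elements of `M` by the relations making `m ⊗ x` linear in `m`, and
`(m · g) ⊗ x = m ⊗ (g · x)`. -/
def bal : C := coequalizer (balL M ρ (X := X)) (balR M a)

variable {M ρ a}

variable (M ρ a) in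
/-- The quotient map. -/
def bal.π : ∐ (fun _ : M => X) ⟶ bal M ρ a := coequalizer.π _ _

theorem bal.condition : balL M ρ (X := X) ≫ bal.π M ρ a = balR M a ≫ bal.π M ρ a :=
  coequalizer.condition _ _

/-- The map `x ↦ m ⊗ x`. -/
def bal.ι (m : M) : X ⟶ bal M ρ a := Sigma.ι (fun _ : M => X) m ≫ bal.π M ρ a

theorem bal.ι_smul_add (c : k) (m m' : M) :
    (bal.ι (c • m + m') : X ⟶ bal M ρ a) = c • bal.ι m + bal.ι m' := by
  have h := Sigma.ι (fun _ : (k × M × M) ⊕ (G × M) => X) (.inl (c, m, m')) ≫=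
    bal.condition (M := M) (ρ := ρ) (a := a)
  simpa [balL, balR, bal.ι] using h

theorem bal.ι_act (g : G) (m : M) : (bal.ι (ρ g m) : X ⟶ bal M ρ a) = a g ≫ bal.ι m := by
  have h := Sigma.ι (fun _ : (k × M × M) ⊕ (G × M) => X) (.inr (g, m)) ≫=
    bal.condition (M := M) (ρ := ρ) (a := a)
  simpa [balL, balR, bal.ι] using h

/-- The universal property of the balanced tensor product. -/
def bal.desc {Z : C} (f : M → (X ⟶ Z)) (h1 : ∀ (c : k) (m m' : M), f (c • m + m') = c • f m + f m')
    (h2 : ∀ g m, f (ρ g m) = a g ≫ f m) : bal M ρ a ⟶ Z :=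
  coequalizer.desc (Sigma.desc f) (Sigma.hom_ext _ _ fun
    | .inl x => by simp [balL, balR, h1]
    | .inr x => by simp [balL, balR, h2])

theorem bal.ι_desc {Z : C} (f : M → (X ⟶ Z))
    (h1 : ∀ (c : k) (m m' : M), f (c • m + m') = c • f m + f m')
    (h2 : ∀ g m, f (ρ g m) = a g ≫ f m) (m : M) : bal.ι m ≫ bal.desc f h1 h2 = f m := by
  have h : bal.π M ρ a ≫ bal.desc f h1 h2 = Sigma.desc f := coequalizer.π_desc _ _
  rw [bal.ι, Category.assoc, h, Sigma.ι_desc]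

theorem bal.hom_ext {Z : C} {f f' : bal M ρ a ⟶ Z} (h : ∀ m, bal.ι m ≫ f = bal.ι m ≫ f') :
    f = f' :=
  coequalizer.hom_ext (Sigma.hom_ext _ _ fun m =>
    ((Category.assoc _ _ _).symm.trans (h m)).trans (Category.assoc _ _ _))

/-- Functoriality of the balanced tensor product in `M`. -/
def bal.map {M' : ModuleCat.{w} k} {ρ' : G → (M' ⟶ M')} (φ : M ⟶ M')
    (h : ∀ g, ρ g ≫ φ = φ ≫ ρ' g) : bal M ρ a ⟶ bal M' ρ' a :=
  bal.desc (fun m => bal.ι (φ m)) (fun c m m' => by rw [map_add, map_smul, bal.ι_smul_add])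
    (fun g m => by
      rw [← bal.ι_act]
      exact congrArg bal.ι (ConcreteCategory.congr_hom (h g) m))

theorem bal.ι_map {M' : ModuleCat.{w} k} {ρ' : G → (M' ⟶ M')} (φ : M ⟶ M')
    (h : ∀ g, ρ g ≫ φ = φ ≫ ρ' g) (m : M) :
    (bal.ι m : X ⟶ bal M ρ a) ≫ bal.map φ h = bal.ι (φ m) := bal.ι_desc _ _ _ m

end

variable [MonoidalCategory C] [BraidedCategory C] [HasCountableCoproducts C]

/-- The terms `S(n) ⊗_{Bₙ} V ⊗ ⋯ ⊗ V` of the Artin functor. -/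
def artinTerm (S : BraidedSeq.{t} k) (V : C) (n : ℕ) (i : (S.obj n).ι) : C :=
  bal ((S.obj n).diag.obj i) (fun g => (S.act n g).app i) (braidMap V n)

/-- The map `v ↦ x ⊗ v`. -/
def artinTerm.ι (S : BraidedSeq.{t} k) (V : C) (n : ℕ) (i : (S.obj n).ι) (x : (S.obj n).diag.obj i) :
    tensorPow V n ⟶ artinTerm S V n i := bal.ι x

theorem artinTerm.hom_ext {S : BraidedSeq.{t} k} {V : C} {n : ℕ} {i : (S.obj n).ι} {Z : C}
    {f f' : artinTerm S V n i ⟶ Z}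
    (h : ∀ x, artinTerm.ι S V n i x ≫ f = artinTerm.ι S V n i x ≫ f') : f = f' := bal.hom_ext h

/-- The transition maps of the terms of the Artin functor. -/
def artinTerm.map (S : BraidedSeq.{t} k) (V : C) (n : ℕ) {i i' : (S.obj n).ι} (f : i ⟶ i') :
    artinTerm S V n i ⟶ artinTerm S V n i' :=
  bal.map ((S.obj n).diag.map f) fun g => ((S.act n g).naturality f).symm

theorem artinTerm.ι_map (S : BraidedSeq.{t} k) (V : C) (n : ℕ) {i i' : (S.obj n).ι} (f : i ⟶ i')
    (x : (S.obj n).diag.obj i) :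
    artinTerm.ι S V n i x ≫ artinTerm.map S V n f =
      artinTerm.ι S V n i' ((S.obj n).diag.map f x) := bal.ι_map _ _ _

theorem artinTerm.map_id (S : BraidedSeq.{t} k) (V : C) (n : ℕ) (i : (S.obj n).ι) :
    artinTerm.map S V n (𝟙 i) = 𝟙 _ :=
  artinTerm.hom_ext fun x => by
    rw [artinTerm.ι_map, Category.comp_id, (S.obj n).diag.map_id]; rfl

theorem artinTerm.map_comp (S : BraidedSeq.{t} k) (V : C) (n : ℕ) {i i' i'' : (S.obj n).ι}
    (f : i ⟶ i') (f' : i' ⟶ i'') :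
    artinTerm.map S V n (f ≫ f') = artinTerm.map S V n f ≫ artinTerm.map S V n f' :=
  artinTerm.hom_ext fun x => by
    rw [artinTerm.ι_map, ← Category.assoc, artinTerm.ι_map, artinTerm.ι_map,
      (S.obj n).diag.map_comp]; rfl

theorem artinTerm.ι_sigmaMap (S : BraidedSeq.{t} k) (V : C) {j j' : ∀ n, (S.obj n).ι} (f : j ⟶ j')
    (n : ℕ) (x : (S.obj n).diag.obj (j n)) :
    (artinTerm.ι S V n (j n) x ≫ Sigma.ι (fun n => artinTerm S V n (j n)) n) ≫
        Limits.Sigma.map (fun n => artinTerm.map S V n (f n)) =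
      artinTerm.ι S V n (j' n) ((S.obj n).diag.map (f n) x) ≫
        Sigma.ι (fun n => artinTerm S V n (j' n)) n := by
  rw [Category.assoc, Sigma.ι_map, ← Category.assoc, artinTerm.ι_map]

/-- The Artin functor: the pro-object `⨁ₙ S(n) ⊗_{Bₙ} V ⊗ ⋯ ⊗ V`, indexed by the product of the
indexing categories of the pro-vector spaces `S(n)`. -/
def artin (S : BraidedSeq.{t} k) (V : C) : Pro.{t} C where
  ι := ∀ n, (S.obj n).ι
  diag :=
    { obj := fun j => ∐ fun n => artinTerm S V n (j n)
      map := fun {j j'} f => Limits.Sigma.map fun n => artinTerm.map S V n (f n)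
      map_id := fun j => Sigma.hom_ext _ _ fun n => by
        rw [Sigma.ι_map, Category.comp_id, Pi.id_apply, artinTerm.map_id, Category.id_comp]
      map_comp := fun {j j' j''} f f' => Sigma.hom_ext _ _ fun n => by
        rw [Sigma.ι_map, Sigma.ι_map_assoc, Sigma.ι_map, Pi.comp_apply, artinTerm.map_comp,
          Category.assoc] }

/-- The map from the `n`-th tensor power of `V` to `S[V]` given by `v ↦ x ⊗ v`, for a compatible
family `x` of elements of the inverse system `S(n)`. -/
def artin.eval (S : BraidedSeq.{t} k) (V : C) (n : ℕ) (x : ∀ j, (S.obj n).diag.obj j)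
    (hx : ∀ {j j' : (S.obj n).ι} (f : j ⟶ j'), (S.obj n).diag.map f (x j) = x j') :
    (Pro.const C).obj (tensorPow V n) ⟶ artin S V where
  germ := fun j => Pro.Germ.mk (X := (Pro.const C).obj (tensorPow V n)) ⟨⟨⟩⟩
    (artinTerm.ι S V n (j n) (x (j n)) ≫ Sigma.ι (fun n => artinTerm S V n (j n)) n)
  compat := fun {j j'} f => by
    refine congrArg (Pro.Germ.mk (X := (Pro.const C).obj (tensorPow V n)) ⟨⟨⟩⟩) ?_
    refine (artinTerm.ι_sigmaMap S V f n (x (j n))).trans ?_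
    rw [hx (f n)]
    rfl

end Balanced

section NicEval

variable (k : Type w) [Field k]

/-- The class in `Nic(n)` of an element of the group ring of the braid group. -/
def nicClass {n : ℕ} (α : MonoidAlgebra k (Braid n)) (Q : FinQuot n) : QuotAlg k Q ⧸ worKer k Q :=
  (worKer k Q).mkQ (toQuotAlg k Q α)

theorem nicClass_compat {n : ℕ} (α : MonoidAlgebra k (Braid n)) {P Q : FinQuot n} (f : P ⟶ Q) :
    (((nic k).obj n).diag.map f : ModuleCat.of k (QuotAlg k P ⧸ worKer k P) ⟶
      ModuleCat.of k (QuotAlg k Q ⧸ worKer k Q)) (nicClass k α P) = nicClass k α Q :=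
  congrArg (worKer k Q).mkQ (quotAlgMap_toQuotAlg k (leOfHom f) α)

variable {C : Type u} [Category.{v} C] [Preadditive C] [Linear k C] [HasCoproducts.{w} C]
  [HasCoequalizers C] [MonoidalCategory C] [BraidedCategory C] [HasCountableCoproducts C]

/-- The map from the `n`-th tensor power of `V` to `Nic[V]` given by `v ↦ g ⊗ v`,
for a braid `g`. -/
def nicEval (V : C) {n : ℕ} (g : Braid n) :
    (Pro.const C).obj (tensorPow V n) ⟶ artin (nic k) V :=
  artin.eval (nic k) V n (nicClass k (MonoidAlgebra.single g 1)) fun f => nicClass_compat k _ f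

end NicEval

/-! ### Tensor algebras and Nichols algebras -/

section TensorAlgebra

variable {C : Type u} [Category.{v} C] [MonoidalCategory C] [BraidedCategory C]
  [HasCountableCoproducts C] [∀ X : C, PreservesColimitsOfShape (Discrete ℕ) (tensorLeft X)]

/-- Maps out of `X ⊗ ∐ Y`. -/
def descLeft {Y : ℕ → C} {Z : C} (X : C) (f : ∀ q, X ⊗ Y q ⟶ Z) : X ⊗ ∐ Y ⟶ Z :=
  (PreservesCoproduct.iso (tensorLeft X) Y).hom ≫ Sigma.desc f

theorem ι_descLeft {Y : ℕ → C} {Z : C} (X : C) (f : ∀ q, X ⊗ Y q ⟶ Z) (q : ℕ) :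
    X ◁ Sigma.ι Y q ≫ descLeft X f = f q := by
  have h : (tensorLeft X).map (Sigma.ι Y q) ≫ (PreservesCoproduct.iso (tensorLeft X) Y).hom =
      Sigma.ι (fun q => (tensorLeft X).obj (Y q)) q := by
    rw [← Iso.eq_comp_inv, PreservesCoproduct.inv_hom]
    exact (ι_comp_sigmaComparison (tensorLeft X) Y q).symm
  calc _ = ((tensorLeft X).map (Sigma.ι Y q) ≫ (PreservesCoproduct.iso (tensorLeft X) Y).hom) ≫
        Sigma.desc f := (Category.assoc _ _ _).symm
    _ = _ := by rw [h, Sigma.ι_desc]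

/-- Maps out of `(∐ Y) ⊗ (∐ Y')`. -/
def descTwo {Y Y' : ℕ → C} {Z : C} (f : ∀ p q, Y p ⊗ Y' q ⟶ Z) : (∐ Y) ⊗ (∐ Y') ⟶ Z :=
  descLeft (∐ Y) fun q =>
    (β_ (∐ Y) (Y' q)).hom ≫ descLeft (Y' q) fun p => (β_ (Y p) (Y' q)).inv ≫ f p q

theorem ι_descTwo {Y Y' : ℕ → C} {Z : C} (f : ∀ p q, Y p ⊗ Y' q ⟶ Z) (p q : ℕ) :
    (Sigma.ι Y p ⊗ₘ Sigma.ι Y' q) ≫ descTwo f = f p q := by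
  rw [MonoidalCategory.tensorHom_def, Category.assoc, descTwo, ι_descLeft,
    BraidedCategory.braiding_naturality_left_assoc, ι_descLeft, Iso.hom_inv_id_assoc]

/-- The object underlying the tensor algebra `T(V)` and the tensor coalgebra of `V`. -/
def tensorAlg (V : C) : C := ∐ fun n => tensorPow V n

/-- The inclusion of a tensor power. -/
def tensorAlg.ι (V : C) (n : ℕ) : tensorPow V n ⟶ tensorAlg V := Sigma.ι _ n

/-- The product of the tensor algebra `T(V)`: concatenation. -/
def concatMul (V : C) : tensorAlg V ⊗ tensorAlg V ⟶ tensorAlg V :=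
  descTwo fun p q => (concat V p q).hom ≫ tensorAlg.ι V (p + q)

variable (k : Type w) [Field k] [Preadditive C] [Linear k C]

/-- The product of the tensor coalgebra of `V`: the quantum shuffle product. -/
def shuffleMul (V : C) : tensorAlg V ⊗ tensorAlg V ⟶ tensorAlg V :=
  descTwo fun p q =>
    (concat V p q).hom ≫ algAct k V (p + q) (shuffleSum k (p + q) p) ≫ tensorAlg.ι V (p + q)

/-- The iterated quantum shuffle product `v₁ ⊗ ⋯ ⊗ vₙ ↦ v₁ ⋆ ⋯ ⋆ vₙ` of elements of `V`. -/
def iterShuffle (V : C) : ∀ n, tensorPow V n ⟶ tensorPow V n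
  | 0 => 𝟙 _
  | n + 1 => iterShuffle V n ▷ V ≫ algAct k V (n + 1) (shuffleSum k (n + 1) n)

/-- The map from the tensor algebra (with concatenation) to the tensor coalgebra (with the quantum
shuffle product) which is multiplicative and restricts to the identity of `V`. -/
def tensorAlgToCo (V : C) : tensorAlg V ⟶ tensorAlg V :=
  Limits.Sigma.map fun n => iterShuffle k V n

variable [HasImages C]

/-- The Nichols algebra of `V`: the image of the tensor algebra in the tensor coalgebra. -/
def nichols (V : C) : C := image (tensorAlgToCo k V)

/-- The inclusion of the Nichols algebra in the tensor coalgebra. -/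
def nichols.incl (V : C) : nichols k V ⟶ tensorAlg V := image.ι (tensorAlgToCo k V)

/-- The projection from the tensor algebra to the Nichols algebra. -/
def nichols.proj (V : C) : tensorAlg V ⟶ nichols k V := factorThruImage (tensorAlgToCo k V)

open MonObj in
/-- The algebra structure on the Nichols algebra is the one for which the projection from the tensor
algebra (with concatenation) and the inclusion in the tensor coalgebra (with the quantum shuffle
product) are algebra maps. -/
structure IsNicholsAlgebra (V : C) [MonObj (nichols k V)] : Prop where
  one_incl : η[nichols k V] ≫ nichols.incl k V = tensorAlg.ι V 0
  mul_incl : μ[nichols k V] ≫ nichols.incl k V =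
    (nichols.incl k V ⊗ₘ nichols.incl k V) ≫ shuffleMul k V
  one_proj : tensorAlg.ι V 0 ≫ nichols.proj k V = η[nichols k V]
  mul_proj : concatMul V ≫ nichols.proj k V =
    (nichols.proj k V ⊗ₘ nichols.proj k V) ≫ μ[nichols k V]

end TensorAlgebra

section NicAlgebra

variable {C : Type u} [Category.{v} C] [MonoidalCategory C]

/-- Constant pro-objects on algebras are algebras. -/
instance constMonObj (A : C) [MonObj A] : MonObj ((Pro.const.{t} C).obj A) :=
  Functor.monObjObj (F := Pro.const.{t} C) A

variable (k : Type w) [Field k] [Preadditive C] [Linear k C] [HasCoproducts.{w} C]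
  [HasCoequalizers C] [BraidedCategory C] [HasCountableCoproducts C]

open MonObj in
/-- The algebra structure on `Nic[V]` induced by the left module structure of `Nic` over the
profinite braided associative operad: the unit is given by the trivial braid on no strands, and
`(g ⊗ v) (h ⊗ w) = (g | h) ⊗ (v ⊗ w)`, where `g | h`, the juxtaposition of the braids `g` and
`h`, is the operadic composite of the trivial braid on two strands with `g` and `h`. -/
structure IsNicAlgebra (V : C) [MonObj (artin (nic k) V)] : Prop where
  one : η[artin (nic k) V] = nicEval k V (1 : Braid 0)
  mul : ∀ {p q : ℕ} (g : Braid p) (h : Braid q),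
    (nicEval k V g ⊗ₘ nicEval k V h) ≫ μ[artin (nic k) V] =
      Functor.LaxMonoidal.μ (Pro.const C) _ _ ≫ (Pro.const C).map (concat V p q).hom ≫
        nicEval k V (juxt g h)

end NicAlgebra

end BraidedNichols

end

namespace BraidedNichols

noncomputable section

/-! ### Moving a generator through a cabled crossing -/

/-! Two facts carry the proof: the quantum symmetrizer factors through the symmetrizer of any block
of consecutive strands, and group rings of finite groups are semisimple in characteristic `0`.

Factorization: the Matsumoto lift is multiplicative on products of permutations whose lengths add
(`matsumoto_mul`). Every permutation of `N` points is uniquely one that is increasing on a given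
block times a permutation of the block, and here lengths do add. Hence `S_N = y · S_n` with `S_n`
placed on the block (`sum_matsumoto_eq_mul`). For the blocks of the first `p` and last `q` points
together this gives `S_{p+q} = Sh_{p,q} · (S_p | S_q)`.

Left ideal: a braid inside a cable slides through it (`shift_mul_cable`). If the cabled strand of
`γ` ends at `γ(i)`, factoring `S_N` through the block starting there gives `S_N (γ ∘ᵢ w) = y ·
cable(γ) · shiftᵢ(S_n w)`, which vanishes when `S_n w = 0`.

Strictness: for a surjection of finite groups `P → Q`, let `e` be the average over its kernel. Then
`e ↦ 1`, and `e` annihilates from the right everything that dies in `k[Q]`. If `S x = 0` in `k[Q]`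
and `y` lifts `x`, then `y e` also lifts `x` and `S y e = 0` (`exists_mem_worKer`).

Nichols algebra: the map `T(V) → T^co(V)` is the action of `S_n` in degree `n` (`iterShuffle_eq`).
Let `K_n` be the kernel of the action on the `n`-th tensor power. Since `k[B_n/K_n]` is semisimple,
it contains `t` with `S t S = S`. Thus the projection `T(V) → 𝔅(V)` is a split epimorphism and stays
epi after tensoring, so the algebra axioms descend from `T(V)` without any exactness of the tensor
product.

Comparison: at level `K` the map `Nic[V] → 𝔅(V)` is `x ⊗ v ↦ x v`, and the inverse is `𝔅(V) → T(V) →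
Nic[V]`, built from `t` and `v ↦ 1 ⊗ v`. One composite sends `x ⊗ v` to `t S x ⊗ v`. This is `x ⊗ v`
because `S t S x = S x` over `K`; strictness carries the conclusion from `K` to an arbitrary level
(`nicι_eq_of_quantumSymmetrizer_mul`). The algebra structure of `Nic[V]` is transported along the
isomorphism. -/

theorem shift_gen {n N : ℕ} (a : ℕ) (h : a + n ≤ N) (i : ℕ) (hi : i + 1 < n) :
    shift a h (braidGen n i) = braidGen N (a + i) := by
  rw [shift, braidLift_gen _ _ _ hi]

/-- `ascProd` moves one strand across `l` others, and a crossing between two of those others slides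
past it with its index changed by one. -/
theorem IsBraiding.asc_shift {G : Type*} [Group G] {s : ℕ → G} {N : ℕ} (hs : IsBraiding N s)
    {a b : ℕ} : ∀ {l : ℕ}, b + 2 ≤ l → a + l < N →
      s (a + 1 + b) * ascProd s a l = ascProd s a l * s (a + b)
  | 0, h, _ => by omega
  | l + 1, h, hl => by
    rcases Nat.lt_or_ge l (b + 2) with hb | hb
    -- In the shortest case only the last two factors fail to commute with the generator, and one
    -- braid relation handles them.
    · obtain rfl : l = b + 1 := by omega
      have h1 := hs.braid (a + b) (by omega)
      have h2 : s (a + b + 1) * ascProd s a b = ascProd s a b * s (a + b + 1) :=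
        hs.comm_asc (Or.inr ⟨by omega, by omega⟩)
      have e : a + 1 + b = a + b + 1 := by omega
      have e' : a + (b + 1) = a + b + 1 := by omega
      simp only [ascProd, e, e']
      calc s (a + b + 1) * (ascProd s a b * s (a + b) * s (a + b + 1))
          = (s (a + b + 1) * ascProd s a b) * s (a + b) * s (a + b + 1) := by group
        _ = ascProd s a b * (s (a + b + 1) * s (a + b) * s (a + b + 1)) := by rw [h2]; group
        _ = _ := by rw [← h1]; group
    -- The additional factor has index at least `a + b + 2`, so it commutes with the generator that
    -- has come through.
    · have h1 := hs.asc_shift (a := a) hb (by omega)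
      have h2 := hs.comm (a + b) (a + l) (by omega) (by omega)
      rw [ascProd, ← mul_assoc, h1, mul_assoc, h2, mul_assoc]

theorem IsBraiding.desc_shift {G : Type*} [Group G] {s : ℕ → G} {N : ℕ} (hs : IsBraiding N s)
    {a b : ℕ} : ∀ {l : ℕ}, b + 2 ≤ l → a + l < N →
      s (a + b) * descProd s a l = descProd s a l * s (a + 1 + b)
  | 0, h, _ => by omega
  | l + 1, h, hl => by
    rcases Nat.lt_or_ge l (b + 2) with hb | hb
    · obtain rfl : l = b + 1 := by omega
      have h1 := hs.braid (a + b) (by omega)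
      have h2 : s (a + b + 1) * descProd s a b = descProd s a b * s (a + b + 1) :=
        hs.comm_desc (Or.inr ⟨by omega, by omega⟩)
      have e : a + 1 + b = a + b + 1 := by omega
      have e' : a + (b + 1) = a + b + 1 := by omega
      simp only [descProd, e, e']
      calc s (a + b) * (s (a + b + 1) * (s (a + b) * descProd s a b))
          = (s (a + b) * s (a + b + 1) * s (a + b)) * descProd s a b := by group
        _ = s (a + b + 1) * s (a + b) * (s (a + b + 1) * descProd s a b) := by rw [h1]; group
        _ = _ := by rw [h2]; group
    · have h1 := hs.desc_shift (a := a) hb (by omega)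
      have h2 := hs.comm (a + b) (a + l) (by omega) (by omega)
      rw [descProd, ← mul_assoc, h2, mul_assoc, h1, mul_assoc]

/-! ### Multiplicativity of the Matsumoto section -/

/-- `i` occurs before `i + 1` among the values of `τ`. -/
def IsAscent {n : ℕ} (τ : Equiv.Perm (Fin n)) (i : ℕ) : Prop :=
  ∀ x y : Fin n, (τ x : ℕ) = i → (τ y : ℕ) = i + 1 → x < y

theorem map_braidGen_prod {n N : ℕ} (h : 0 + n ≤ N) : ∀ w : List ℕ, (∀ i ∈ w, i + 1 < n) →
    (w.map (braidGen N)).prod = shift 0 h (w.map (braidGen n)).prod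
  | [], _ => by simp
  | i :: w, hw => by
    rw [List.map_cons, List.map_cons, List.prod_cons, List.prod_cons, map_mul,
      shift_gen _ _ _ (hw i (by simp)), Nat.zero_add,
      map_braidGen_prod h w fun j hj => hw j (by simp [hj])]

theorem range'_map_prod {G : Type*} [Group G] (s : ℕ → G) (a : ℕ) : ∀ l,
    ((List.range' a l).map s).prod = ascProd s a l
  | 0 => rfl
  | l + 1 => by
    rw [List.range'_concat, List.map_append, List.prod_append, range'_map_prod s a l]
    simp [ascProd]

theorem matsumoto_succ {n : ℕ} (τ : Equiv.Perm (Fin (n + 1))) :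
    matsumoto (n + 1) τ = ascProd (braidGen (n + 1)) (τ (Fin.last n)) (n - τ (Fin.last n)) *
      shift 0 (by omega) (matsumoto n (restrictLast τ)) := by
  rw [matsumoto, matsumotoWord, List.map_append, List.prod_append, range'_map_prod,
    map_braidGen_prod (n := n) (by omega) _ (matsumotoWord_lt n _), matsumoto]

theorem matsumoto_one (n : ℕ) : matsumoto n 1 = 1 := by
  rw [matsumoto, matsumotoWord_one]; rfl

/-- Multiplying on the left at an ascent lengthens the permutation, and the lift follows. The
induction removes the last point, with value `j`. An ascent excludes `j = i`. If `j = i + 1`, the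
new letter extends the leading run. Otherwise the transposition acts on the restricted permutation
with index `i` or `i - 1`, and `σᵢ` is carried through the leading run. -/
theorem matsumoto_adjSwap_mul : ∀ (n : ℕ) (τ : Equiv.Perm (Fin n)) (i : ℕ), i + 1 < n →
    IsAscent τ i →
    (matsumotoWord n (adjSwap n i * τ)).length = (matsumotoWord n τ).length + 1 ∧
    matsumoto n (adjSwap n i * τ) = braidGen n i * matsumoto n τ
  | 0, _, _, hi, _ => by omega
  | n + 1, τ, i, hi, h => by
    have key : ∀ (a : Fin n), (((adjSwap (n + 1) i * τ) (Fin.last n)).succAbove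
        (restrictLast (adjSwap (n + 1) i * τ) a) : ℕ) = adjSwap (n + 1) i
          ((τ (Fin.last n)).succAbove (restrictLast τ a)) := fun a => by
      rw [restrictLast_spec, restrictLast_spec]; rfl
    simp only [succAbove_val, adjSwap_val hi, Equiv.Perm.mul_apply] at key
    have hj := (τ (Fin.last n)).2
    have hsp : ∀ a : Fin n, (τ a.castSucc : ℕ) =
        if (restrictLast τ a : ℕ) < τ (Fin.last n) then (restrictLast τ a : ℕ)
          else restrictLast τ a + 1 := fun a => by rw [← restrictLast_spec, succAbove_val]
    simp only [matsumotoWord, List.length_append, List.length_range', Equiv.Perm.mul_apply,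
      adjSwap_val hi, matsumoto_succ]
    -- If the last point had value `i`, the point with value `i + 1` would have to come after it.
    have hne : (τ (Fin.last n) : ℕ) ≠ i := fun h0 => by
      have h1 : (τ (τ⁻¹ ⟨i + 1, hi⟩) : ℕ) = i + 1 := by simp
      exact (Fin.le_last _).not_gt (h _ _ h0 h1)
    by_cases h1 : (τ (Fin.last n) : ℕ) = i + 1
    · have : restrictLast (adjSwap (n + 1) i * τ) = restrictLast τ := by
        ext a
        have := key a
        split_ifs at this <;> omega
      rw [this, if_neg hne, if_pos h1, h1]
      refine ⟨by omega, ?_⟩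
      rw [← mul_assoc]
      congr 1
      rw [← range'_map_prod, ← range'_map_prod, show n - i = n - (i + 1) + 1 by omega,
        List.range'_succ, List.map_cons, List.prod_cons]
    · rw [if_neg hne, if_neg h1] at key ⊢
      -- Deleting the value `j` lowers the values above it by one, so the index drops to `i - 1`
      -- exactly when `j < i`.
      obtain ⟨i', hi', hii⟩ : ∃ i', i' + 1 < n ∧
          (i + 1 < (τ (Fin.last n) : ℕ) ∧ i' = i ∨ (τ (Fin.last n) : ℕ) < i ∧ i = i' + 1) := by
        rcases Nat.lt_or_ge i (τ (Fin.last n)) with h | h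
        · exact ⟨i, by omega, Or.inl ⟨by omega, rfl⟩⟩
        · exact ⟨i - 1, by omega, Or.inr ⟨by omega, by omega⟩⟩
      have h2 : restrictLast (adjSwap (n + 1) i * τ) = adjSwap n i' * restrictLast τ := by
        ext a
        have h4 := key a
        rw [Equiv.Perm.mul_apply, adjSwap_val hi']
        clear key h hsp
        generalize ((restrictLast (adjSwap (n + 1) i * τ)) a : ℕ) = y at *
        generalize (restrictLast τ a : ℕ) = z at *
        generalize (τ (Fin.last n) : ℕ) = j at *
        split_ifs at h4 ⊢ <;> omega
      have h5 : IsAscent (restrictLast τ) i' := fun x y hx hy => by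
        have h6 := hsp x
        have h7 := hsp y
        refine Fin.castSucc_lt_castSucc_iff.1 (h _ _ (h6.trans ?_) (h7.trans ?_))
        · split_ifs <;> omega
        · split_ifs <;> omega
      obtain ⟨h3, h3'⟩ := matsumoto_adjSwap_mul n (restrictLast τ) i' hi' h5
      rw [h2]
      refine ⟨by omega, ?_⟩
      rw [h3', map_mul, shift_gen _ _ _ hi', ← mul_assoc, ← mul_assoc]
      congr 1
      rw [Nat.zero_add]
      -- Below the leading run `σᵢ` commutes with it; inside the run `asc_shift` absorbs the change
      -- of index.
      rcases hii with ⟨h6, rfl⟩ | ⟨h6, rfl⟩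
      · exact ((isBraiding_gen (n + 1)).comm_asc (Or.inl ⟨h6, by omega⟩)).symm
      · have := (isBraiding_gen (n + 1)).asc_shift (a := τ (Fin.last n))
          (b := i' - τ (Fin.last n)) (l := n - τ (Fin.last n)) (by omega) (by omega)
        rw [show (τ (Fin.last n) : ℕ) + 1 + (i' - τ (Fin.last n)) = i' + 1 by omega,
          show (τ (Fin.last n) : ℕ) + (i' - τ (Fin.last n)) = i' by omega] at this
        exact this.symm

theorem adjSwap_mul_self (n i : ℕ) : adjSwap n i * adjSwap n i = 1 := by
  conv_lhs => lhs; rw [← adjSwap_inv]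
  exact inv_mul_cancel _

theorem eq_one_of_strictMono {n : ℕ} {τ : Equiv.Perm (Fin n)} (h : StrictMono τ) : τ = 1 := by
  ext x
  have := Subsingleton.elim (h.orderIsoOfSurjective _ τ.surjective) (OrderIso.refl _)
  exact congrArg Fin.val (DFunLike.congr_fun this x)

/-- If no two consecutive values are in the wrong order, then `τ⁻¹` is increasing, and an increasing
permutation is the identity. -/
theorem exists_descent {n : ℕ} {τ : Equiv.Perm (Fin n)} (h : τ ≠ 1) :
    ∃ i, i + 1 < n ∧ IsAscent (adjSwap n i * τ) i := by
  by_contra! hc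
  refine h (inv_eq_one.1 (eq_one_of_strictMono ?_))
  cases n with
  | zero => exact fun x => x.elim0
  | succ n =>
    refine Fin.strictMono_iff_lt_succ.2 fun i => ?_
    by_contra! hi
    refine hc i (by omega) fun x y hx hy => ?_
    rw [Equiv.Perm.mul_apply, adjSwap_val (by omega)] at hx hy
    have hx' : τ x = i.succ := by
      ext; rw [Fin.val_succ]; split_ifs at hx <;> omega
    have hy' : τ y = i.castSucc := by
      ext; rw [Fin.val_castSucc]; split_ifs at hy <;> omega
    rw [← hx', ← hy', Equiv.Perm.inv_def, Equiv.symm_apply_apply, Equiv.symm_apply_apply] at hi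
    refine lt_of_le_of_ne hi fun e => ?_
    rw [e, hy'] at hx'
    exact absurd (congrArg Fin.val hx') (by simp)

/-- Induction on permutations along reduced words. -/
theorem perm_induction {n : ℕ} {P : Equiv.Perm (Fin n) → Prop} (h1 : P 1)
    (h2 : ∀ τ i, i + 1 < n → IsAscent τ i → P τ → P (adjSwap n i * τ)) (τ : Equiv.Perm (Fin n)) :
    P τ := by
  induction hl : (matsumotoWord n τ).length using Nat.strong_induction_on generalizing τ with
  | _ l ih =>
    by_cases h : τ = 1
    · rwa [h]
    · obtain ⟨i, hi, ha⟩ := exists_descent h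
      have e : adjSwap n i * (adjSwap n i * τ) = τ := by
        rw [← mul_assoc, adjSwap_mul_self, one_mul]
      have hl' := (matsumoto_adjSwap_mul n _ i hi ha).1
      rw [e] at hl'
      rw [← e]
      exact h2 _ _ hi ha (ih _ (by omega) _ rfl)

/-- The Matsumoto section is multiplicative on pairs of permutations whose lengths add up. -/
theorem matsumoto_mul {n : ℕ} (τ w : Equiv.Perm (Fin n))
    (h : ∀ u v, w u < w v → v < u → τ (w u) < τ (w v)) :
    matsumoto n (τ * w) = matsumoto n τ * matsumoto n w := by
  -- The hypothesis says that `τ` undoes no inversion of `w`, i.e. that the lengths add. It is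
  -- inherited when the first letter of a reduced word of `τ` is removed.
  induction τ using perm_induction with
  | h1 => rw [matsumoto_one, one_mul, one_mul]
  | h2 τ i hi ha ih =>
    have h' : ∀ x, ((adjSwap n i * τ) x : ℕ) = _ := fun x => adjSwap_val hi (τ x)
    -- The letter changes only the relative order of the values `i` and `i + 1`, and for those the
    -- ascent decides.
    have hc : ∀ u v, w u < w v → v < u → τ (w u) < τ (w v) := fun u v h1 h2 => by
      have h3 := h u v h1 h2
      rw [Fin.lt_def, h', h'] at h3
      rw [Fin.lt_def]
      by_contra! h4
      have h5 := ha (w v) (w u)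
      refine h1.not_gt (h5 ?_ ?_) <;> (split_ifs at h3 <;> omega)
    -- If `i + 1` came first in `τ w`, that pair would be an inversion of `w` which the letter
    -- undoes.
    have ha' : IsAscent (τ * w) i := fun x y hx hy => by
      rw [Equiv.Perm.mul_apply] at hx hy
      have h1 := ha _ _ hx hy
      by_contra! h2
      have hne : y ≠ x := fun e => by rw [e] at hy; omega
      have h3 := h x y h1 (lt_of_le_of_ne h2 hne)
      rw [Fin.lt_def, h', h'] at h3
      split_ifs at h3 <;> omega
    rw [mul_assoc, (matsumoto_adjSwap_mul n _ i hi ha').2, ih hc, ← mul_assoc,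
      (matsumoto_adjSwap_mul n _ i hi ha).2]

/-! ### Permutations of a block of consecutive points -/

/-- The `i`-th point of the block `a, …, a + n - 1`. -/
def blockPos {n N : ℕ} (a : ℕ) (h : a + n ≤ N) (i : Fin n) : Fin N := ⟨a + i, by omega⟩

theorem blockPos_val {n N : ℕ} (a : ℕ) (h : a + n ≤ N) (i : Fin n) :
    (blockPos a h i : ℕ) = a + i := rfl

theorem blockPos_cases {n N : ℕ} (a : ℕ) (h : a + n ≤ N) (x : Fin N) :
    ((x : ℕ) < a ∨ a + n ≤ x) ∨ ∃ i, x = blockPos a h i := by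
  by_cases hx : (x : ℕ) < a ∨ a + n ≤ x
  · exact Or.inl hx
  · exact Or.inr ⟨⟨x - a, by omega⟩, Fin.ext (by simp only [blockPos_val]; omega)⟩

/-- Permutations of the block `a, …, a + n - 1`, extended by the identity. -/
def blockPerm {n N : ℕ} (a : ℕ) (h : a + n ≤ N) : Equiv.Perm (Fin n) →* Equiv.Perm (Fin N) :=
  Equiv.Perm.extendDomainHom
    { toFun := fun i => (⟨blockPos a h i, by simp only [blockPos_val]; omega⟩ :
        {x : Fin N // a ≤ x ∧ (x : ℕ) < a + n})
      invFun := fun x => ⟨x.1 - a, by have := x.2; omega⟩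
      left_inv := fun i => Fin.ext (by simp [blockPos_val])
      right_inv := fun x => Subtype.ext (Fin.ext (by have := x.2; simp only [blockPos_val]; omega)) }

theorem blockPerm_pos {n N : ℕ} (a : ℕ) (h : a + n ≤ N) (w : Equiv.Perm (Fin n)) (i : Fin n) :
    blockPerm a h w (blockPos a h i) = blockPos a h (w i) :=
  Equiv.Perm.extendDomain_apply_image w _ i

theorem blockPerm_of_notMem {n N : ℕ} (a : ℕ) (h : a + n ≤ N) (w : Equiv.Perm (Fin n)) {x : Fin N}
    (hx : (x : ℕ) < a ∨ a + n ≤ x) : blockPerm a h w x = x :=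
  Equiv.Perm.extendDomain_apply_not_subtype w _ (by omega)

theorem blockPerm_adjSwap {n N : ℕ} (a : ℕ) (h : a + n ≤ N) {i : ℕ} (hi : i + 1 < n) :
    blockPerm a h (adjSwap n i) = adjSwap N (a + i) := by
  ext x
  rw [adjSwap_val (by omega)]
  rcases blockPos_cases a h x with hx | ⟨j, rfl⟩
  · rw [blockPerm_of_notMem a h _ hx]
    split_ifs <;> omega
  · rw [blockPerm_pos, blockPos_val, blockPos_val, adjSwap_val hi]
    split_ifs <;> omega

/-- An ascent of `τ` at `i` becomes an ascent of the extended permutation at `a + i`, so both sides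
grow by the same letters along a reduced word. -/
theorem matsumoto_blockPerm {n N : ℕ} (a : ℕ) (h : a + n ≤ N) (w : Equiv.Perm (Fin n)) :
    matsumoto N (blockPerm a h w) = shift a h (matsumoto n w) := by
  induction w using perm_induction with
  | h1 => rw [map_one, matsumoto_one, matsumoto_one, map_one]
  | h2 τ i hi ha ih =>
    have ha' : IsAscent (blockPerm a h τ) (a + i) := fun x y hx hy => by
      rcases blockPos_cases a h x with hx' | ⟨x, rfl⟩
      · rw [blockPerm_of_notMem a h _ hx'] at hx; omega
      rcases blockPos_cases a h y with hy' | ⟨y, rfl⟩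
      · rw [blockPerm_of_notMem a h _ hy'] at hy; omega
      rw [blockPerm_pos, blockPos_val] at hx hy
      have := ha x y (by omega) (by omega)
      simp only [Fin.lt_def, blockPos_val] at this ⊢
      omega
    rw [map_mul, blockPerm_adjSwap a h hi, (matsumoto_adjSwap_mul N _ _ (by omega) ha').2, ih,
      (matsumoto_adjSwap_mul n _ _ hi ha).2, map_mul, shift_gen _ _ _ hi]

/-- `τ` is increasing on the block `a, …, a + n - 1`. -/
def IncOn {n N : ℕ} (a : ℕ) (h : a + n ≤ N) (τ : Equiv.Perm (Fin N)) : Prop :=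
  StrictMono (τ ∘ blockPos a h)

/-- Both points of any inversion of the block permutation lie in the block, where `τ` preserves the
order; so no inversion is undone and `matsumoto_mul` applies. -/
theorem matsumoto_mul_blockPerm {n N : ℕ} (a : ℕ) (h : a + n ≤ N) {τ : Equiv.Perm (Fin N)}
    (hτ : IncOn a h τ) (w : Equiv.Perm (Fin n)) :
    matsumoto N (τ * blockPerm a h w) = matsumoto N τ * shift a h (matsumoto n w) := by
  rw [← matsumoto_blockPerm]
  refine matsumoto_mul _ _ fun u v h1 h2 => ?_
  rcases blockPos_cases a h u with hu | ⟨u, rfl⟩ <;>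
    rcases blockPos_cases a h v with hv | ⟨v, rfl⟩
  · rw [blockPerm_of_notMem a h _ hu, blockPerm_of_notMem a h _ hv] at h1
    exact absurd h2 h1.not_gt
  · rw [blockPerm_of_notMem a h _ hu, blockPerm_pos] at h1
    simp only [Fin.lt_def, blockPos_val] at h1 h2
    omega
  · rw [blockPerm_of_notMem a h _ hv, blockPerm_pos] at h1
    simp only [Fin.lt_def, blockPos_val] at h1 h2
    omega
  · rw [blockPerm_pos, blockPerm_pos] at h1 ⊢
    refine hτ ?_
    simp only [Fin.lt_def, blockPos_val] at h1 ⊢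
    omega

theorem comp_blockPerm {n N : ℕ} (a : ℕ) (h : a + n ≤ N) (τ : Equiv.Perm (Fin N))
    (w : Equiv.Perm (Fin n)) :
    (τ * blockPerm a h w : Equiv.Perm (Fin N)) ∘ blockPos a h = (τ ∘ blockPos a h) ∘ w :=
  funext fun i => congrArg τ (blockPerm_pos a h w i)

theorem blockPos_injective {n N : ℕ} (a : ℕ) (h : a + n ≤ N) : Function.Injective (blockPos a h) :=
  fun i j e => Fin.ext (by have := congrArg Fin.val e; simp only [blockPos_val] at this; omega)

/-- The permutation sorting the values of `τ` on the block `a, …, a + n - 1`. -/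
def blockSort {n N : ℕ} (a : ℕ) (h : a + n ≤ N) (τ : Equiv.Perm (Fin N)) : Equiv.Perm (Fin n) :=
  Tuple.sort (τ ∘ blockPos a h)

theorem incOn_mul_blockSort {n N : ℕ} (a : ℕ) (h : a + n ≤ N) (τ : Equiv.Perm (Fin N)) :
    IncOn a h (τ * blockPerm a h (blockSort a h τ)) := by
  rw [IncOn, comp_blockPerm]
  exact (Tuple.monotone_sort _).strictMono_of_injective
    ((τ.injective.comp (blockPos_injective a h)).comp (Equiv.injective _))

/-- This is uniqueness of the factorization: `τ` is already increasing on the block, so the values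
become sorted only when `w` is cancelled. -/
theorem blockSort_mul {n N : ℕ} (a : ℕ) (h : a + n ≤ N) {τ : Equiv.Perm (Fin N)}
    (hτ : IncOn a h τ) (w : Equiv.Perm (Fin n)) :
    blockSort a h (τ * blockPerm a h w) = w⁻¹ := by
  have h1 := incOn_mul_blockSort a h (τ * blockPerm a h w)
  rw [mul_assoc, ← map_mul, IncOn, comp_blockPerm] at h1
  have h2 : w * blockSort a h (τ * blockPerm a h w) = 1 :=
    eq_one_of_strictMono fun i j hij => hτ.lt_iff_lt.1 (h1 hij)
  exact eq_inv_of_mul_eq_one_right h2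

/-! ### Factorizations of the quantum symmetrizer. -/

section Symmetrizers

variable (k : Type w) [Field k]

/-- The extension of `shift` to group rings. -/
def shiftAlg {n N : ℕ} (a : ℕ) (h : a + n ≤ N) :
    MonoidAlgebra k (Braid n) →ₐ[k] MonoidAlgebra k (Braid N) :=
  MonoidAlgebra.mapDomainAlgHom k k (shift a h)

theorem shiftAlg_single {n N : ℕ} (a : ℕ) (h : a + n ≤ N) (g : Braid n) (c : k) :
    shiftAlg k a h (MonoidAlgebra.single g c) = MonoidAlgebra.single (shift a h g) c := by
  exact MonoidAlgebra.mapDomain_single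

open Classical in
/-- The sum of the Matsumoto lifts of the permutations in a set invariant under permutations of a
block factors through the quantum symmetrizer of the block. -/
theorem sum_matsumoto_eq_mul {n N : ℕ} (a : ℕ) (h : a + n ≤ N) (P P' : Equiv.Perm (Fin N) → Prop)
    (hP : ∀ τ w, P τ → P (τ * blockPerm a h w)) (hP' : ∀ τ, P' τ ↔ P τ ∧ IncOn a h τ) :
    ∑ τ : Equiv.Perm (Fin N) with P τ, MonoidAlgebra.single (matsumoto N τ) (1 : k) =
      (∑ τ : Equiv.Perm (Fin N) with P' τ, MonoidAlgebra.single (matsumoto N τ) (1 : k)) *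
      shiftAlg k a h (quantumSymmetrizer k n) := by
  rw [quantumSymmetrizer, map_sum, Finset.sum_mul_sum, ← Finset.sum_product']
  -- Permutations increasing on the block are the minimal representatives of the cosets of the block
  -- permutations; sorting the values on the block finds the representative.
  refine (Finset.sum_nbij' (fun x => x.1 * blockPerm a h x.2)
    (fun τ => (τ * blockPerm a h (blockSort a h τ), (blockSort a h τ)⁻¹)) ?_ ?_ ?_ ?_ ?_).symm
  · rintro ⟨τ, w⟩ hx
    simp only [Finset.mem_product, Finset.mem_filter, hP', Finset.mem_univ, true_and, and_true] at hx ⊢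
    exact hP _ _ hx.1
  · intro τ hx
    simp only [Finset.mem_product, Finset.mem_filter, hP', Finset.mem_univ, true_and, and_true] at hx ⊢
    exact ⟨hP _ _ hx, incOn_mul_blockSort a h τ⟩
  · rintro ⟨τ, w⟩ hx
    simp only [Finset.mem_product, Finset.mem_filter, hP', Finset.mem_univ, true_and, and_true] at hx
    simp only [blockSort_mul a h hx.2, inv_inv, mul_assoc, ← map_mul, mul_inv_cancel, map_one,
      mul_one]
  · intro τ _
    simp only [mul_assoc, ← map_mul, mul_inv_cancel, map_one, mul_one]
  · rintro ⟨τ, w⟩ hx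
    simp only [Finset.mem_product, Finset.mem_filter, hP', Finset.mem_univ, true_and, and_true] at hx
    simp only [shiftAlg_single, MonoidAlgebra.single_mul_single, mul_one,
      matsumoto_mul_blockPerm a h hx.2]

/-- The left ideal property needs this for every position `a`, since a cable may end anywhere. The
cofactor `y` depends on `a`, but its form plays no role. -/
theorem quantumSymmetrizer_eq_mul {n N : ℕ} (a : ℕ) (h : a + n ≤ N) :
    ∃ y, quantumSymmetrizer k N = y * shiftAlg k a h (quantumSymmetrizer k n) := by
  classical
  refine ⟨_, Eq.trans ?_ (sum_matsumoto_eq_mul k a h (fun _ => True) _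
    (fun _ _ _ => trivial) fun _ => Iff.rfl)⟩
  rw [quantumSymmetrizer, Finset.filter_true]

/-- For `p = n` the shuffle condition on the last block is vacuous, as that block is a single point.
This is the recursion that defines `iterShuffle`. -/
theorem quantumSymmetrizer_succ (n : ℕ) :
    quantumSymmetrizer k (n + 1) =
      shuffleSum k (n + 1) n * shiftAlg k 0 (by omega) (quantumSymmetrizer k n) := by
  classical
  refine Eq.trans ?_ (sum_matsumoto_eq_mul k (n := n) (N := n + 1) 0 (by omega) (fun _ => True)
    (IsShuffle n) (fun _ _ _ => trivial) fun τ => ?_)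
  · rw [quantumSymmetrizer, Finset.filter_true]
  rw [true_and]
  constructor
  · exact fun h i j hij => h _ _ (Nat.add_lt_add_left hij _)
      (Or.inl (by rw [blockPos_val]; omega))
  · intro h i j hij hp
    have hj := j.2
    rw [Fin.lt_def] at hij
    have := @h ⟨i, by omega⟩ ⟨j, by omega⟩ hij
    have e : ∀ (x : Fin (n + 1)) (hx : (x : ℕ) < n),
        blockPos (N := n + 1) 0 (by omega) ⟨x, hx⟩ = x :=
      fun x hx => Fin.ext (by simp [blockPos_val])
    rwa [Function.comp_apply, Function.comp_apply, e, e] at this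

theorem isShuffle_iff {p q : ℕ} (τ : Equiv.Perm (Fin (p + q))) :
    IsShuffle p τ ↔ IncOn (n := p) 0 (by omega) τ ∧ IncOn (n := q) p le_rfl τ := by
  constructor
  · exact fun h => ⟨fun i j hij => h _ _ (Nat.add_lt_add_left hij _)
        (Or.inl (by rw [blockPos_val]; omega)),
      fun i j hij => h _ _ (Nat.add_lt_add_left hij _) (Or.inr (Nat.le_add_right _ _))⟩
  · rintro ⟨h1, h2⟩ i j hij hp
    have hi := i.2
    have hj := j.2
    rw [Fin.lt_def] at hij
    rcases hp with hp | hp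
    · have e : ∀ (x : Fin (p + q)) (hx : (x : ℕ) < p),
          blockPos (N := p + q) 0 (by omega) ⟨x, hx⟩ = x :=
        fun x hx => Fin.ext (by simp [blockPos_val])
      have := @h1 ⟨i, by omega⟩ ⟨j, by omega⟩ hij
      rwa [Function.comp_apply, Function.comp_apply, e, e] at this
    · have e : ∀ (x : Fin (p + q)) (hx : p ≤ (x : ℕ)),
          blockPos (n := q) (N := p + q) p le_rfl ⟨x - p, by omega⟩ = x :=
        fun x hx => Fin.ext (by simp only [blockPos_val]; omega)
      have := @h2 ⟨i - p, by omega⟩ ⟨j - p, by omega⟩ (by rw [Fin.lt_def]; simp only; omega)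
      rwa [Function.comp_apply, Function.comp_apply, e _ hp, e _ (by omega)] at this

/-- The block factorization is used twice. Splitting off the first `p` points leaves the
permutations increasing on them; this set is stable under permutations of the last `q` points, so
the second block splits off as well and the shuffles remain. -/
theorem quantumSymmetrizer_add (p q : ℕ) :
    quantumSymmetrizer k (p + q) =
      shuffleSum k (p + q) p * shiftAlg k p le_rfl (quantumSymmetrizer k q) *
        shiftAlg k 0 (by omega) (quantumSymmetrizer k p) := by
  classical
  refine Eq.trans ?_ ((sum_matsumoto_eq_mul k (n := p) (N := p + q) 0 (by omega) (fun _ => True)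
    (IncOn (n := p) 0 (by omega)) (fun _ _ _ => trivial) fun τ => by rw [true_and]).trans ?_)
  · rw [quantumSymmetrizer, Finset.filter_true]
  congr 1
  refine sum_matsumoto_eq_mul k (n := q) (N := p + q) p le_rfl (IncOn (n := p) 0 (by omega)) _
    (fun τ w h i j hij => ?_) isShuffle_iff
  have h1 := h hij
  rw [Function.comp_apply, Function.comp_apply, Equiv.Perm.mul_apply, Equiv.Perm.mul_apply,
    blockPerm_of_notMem, blockPerm_of_notMem]
  · exact h1
  · left; simp [blockPos_val]
  · left; simp [blockPos_val]

end Symmetrizers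

/-! ### Naturality of cabling -/

/-- The cable leaves the crossing at `adjSwap m j i`. If it takes part in the crossing, the crossing
is an `ascProd` or a `descProd`, which shifts the index by one; otherwise the two generators are far
apart and commute. -/
theorem cable_gen_shift_gen {m n N : ℕ} (h : m + n = N + 1) (i : Fin m) {j : ℕ} (hj : j + 1 < m)
    {b : ℕ} (hb : b + 1 < n) :
    braidGen N (adjSwap m j i + b) * cable h i (braidGen m j) =
      cable h i (braidGen m j) * braidGen N (i + b) := by
  have hs := isBraiding_gen N
  have hi := i.2
  rw [cable_gen _ _ _ hj, adjSwap_val hj]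
  generalize (i : ℕ) = x at hi
  by_cases h1 : x = j
  · subst h1
    rw [if_pos rfl, cableGen_succ rfl]
    exact hs.asc_shift (by omega) (by omega)
  by_cases h2 : x = j + 1
  · subst h2
    rw [if_neg h1, if_pos rfl, cableGen_eq rfl]
    exact hs.desc_shift (by omega) (by omega)
  rw [if_neg h1, if_neg h2]
  rcases Nat.lt_or_ge x j with h3 | h3
  · rw [cableGen_lt h3]
    exact hs.comm _ _ (by omega) (by omega)
  · rw [cableGen_gt (by omega)]
    exact (hs.comm _ _ (by omega) (by omega)).symm

theorem braid_induction {n : ℕ} {P : Braid n → Prop} (gen : ∀ j, j + 1 < n → P (braidGen n j))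
    (one : P 1) (mul : ∀ x y, P x → P y → P (x * y)) (inv : ∀ x, P x → P x⁻¹) (x : Braid n) :
    P x := by
  have hx : x ∈ Subgroup.closure (Set.range (PresentedGroup.of (rels := braidRels n))) := by
    rw [PresentedGroup.closure_range_of]; trivial
  induction hx using Subgroup.closure_induction with
  | mem x hx =>
    obtain ⟨j, rfl⟩ := hx
    have hj := j.2
    have e : PresentedGroup.of j = braidGen n j := by simp [braidGen]
    rw [e]
    exact gen j (by omega)
  | one => exact one
  | mul x y _ _ hx hy => exact mul x y hx hy
  | inv x _ hx => exact inv x hx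

/-- A braid on the cabled strands can be pulled through the cable. -/
theorem shift_mul_cable {m n N : ℕ} (h : m + n = N + 1) (γ : Braid m) :
    ∀ (i : Fin m) (x : Braid n),
      shift (N := N) (toPerm m γ i) (by omega) x * cable h i γ =
        cable h i γ * shift (N := N) i (by omega) x := by
  induction γ using braid_induction with
  | gen j hj =>
    intro i x
    induction x using braid_induction with
    | gen b hb =>
      rw [shift_gen _ _ _ hb, shift_gen _ _ _ hb, toPerm, braidLift_gen _ _ _ hj]
      exact cable_gen_shift_gen h i hj hb
    | one => simp
    | mul x y hx hy => rw [map_mul, map_mul, mul_assoc, hy, ← mul_assoc, hx, mul_assoc]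
    | inv x hx =>
      rw [map_inv, map_inv, inv_mul_eq_iff_eq_mul, ← mul_assoc, hx, mul_inv_cancel_right]
  | one => intro i x; simp [cable_one']
  | mul γ δ hγ hδ =>
    intro i x
    have := hγ (toPerm m δ i) x
    simp only [cable_mul, map_mul, Equiv.Perm.mul_apply, ← mul_assoc]
    rw [this, mul_assoc, hδ, ← mul_assoc]
  | inv γ hγ =>
    intro i x
    -- The cabling of `γ⁻¹` at `i` is inverse to that of `γ` at `γ⁻¹(i)`, so the hypothesis is
    -- needed at that position.
    have h1 := hγ (toPerm m γ⁻¹ i) x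
    have h2 := cable_mul h i γ γ⁻¹
    rw [mul_inv_cancel, cable_one'] at h2
    have e : toPerm m γ (toPerm m γ⁻¹ i) = i := by simp
    simp only [e] at h1
    rw [eq_inv_of_mul_eq_one_right h2.symm, eq_inv_mul_iff_mul_eq, ← mul_assoc, ← h1,
      mul_inv_cancel_right]

/-! ### Group rings of finite groups -/

theorem toQuotAlg_surjective (k : Type w) [Field k] {n : ℕ} (Q : FinQuot n) :
    Function.Surjective (toQuotAlg k Q) := by
  refine LinearMap.range_eq_top (f := (toQuotAlg k Q).toLinearMap).1 (top_le_iff.1 ?_)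
  rw [← (MonoidAlgebra.basis (Braid n ⧸ Q.toSubgroup) k).span_eq, Submodule.span_le]
  rintro _ ⟨x, rfl⟩
  induction x using QuotientGroup.induction_on with | H g =>
  rw [MonoidAlgebra.basis_apply]
  exact ⟨MonoidAlgebra.single g 1, toQuotAlg_single k Q g 1⟩

/-! ### Averaging, regularity and strictness. -/

section GroupRings

variable (k : Type w) [Field k] [CharZero k]

/-- Averaging over the kernel of a surjection of finite groups. -/
theorem exists_average {G H : Type*} [Group G] [Finite G] [Group H] (f : G →* H)
    (hf : Function.Surjective f) :
    ∃ e : MonoidAlgebra k G, MonoidAlgebra.mapDomainAlgHom k k f e = 1 ∧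
      ∀ z, MonoidAlgebra.mapDomainAlgHom k k f z = 0 → z * e = 0 := by
  have := Fintype.ofFinite f.ker
  let e : MonoidAlgebra k G :=
    ∑ x : f.ker, MonoidAlgebra.single (x : G) ((Fintype.card f.ker : k)⁻¹)
  have hF : ∀ (g : G) (c : k), MonoidAlgebra.mapDomainAlgHom k k f (MonoidAlgebra.single g c) =
      MonoidAlgebra.single (f g) c := fun g c => MonoidAlgebra.mapDomain_single
  -- The average absorbs kernel elements, since translation permutes the summands.
  have he : ∀ u : f.ker, MonoidAlgebra.single (u : G) 1 * e = e := fun u => by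
    rw [Finset.mul_sum]
    refine Fintype.sum_equiv (Equiv.mulLeft u) _ _ fun x => ?_
    rw [MonoidAlgebra.single_mul_single, one_mul]
    rfl
  refine ⟨e, ?_, fun z hz => ?_⟩
  · rw [map_sum]
    have h1 : ∀ x : f.ker, MonoidAlgebra.mapDomainAlgHom k k f (MonoidAlgebra.single (x : G)
        ((Fintype.card f.ker : k)⁻¹)) = (Fintype.card f.ker : k)⁻¹ • 1 := fun x => by
      rw [hF, x.2, MonoidAlgebra.one_def, MonoidAlgebra.smul_single, smul_eq_mul, mul_one]
    rw [Finset.sum_congr rfl fun x _ => h1 x, Finset.sum_const, Finset.card_univ,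
      ← Nat.cast_smul_eq_nsmul k, smul_smul, mul_inv_cancel₀, one_smul]
    exact Nat.cast_ne_zero.2 Fintype.card_ne_zero
  -- Right multiplication by `e` factors through `k[H]`: `g` and the chosen preimage of `f g` differ
  -- on the right by an element of the kernel, which `e` absorbs. So `z e` depends only on the image
  -- of `z`.
  · let σ : MonoidAlgebra k H →ₗ[k] MonoidAlgebra k G :=
      (MonoidAlgebra.basis H k).constr k fun y =>
        MonoidAlgebra.single (Function.surjInv hf y) 1 * e
    have h1 : σ ∘ₗ (MonoidAlgebra.mapDomainAlgHom k k f).toLinearMap = LinearMap.mulRight k e := by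
      refine (MonoidAlgebra.basis G k).ext fun g => ?_
      rw [MonoidAlgebra.basis_apply, LinearMap.comp_apply, AlgHom.toLinearMap_apply, hF,
        ← MonoidAlgebra.basis_apply, Module.Basis.constr_basis, LinearMap.mulRight_apply]
      have hu : g⁻¹ * Function.surjInv hf (f g) ∈ f.ker := by
        rw [MonoidHom.mem_ker, map_mul, Function.surjInv_eq hf, map_inv, inv_mul_cancel]
      conv_rhs => rw [← he ⟨_, hu⟩]
      rw [← mul_assoc, MonoidAlgebra.single_mul_single, mul_inv_cancel_left, one_mul]
    have h2 := LinearMap.congr_fun h1 z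
    rw [LinearMap.comp_apply, AlgHom.toLinearMap_apply, hz, map_zero] at h2
    exact h2.symm

/-- Semisimple rings are von Neumann regular. -/
theorem exists_mul_mul_eq {R : Type*} [Ring R] [IsSemisimpleRing R] (s : R) :
    ∃ t, s * t * s = s := by
  obtain ⟨q, hq⟩ := exists_isCompl (Submodule.span R {s})
  -- Decompose `1 = t s + b` along the left ideal `R s` and a complement. Then `s b = s - s t s`
  -- lies in both summands and is therefore zero.
  obtain ⟨a, ha, b, hb, hab⟩ := Submodule.mem_sup.1 (hq.sup_eq_top ▸ Submodule.mem_top : (1 : R) ∈ _)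
  obtain ⟨t, rfl⟩ := Submodule.mem_span_singleton.1 ha
  refine ⟨t, ?_⟩
  rw [smul_eq_mul] at hab
  have h1 : s * b = s - s * t * s := by
    rw [eq_sub_iff_add_eq', mul_assoc, ← mul_add, hab, mul_one]
  have h2 : s * b ∈ Submodule.span R {s} := by
    rw [h1]
    exact Submodule.sub_mem _ (Submodule.mem_span_singleton_self s)
      (Submodule.mem_span_singleton.2 ⟨s * t, rfl⟩)
  have h3 : s * b = 0 := Submodule.disjoint_def.1 hq.disjoint _ h2 (q.smul_mem s hb)
  rw [h3] at h1
  exact (sub_eq_zero.1 h1.symm).symm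

/-- Maschke's theorem makes `k[Q]` semisimple, hence von Neumann regular. The quasi-inverse is
lifted to `k[B_n]` so that it acts on tensor powers and can be projected to any level. -/
theorem exists_regular {n : ℕ} (Q : FinQuot n) : ∃ t : MonoidAlgebra k (Braid n),
    toQuotAlg k Q (quantumSymmetrizer k n * t * quantumSymmetrizer k n) =
      toQuotAlg k Q (quantumSymmetrizer k n) := by
  have : NeZero (Nat.card (Braid n ⧸ Q.toSubgroup) : k) := ⟨Nat.cast_ne_zero.2 Nat.card_pos.ne'⟩
  obtain ⟨t, ht⟩ := exists_mul_mul_eq (toQuotAlg k Q (quantumSymmetrizer k n))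
  obtain ⟨t, rfl⟩ := toQuotAlg_surjective k Q t
  exact ⟨t, by rw [map_mul, map_mul, ht]⟩

/-- The kernels of the quantum symmetrizer form a strict inverse system. -/
theorem exists_mem_worKer {n : ℕ} {P Q : FinQuot n} (h : P ≤ Q) {x : QuotAlg k Q}
    (hx : x ∈ worKer k Q) : ∃ y ∈ worKer k P, quotAlgMap k h y = x := by
  obtain ⟨e, he, hz⟩ := exists_average k
    (QuotientGroup.map P.toSubgroup Q.toSubgroup (MonoidHom.id _) h)
    (QuotientGroup.map_surjective_of_surjective _ _ _ (QuotientGroup.mk_surjective) _)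
  obtain ⟨y, rfl⟩ := toQuotAlg_surjective k Q x
  -- An arbitrary lift is corrected by the average on the right, which commutes with left
  -- multiplication by the symmetrizer.
  refine ⟨toQuotAlg k P y * e, ?_, ?_⟩
  · rw [worKer, LinearMap.mem_ker, symMul, LinearMap.mulLeft_apply] at hx ⊢
    rw [← mul_assoc]
    refine hz _ ?_
    change quotAlgMap k h _ = 0
    rw [map_mul, quotAlgMap_toQuotAlg, quotAlgMap_toQuotAlg, hx]
  · rw [map_mul, quotAlgMap_toQuotAlg]
    exact (congrArg _ he).trans (mul_one _)

theorem woronowicz_isStrict : (woronowicz k).IsStrict := fun n P Q f => by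
  rw [ModuleCat.epi_iff_surjective]
  rintro ⟨x, hx⟩
  obtain ⟨y, hy, hyx⟩ := exists_mem_worKer k (leOfHom f) hx
  exact ⟨⟨y, hy⟩, Subtype.ext hyx⟩

end GroupRings

/-! ### The Woronowicz ideal -/

section LeftIdeal

variable (k : Type w) [Field k]

/-- The map of group rings of finite quotients induced by `shift`. -/
def shiftQuot {n N : ℕ} (a : ℕ) (h : a + n ≤ N) {Q : FinQuot n} {R : FinQuot N}
    (hQ : Q ≤ R.comap (shift a h)) : QuotAlg k Q →ₐ[k] QuotAlg k R :=
  MonoidAlgebra.mapDomainAlgHom k k (QuotientGroup.map Q.toSubgroup R.toSubgroup (shift a h) hQ)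

theorem shiftQuot_single {n N : ℕ} (a : ℕ) (h : a + n ≤ N) {Q : FinQuot n} {R : FinQuot N}
    (hQ : Q ≤ R.comap (shift a h)) (g : Braid n) (c : k) :
    shiftQuot k a h hQ (MonoidAlgebra.single (g : Braid n ⧸ Q.toSubgroup) c) =
      MonoidAlgebra.single (shift a h g : Braid N ⧸ R.toSubgroup) c := by
  exact MonoidAlgebra.mapDomain_single

theorem shiftQuot_toQuotAlg {n N : ℕ} (a : ℕ) (h : a + n ≤ N) {Q : FinQuot n} {R : FinQuot N}
    (hQ : Q ≤ R.comap (shift a h)) (x : MonoidAlgebra k (Braid n)) :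
    shiftQuot k a h hQ (toQuotAlg k Q x) = toQuotAlg k R (shiftAlg k a h x) := by
  refine LinearMap.congr_fun (f := ((shiftQuot k a h hQ).comp (toQuotAlg k Q)).toLinearMap)
    (g := ((toQuotAlg k R).comp (shiftAlg k a h)).toLinearMap)
    ((MonoidAlgebra.basis _ k).ext fun g => ?_) x
  rw [MonoidAlgebra.basis_apply]
  change shiftQuot k a h hQ (toQuotAlg k Q _) = toQuotAlg k R (shiftAlg k a h _)
  rw [toQuotAlg_single, shiftQuot_single, shiftAlg_single, toQuotAlg_single]

theorem shiftAlg_mul_single_cable {m n N : ℕ} (h : m + n = N + 1) (i : Fin m) (γ : Braid m)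
    (x : MonoidAlgebra k (Braid n)) :
    shiftAlg k (toPerm m γ i) (by omega) x * MonoidAlgebra.single (cable h i γ) 1 =
      MonoidAlgebra.single (cable h i γ) 1 * shiftAlg k i (by omega) x := by
  refine LinearMap.congr_fun (f := LinearMap.mulRight k (MonoidAlgebra.single (cable h i γ) 1) ∘ₗ
      (shiftAlg k (N := N) (toPerm m γ i) (by omega)).toLinearMap)
    (g := LinearMap.mulLeft k (MonoidAlgebra.single (cable h i γ) 1) ∘ₗ
      (shiftAlg k (n := n) (N := N) i (by omega)).toLinearMap)
    ((MonoidAlgebra.basis _ k).ext fun g => ?_) x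
  rw [MonoidAlgebra.basis_apply]
  change shiftAlg k _ _ _ * _ = _ * shiftAlg k _ _ _
  rw [shiftAlg_single, shiftAlg_single, MonoidAlgebra.single_mul_single,
    MonoidAlgebra.single_mul_single, shift_mul_cable]

/-- The symmetrizer is factored through the block where the cable ends; this inner symmetrizer is
then pulled through the cable to where it starts, and there it meets the inserted element. -/
theorem symMul_quotCirc {m n N : ℕ} (h : m + n = N + 1) (i : Fin m) {P : FinQuot m} {Q : FinQuot n}
    {R : FinQuot N} (hP : P ≤ cableKer h R) (hQ : Q ≤ R.comap (shift (N := N) i (by omega)))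
    (γ : Braid m) {y : MonoidAlgebra k (Braid N)}
    (hy : quantumSymmetrizer k N =
      y * shiftAlg k (toPerm m γ i) (by omega) (quantumSymmetrizer k n)) (w : QuotAlg k Q) :
    symMul k R (quotCirc k h i hP hQ (TensorProduct.tmul k
      (MonoidAlgebra.single (γ : Braid m ⧸ P.toSubgroup) 1) w)) =
    toQuotAlg k R (y * MonoidAlgebra.single (cable h i γ) 1) *
      shiftQuot k i (by omega) hQ (symMul k Q w) := by
  refine LinearMap.congr_fun (f := symMul k R ∘ₗ quotCirc k h i hP hQ ∘ₗ TensorProduct.mk k _ _ _)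
    (g := LinearMap.mulLeft k (toQuotAlg k R (y * MonoidAlgebra.single (cable h i γ) 1)) ∘ₗ
      (shiftQuot k i (by omega) hQ).toLinearMap ∘ₗ symMul k Q) (quotAlg_hom_ext fun ρ => ?_) w
  change symMul k R (quotCirc k h i hP hQ (TensorProduct.tmul k _ _)) =
    _ * shiftQuot k _ _ hQ (symMul k Q _)
  rw [quotCirc_single, symMul, symMul, LinearMap.mulLeft_apply, LinearMap.mulLeft_apply,
    ← toQuotAlg_single, ← toQuotAlg_single, ← map_mul, ← map_mul, shiftQuot_toQuotAlg, ← map_mul]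
  congr 1
  rw [map_mul, ← mul_assoc, mul_assoc y, ← shiftAlg_mul_single_cable, ← mul_assoc, ← hy, mul_assoc,
    shiftAlg_single, MonoidAlgebra.single_mul_single, mul_one, cabling]

/-- By linearity one braid `γ` can be treated at a time, each with the factorization for its own end
position `γ(i)`. -/
theorem quotCirc_mem {m n N : ℕ} (h : m + n = N + 1) (i : Fin m) {P : FinQuot m} {Q : FinQuot n}
    {R : FinQuot N} (hP : P ≤ cableKer h R) (hQ : Q ≤ R.comap (shift (N := N) i (by omega)))
    (x : TensorProduct k (QuotAlg k P) (worKer k Q)) :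
    (quotCirc k h i hP hQ ∘ₗ (worKer k Q).subtype.lTensor (QuotAlg k P)) x ∈ worKer k R := by
  rw [worKer, LinearMap.mem_ker]
  refine LinearMap.congr_fun (f := symMul k R ∘ₗ quotCirc k h i hP hQ ∘ₗ
    (worKer k Q).subtype.lTensor (QuotAlg k P)) (g := 0)
    (TensorProduct.ext (quotAlg_hom_ext fun γ => LinearMap.ext fun w => ?_)) x
  obtain ⟨y, hy⟩ := quantumSymmetrizer_eq_mul k (n := n) (N := N) (toPerm m γ i) (by omega)
  refine (symMul_quotCirc k h i hP hQ γ hy w.1).trans ?_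
  rw [show symMul k Q w.1 = 0 from w.2, map_zero, mul_zero]
  rfl

theorem quotAlgMap_quotCirc {m n N : ℕ} (h : m + n = N + 1) (i : Fin m) {R R' : FinQuot N}
    (hR : R ≤ R') (x : QuotAlg k (cableKer h R))
    (w : QuotAlg k (R.comap (shift (n := n) (N := N) i (by omega)))) :
    quotAlgMap k hR (quotCirc k h i le_rfl le_rfl (TensorProduct.tmul k x w)) =
      quotCirc k h i le_rfl le_rfl (TensorProduct.tmul k
        (quotAlgMap k (cableKer_mono h hR) x)
        (quotAlgMap k (FiniteIndexNormalSubgroup.comap_mono _ hR) w)) := by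
  refine LinearMap.congr_fun (f := (quotAlgMap k hR).toLinearMap ∘ₗ quotCirc k h i le_rfl le_rfl)
    (g := quotCirc k h i le_rfl le_rfl ∘ₗ
      TensorProduct.map (quotAlgMap k (cableKer_mono h hR)).toLinearMap
        (quotAlgMap k (FiniteIndexNormalSubgroup.comap_mono _ hR)).toLinearMap)
    (TensorProduct.ext (quotAlg_hom_ext fun γ => quotAlg_hom_ext fun ρ => ?_)) _
  change quotAlgMap k hR (quotCirc k h i _ _ (TensorProduct.tmul k _ _)) =
    quotCirc k h i _ _ (TensorProduct.tmul k (quotAlgMap k _ _) (quotAlgMap k _ _))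
  rw [quotAlgMap_single, quotAlgMap_single, quotCirc_single, quotCirc_single, quotAlgMap_single]

/-- The inclusion is injective at each level. Two germs with the same image agree after restriction
to a common refinement, where the levelwise monomorphism can be cancelled. -/
theorem mono_woronowiczIncl (n : ℕ) : Mono (woronowiczIncl k n) where
  right_cancellation {Z} f g e := Pro.hom_ext fun Q => by
    have h1 : (f.germ Q).postcomp (ModuleCat.ofHom (worKer k Q).subtype) =
        (g.germ Q).postcomp (ModuleCat.ofHom (worKer k Q).subtype) :=
      congrArg (fun F : Z ⟶ (brAssHat k).obj n => F.germ Q) e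
    have hm : Mono (ModuleCat.ofHom (worKer k Q).subtype) :=
      (ModuleCat.mono_iff_injective _).2 Subtype.val_injective
    generalize f.germ Q = a at h1
    generalize g.germ Q = b at h1
    induction a using Pro.Germ.ind with | h i a =>
    induction b using Pro.Germ.ind with | h j b =>
    obtain ⟨l, p, q, h2⟩ := Quotient.exact h1
    refine Pro.Germ.sound p q ((cancel_mono (ModuleCat.ofHom (worKer k Q).subtype)).1 ?_)
    exact (Category.assoc _ _ _).trans (h2.trans (Category.assoc _ _ _).symm)

theorem isLeftIdeal_woronowicz : IsLeftIdeal (brAssHat k) (woronowicz k) (woronowiczIncl k) where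
  mono := mono_woronowiczIncl k
  equivariant n g := rfl
  circ_mem {m n N} h i := by
    -- The restricted composition uses the same source indices as `brAssHatCirc`, so the two
    -- composites agree already on representatives.
    refine ⟨{ germ := fun R : FinQuot N => Pro.Germ.mk
                (X := Pro.tensor ((brAssHat k).obj m) ((woronowicz k).obj n))
                ((cableKer h R, R.comap (shift (N := N) i (by omega))) : FinQuot m × FinQuot n)
                (ModuleCat.ofHom (LinearMap.codRestrict (worKer k R) _
                  (quotCirc_mem k h i (R := R) le_rfl le_rfl)))
              compat := fun {R R' : FinQuot N} f => ?_ }, ?_⟩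
    · refine Pro.Germ.mk_eq (X := Pro.tensor ((brAssHat k).obj m) ((woronowicz k).obj n))
        ((homOfLE (cableKer_mono h (leOfHom f)) : cableKer h R ⟶ cableKer h R'),
          (homOfLE (FiniteIndexNormalSubgroup.comap_mono _ (leOfHom f)) :
            R.comap (shift (N := N) i (by omega)) ⟶ R'.comap (shift (N := N) i (by omega)))) ?_
      exact ModuleCat.hom_ext (TensorProduct.ext (LinearMap.ext fun x => LinearMap.ext fun w =>
        Subtype.ext (quotAlgMap_quotCirc k h i (leOfHom f) x w.1)))
    · refine Pro.hom_ext fun R => ?_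
      refine congrArg (Pro.Germ.mk (X := Pro.tensor ((brAssHat k).obj m) ((woronowicz k).obj n))
        ((cableKer h R, R.comap (shift (N := N) i (by omega))) : FinQuot m × FinQuot n)) ?_
      exact ModuleCat.hom_ext (TensorProduct.ext (LinearMap.ext fun x => LinearMap.ext fun w => rfl))

end LeftIdeal

/-! ### Braid actions and concatenation -/

section Concat

variable {C : Type u} [Category.{v} C] [MonoidalCategory C] [BraidedCategory C] (V : C)

theorem braidMap_one (n : ℕ) : braidMap V n 1 = 𝟙 _ := by rw [braidMap, map_one]; rfl

theorem braidMap_mul (n : ℕ) (g h : Braid n) :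
    braidMap V n (g * h) = braidMap V n h ≫ braidMap V n g := by rw [braidMap, map_mul]; rfl

theorem braidMap_gen {n i : ℕ} (hi : i + 1 < n) :
    braidMap V n (braidGen n i) = (genAct V n i).hom := by
  rw [braidMap, braidAct, braidLift_gen _ _ _ hi]

theorem braidMap_inv_comp (n : ℕ) (g : Braid n) : braidMap V n g⁻¹ ≫ braidMap V n g = 𝟙 _ := by
  rw [← braidMap_mul, mul_inv_cancel, braidMap_one]

theorem braidMap_comp_inv (n : ℕ) (g : Braid n) : braidMap V n g ≫ braidMap V n g⁻¹ = 𝟙 _ := by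
  rw [← braidMap_mul, inv_mul_cancel, braidMap_one]

theorem genAct_succ : ∀ {n i : ℕ}, i + 1 < n →
    (genAct V (n + 1) i).hom = (genAct V n i).hom ▷ V
  | n + 1, i, h => by rw [genAct_of_ne V (by omega)]; rfl

instance (n : ℕ) (g : Braid n) : IsIso (braidMap V n g) :=
  Iso.isIso_hom (C := C) (braidAct V n g)

/-- Induction on `q`: a generator acting on the first `p` factors does not touch the last one. The
auxiliary statement is for arbitrary objects and is applied to the unfolded tensor powers. -/
theorem concat_genAct_left (p i : ℕ) (hi : i + 1 < p) : ∀ q,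
    (concat V p q).hom ≫ (genAct V (p + q) i).hom =
      (genAct V p i).hom ▷ tensorPow V q ≫ (concat V p q).hom
  | 0 => (rightUnitor_naturality _).symm
  | q + 1 => by
    have aux : ∀ {A B Y : C} {c : A ⊗ B ⟶ Y} {g : Y ⟶ Y} {f : A ⟶ A}, c ≫ g = f ▷ B ≫ c →
        ((α_ A B V).inv ≫ c ▷ V) ≫ g ▷ V = f ▷ (B ⊗ V) ≫ (α_ A B V).inv ≫ c ▷ V := fun h => by
      rw [Category.assoc, ← comp_whiskerRight, h, comp_whiskerRight,
        associator_inv_naturality_left_assoc]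
    exact (congrArg ((concat V p (q + 1)).hom ≫ ·)
      (genAct_succ V (hi.trans_le (Nat.le_add_right p q)))).trans
      (aux (concat_genAct_left p i hi q))

theorem lastBraid_naturality {X Y : C} (f : X ⟶ Y) :
    (lastBraid X V).hom ≫ f ▷ V ▷ V = f ▷ V ▷ V ≫ (lastBraid Y V).hom := by
  simp only [lastBraid, Iso.trans_hom, whiskerLeftIso_hom, Iso.symm_hom, Category.assoc]
  rw [← associator_inv_naturality_left, whisker_exchange_assoc, associator_naturality_left_assoc]

/-- Braiding the last two factors does not depend on how the factors before them are bracketed. -/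
theorem lastBraid_tensor (X Y : C) :
    (α_ X (Y ⊗ V) V).inv ≫ (α_ X Y V).inv ▷ V ≫ (lastBraid (X ⊗ Y) V).hom =
      X ◁ (lastBraid Y V).hom ≫ (α_ X (Y ⊗ V) V).inv ≫ (α_ X Y V).inv ▷ V := by
  simp only [lastBraid, Iso.trans_hom, whiskerLeftIso_hom, Iso.symm_hom]
  monoidal

/-- Either the generator avoids the last factor and induction applies, or it braids the last two
factors and the bracketing is handled by `lastBraid_tensor`. -/
theorem concat_genAct_right (p : ℕ) : ∀ (q j : ℕ), j + 1 < q →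
    (concat V p q).hom ≫ (genAct V (p + q) (p + j)).hom =
      tensorPow V p ◁ (genAct V q j).hom ≫ (concat V p q).hom
  | q + 1, j, hj => by
    by_cases h : j + 1 < q
    · have aux : ∀ {A B Y : C} {c : A ⊗ B ⟶ Y} {g : Y ⟶ Y} {f : B ⟶ B}, c ≫ g = A ◁ f ≫ c →
          ((α_ A B V).inv ≫ c ▷ V) ≫ g ▷ V = A ◁ (f ▷ V) ≫ (α_ A B V).inv ≫ c ▷ V := fun h => by
        rw [Category.assoc, ← comp_whiskerRight, h, comp_whiskerRight,
          associator_inv_naturality_middle_assoc]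
      rw [genAct_succ V h]
      exact (congrArg ((concat V p (q + 1)).hom ≫ ·)
        (genAct_succ V (Nat.add_lt_add_left h p))).trans (aux (concat_genAct_right p q j h))
    · obtain rfl : q = j + 1 := by omega
      have aux : ∀ {A B Y : C} (c : A ⊗ B ⟶ Y),
          ((α_ A (B ⊗ V) V).inv ≫ ((α_ A B V).inv ≫ c ▷ V) ▷ V) ≫ (lastBraid Y V).hom =
          A ◁ (lastBraid B V).hom ≫ (α_ A (B ⊗ V) V).inv ≫ ((α_ A B V).inv ≫ c ▷ V) ▷ V :=
        fun {A B Y} c => by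
          rw [comp_whiskerRight, Category.assoc, Category.assoc, ← lastBraid_naturality,
            reassoc_of% lastBraid_tensor V A B]
      rw [genAct_last V j]
      exact (congrArg ((concat V p (j + 1 + 1)).hom ≫ ·)
        (congrArg Iso.hom (genAct_last V (p + j)))).trans (aux (concat V p j).hom)

theorem concat_shift_left {p q : ℕ} (g : Braid p) :
    (concat V p q).hom ≫ braidMap V (p + q) (shift 0 (by omega) g) =
      braidMap V p g ▷ tensorPow V q ≫ (concat V p q).hom := by
  induction g using braid_induction with
  | gen j hj =>
    rw [shift_gen _ _ _ hj, Nat.zero_add, braidMap_gen V (by omega), braidMap_gen V hj,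
      concat_genAct_left V p j hj]
  | one => rw [map_one, braidMap_one, braidMap_one, Category.comp_id, id_whiskerRight,
      Category.id_comp]
  | mul x y hx hy =>
    rw [map_mul, braidMap_mul, braidMap_mul, reassoc_of% hy, hx, comp_whiskerRight, Category.assoc]
  | inv x hx =>
    rw [← cancel_epi (braidMap V p x ▷ tensorPow V q), ← reassoc_of% hx, ← comp_whiskerRight_assoc,
      braidMap_comp_inv, map_inv, braidMap_comp_inv, Category.comp_id, id_whiskerRight,
      Category.id_comp]

theorem concat_shift_right {p q : ℕ} (g : Braid q) :
    (concat V p q).hom ≫ braidMap V (p + q) (shift p le_rfl g) =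
      tensorPow V p ◁ braidMap V q g ≫ (concat V p q).hom := by
  induction g using braid_induction with
  | gen j hj =>
    rw [shift_gen _ _ _ hj, braidMap_gen V (by omega), braidMap_gen V hj,
      concat_genAct_right V p q j hj]
  | one => rw [map_one, braidMap_one, braidMap_one, Category.comp_id, whiskerLeft_id,
      Category.id_comp]
  | mul x y hx hy =>
    rw [map_mul, braidMap_mul, braidMap_mul, reassoc_of% hy, hx, whiskerLeft_comp, Category.assoc]
  | inv x hx =>
    rw [← cancel_epi (tensorPow V p ◁ braidMap V q x), ← reassoc_of% hx,
      ← whiskerLeft_comp_assoc,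
      braidMap_comp_inv, map_inv, braidMap_comp_inv, Category.comp_id, whiskerLeft_id,
      Category.id_comp]

theorem concat_juxt {p q : ℕ} (g : Braid p) (h : Braid q) :
    (concat V p q).hom ≫ braidMap V (p + q) (juxt g h) =
      (braidMap V p g ⊗ₘ braidMap V q h) ≫ (concat V p q).hom := by
  rw [juxt, braidMap_mul, ← Category.assoc, concat_shift_left, Category.assoc, concat_shift_right,
    ← Category.assoc, ← MonoidalCategory.tensorHom_def]

theorem braidMap_shift_succ {n : ℕ} (g : Braid n) :
    braidMap V (n + 1) (shift 0 (by omega) g) = braidMap V n g ▷ V := by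
  induction g using braid_induction with
  | gen j hj => rw [shift_gen _ _ _ hj, Nat.zero_add, braidMap_gen V (by omega), braidMap_gen V hj,
      genAct_succ V hj]
  | one =>
    rw [map_one, braidMap_one, braidMap_one]
    exact (id_whiskerRight _ _).symm
  | mul x y hx hy =>
    rw [map_mul, braidMap_mul, braidMap_mul, hx, hy]
    exact (comp_whiskerRight _ _ _).symm
  | inv x hx =>
    have h1 : braidMap V n x⁻¹ ▷ V ≫ braidMap V n x ▷ V = 𝟙 _ := by
      rw [← comp_whiskerRight, braidMap_inv_comp, id_whiskerRight]
    rw [map_inv]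
    exact (cancel_mono (braidMap V (n + 1) (shift 0 (by omega) x))).1
      ((braidMap_inv_comp V (n + 1) _).trans
        (h1.symm.trans (congrArg (braidMap V n x⁻¹ ▷ V ≫ ·) hx.symm)))

end Concat

/-! ### The action of the quantum symmetrizers -/

section Symmetrizers

variable (k : Type w) [Field k] {C : Type u} [Category.{v} C] [Preadditive C] [Linear k C]
  [MonoidalCategory C] [BraidedCategory C] (V : C)

theorem algAct_single (n : ℕ) (g : Braid n) :
    algAct k V n (MonoidAlgebra.single g 1) = braidMap V n g :=
  (MonoidAlgebra.lift_single _ _ _).trans (one_smul _ _)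

theorem algAct_mul (n : ℕ) (x y : MonoidAlgebra k (Braid n)) :
    algAct k V n (x * y) = algAct k V n y ≫ algAct k V n x := map_mul _ _ _

/-- Maps depending linearly on an element of the group ring agree if they agree on braids. -/
theorem linear_ext {n : ℕ} {M : Type*} [AddCommGroup M] [Module k M]
    {f f' : MonoidAlgebra k (Braid n) →ₗ[k] M}
    (h : ∀ g, f (MonoidAlgebra.single g 1) = f' (MonoidAlgebra.single g 1)) : f = f' :=
  (MonoidAlgebra.basis _ k).ext fun g => by rw [MonoidAlgebra.basis_apply]; exact h g

variable [MonoidalPreadditive C] [MonoidalLinear k C]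

theorem concat_algAct_left {p q : ℕ} (x : MonoidAlgebra k (Braid p)) :
    (concat V p q).hom ≫ algAct k V (p + q) (shiftAlg k 0 (by omega) x) =
      algAct k V p x ▷ tensorPow V q ≫ (concat V p q).hom := by
  refine LinearMap.congr_fun (f := Linear.leftComp k _ (concat V p q).hom ∘ₗ
      (algAct k V (p + q)).toLinearMap ∘ₗ (shiftAlg k 0 (by omega)).toLinearMap)
    (g := Linear.rightComp k _ (concat V p q).hom ∘ₗ
      (tensorRight (tensorPow V q)).mapLinearMap k ∘ₗ (algAct k V p).toLinearMap)
    (linear_ext k fun g => ?_) x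
  change _ ≫ algAct k V _ (shiftAlg k _ _ _) = algAct k V p _ ▷ _ ≫ _
  rw [shiftAlg_single, algAct_single, algAct_single, concat_shift_left]

theorem concat_algAct_right {p q : ℕ} (x : MonoidAlgebra k (Braid q)) :
    (concat V p q).hom ≫ algAct k V (p + q) (shiftAlg k p le_rfl x) =
      tensorPow V p ◁ algAct k V q x ≫ (concat V p q).hom := by
  refine LinearMap.congr_fun (f := Linear.leftComp k _ (concat V p q).hom ∘ₗ
      (algAct k V (p + q)).toLinearMap ∘ₗ (shiftAlg k p le_rfl).toLinearMap)
    (g := Linear.rightComp k _ (concat V p q).hom ∘ₗ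
      (tensorLeft (tensorPow V p)).mapLinearMap k ∘ₗ (algAct k V q).toLinearMap)
    (linear_ext k fun g => ?_) x
  change _ ≫ algAct k V _ (shiftAlg k _ _ _) = _ ◁ algAct k V q _ ≫ _
  rw [shiftAlg_single, algAct_single, algAct_single, concat_shift_right]

/-- Adding one untouched strand is stated without `concat`, in the form in which `iterShuffle`
recurs. -/
theorem algAct_shift_succ {n : ℕ} (x : MonoidAlgebra k (Braid n)) :
    algAct k V (n + 1) (shiftAlg k 0 (by omega) x) = algAct k V n x ▷ V := by
  refine LinearMap.congr_fun (f := (algAct k V (n + 1)).toLinearMap ∘ₗ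
      (shiftAlg k 0 (by omega)).toLinearMap)
    (g := (tensorRight V).mapLinearMap k ∘ₗ (algAct k V n).toLinearMap)
    (linear_ext k fun g => ?_) x
  change algAct k V (n + 1) (shiftAlg k 0 (by omega) (MonoidAlgebra.single g 1)) =
    (algAct k V n (MonoidAlgebra.single g 1) ▷ V : tensorPow V n ⊗ V ⟶ tensorPow V n ⊗ V)
  rw [shiftAlg_single, algAct_single, algAct_single]
  exact braidMap_shift_succ V g

theorem quantumSymmetrizer_zero : quantumSymmetrizer k 0 = 1 := by
  rw [quantumSymmetrizer, Fintype.sum_subsingleton _ 1, matsumoto_one]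
  rfl

/-- The iterated quantum shuffle product is given by the quantum symmetrizer. -/
theorem iterShuffle_eq : ∀ n, iterShuffle k V n = algAct k V n (quantumSymmetrizer k n)
  | 0 => by rw [quantumSymmetrizer_zero, map_one]; rfl
  | n + 1 => by
    rw [quantumSymmetrizer_succ, algAct_mul, algAct_shift_succ, iterShuffle, iterShuffle_eq n]
    rfl

/-- Under the action the factorization of `S_{p+q}` says that the symmetrizers turn concatenation
into the quantum shuffle product. -/
theorem concat_quantumSymmetrizer (p q : ℕ) :
    (concat V p q).hom ≫ algAct k V (p + q) (quantumSymmetrizer k (p + q)) =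
      (algAct k V p (quantumSymmetrizer k p) ⊗ₘ algAct k V q (quantumSymmetrizer k q)) ≫
        (concat V p q).hom ≫ algAct k V (p + q) (shuffleSum k (p + q) p) := by
  rw [quantumSymmetrizer_add, algAct_mul, algAct_mul, reassoc_of% concat_algAct_left,
    reassoc_of% concat_algAct_right, MonoidalCategory.tensorHom_def, Category.assoc]

end Symmetrizers

/-! ### Concatenation is associative and unital -/

section Coherence

variable {C : Type u} [Category.{v} C] [MonoidalCategory C] (V : C)

/-- Degrees such as `(p + q) + r` and `p + (q + r)` are only propositionally equal; the resulting
transports disappear in the inclusions into the tensor algebra. -/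
theorem eqToHom_comp_family {m n : ℕ} (h : m = n) {Z : C} (f : ∀ n, tensorPow V n ⟶ Z) :
    eqToHom (congrArg (tensorPow V) h) ≫ f n = f m := by
  subst h
  rw [eqToHom_refl, Category.id_comp]

theorem eqToHom_whiskerRight_tensorPow {m n : ℕ} (h : m = n) :
    eqToHom (congrArg (tensorPow V) h) ▷ V =
      eqToHom (congrArg (fun n => tensorPow V n ⊗ V) h) := by
  subst h
  exact id_whiskerRight _ _

theorem concat_zero_left : ∀ q, (concat V 0 q).hom ≫
    eqToHom (congrArg (tensorPow V) (Nat.zero_add q)) = (λ_ (tensorPow V q)).hom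
  | 0 => (Category.comp_id _).trans unitors_equal.symm
  | q + 1 => by
    have aux : ∀ {B Y : C} {c : 𝟙_ C ⊗ B ⟶ Y} {e : Y ⟶ B}, c ≫ e = (λ_ B).hom →
        ((α_ (𝟙_ C) B V).inv ≫ c ▷ V) ≫ e ▷ V = (λ_ (B ⊗ V)).hom := fun h => by
      rw [Category.assoc, ← comp_whiskerRight, h, leftUnitor_tensor_hom]
    exact (congrArg ((concat V 0 (q + 1)).hom ≫ ·)
      (eqToHom_whiskerRight_tensorPow V (Nat.zero_add q)).symm).trans
      (aux (concat_zero_left q))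

theorem concat_assoc (p q : ℕ) : ∀ r, (concat V p q).hom ▷ tensorPow V r ≫
    (concat V (p + q) r).hom ≫ eqToHom (congrArg (tensorPow V) (Nat.add_assoc p q r)) =
      (α_ _ _ _).hom ≫ tensorPow V p ◁ (concat V q r).hom ≫ (concat V p (q + r)).hom
  | 0 => by
    have aux : ∀ {A B Y : C} (c : A ⊗ B ⟶ Y),
        c ▷ 𝟙_ C ≫ (ρ_ Y).hom ≫ 𝟙 Y = (α_ A B (𝟙_ C)).hom ≫ A ◁ (ρ_ B).hom ≫ c := fun c => by
      simp
    exact aux (concat V p q).hom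
  | r + 1 => by
    have aux : ∀ {A B D Y Z Z' X : C} {c : A ⊗ B ⟶ Y} {d : Y ⊗ D ⟶ Z} {e : Z ⟶ Z'}
        {c' : B ⊗ D ⟶ X} {d' : A ⊗ X ⟶ Z'},
        c ▷ D ≫ d ≫ e = (α_ A B D).hom ≫ A ◁ c' ≫ d' →
        c ▷ (D ⊗ V) ≫ ((α_ Y D V).inv ≫ d ▷ V) ≫ e ▷ V =
          (α_ A B (D ⊗ V)).hom ≫ A ◁ ((α_ B D V).inv ≫ c' ▷ V) ≫
            (α_ A X V).inv ≫ d' ▷ V := fun {A B D Y Z Z' X c d e c' d'} h => by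
      have h' := congrArg (· ▷ V) h
      simp only [comp_whiskerRight] at h'
      rw [Category.assoc, associator_inv_naturality_left_assoc, h']
      simp
    have h := aux (concat_assoc p q r)
    rw [eqToHom_whiskerRight_tensorPow V (Nat.add_assoc p q r)] at h
    exact h

end Coherence

/-! ### The tensor algebra -/

section TensorAlgebra

variable {C : Type u} [Category.{v} C] [HasCountableCoproducts C]

theorem preservesCoproduct_hom_ext (F : C ⥤ C) [PreservesColimitsOfShape (Discrete ℕ) F] {Y : ℕ → C}
    {Z : C} {f g : F.obj (∐ Y) ⟶ Z}
    (h : ∀ q, F.map (Sigma.ι Y q) ≫ f = F.map (Sigma.ι Y q) ≫ g) : f = g :=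
  (isColimitOfPreserves F (colimit.isColimit (Discrete.functor Y))).hom_ext fun ⟨q⟩ => h q

variable [MonoidalCategory C] [BraidedCategory C]
  [∀ X : C, PreservesColimitsOfShape (Discrete ℕ) (tensorLeft X)]

instance (X : C) : PreservesColimitsOfShape (Discrete ℕ) (tensorRight X) :=
  preservesColimitsOfShape_of_natIso (BraidedCategory.tensorLeftIsoTensorRight X)

/-- The tensor product preserves countable coproducts in the second variable by hypothesis and in
the first through the braiding, so maps are determined on summands. -/
theorem coproduct_tensor_hom_ext {Y Y' : ℕ → C} {Z : C} {f g : (∐ Y) ⊗ (∐ Y') ⟶ Z}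
    (h : ∀ p q, (Sigma.ι Y p ⊗ₘ Sigma.ι Y' q) ≫ f = (Sigma.ι Y p ⊗ₘ Sigma.ι Y' q) ≫ g) : f = g :=
  preservesCoproduct_hom_ext (tensorLeft _) fun q =>
    preservesCoproduct_hom_ext (tensorRight _) fun p => by
      have := h p q
      rw [MonoidalCategory.tensorHom_def, Category.assoc, Category.assoc] at this
      exact this

theorem coproduct_tensor₃_hom_ext {Y Y' Y'' : ℕ → C} {Z : C}
    {f g : ((∐ Y) ⊗ (∐ Y')) ⊗ (∐ Y'') ⟶ Z}
    (h : ∀ p q r, ((Sigma.ι Y p ⊗ₘ Sigma.ι Y' q) ⊗ₘ Sigma.ι Y'' r) ≫ f =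
      ((Sigma.ι Y p ⊗ₘ Sigma.ι Y' q) ⊗ₘ Sigma.ι Y'' r) ≫ g) : f = g :=
  preservesCoproduct_hom_ext (tensorLeft _) fun r =>
    preservesCoproduct_hom_ext (tensorLeft _ ⋙ tensorRight _) fun q =>
      preservesCoproduct_hom_ext (tensorRight _ ⋙ tensorRight _) fun p => by
        have := h p q r
        rw [MonoidalCategory.tensorHom_def, MonoidalCategory.tensorHom_def, comp_whiskerRight,
          Category.assoc, Category.assoc, Category.assoc, Category.assoc] at this
        exact this

variable (V : C)

theorem ι_concatMul (p q : ℕ) : (tensorAlg.ι V p ⊗ₘ tensorAlg.ι V q) ≫ concatMul V =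
    (concat V p q).hom ≫ tensorAlg.ι V (p + q) := ι_descTwo _ p q

/-- The unit of the tensor algebra. -/
def tensorAlgOne : 𝟙_ C ⟶ tensorAlg V := tensorAlg.ι V 0

theorem concatMul_one_left :
    tensorAlgOne V ▷ tensorAlg V ≫ concatMul V = (λ_ (tensorAlg V)).hom :=
  preservesCoproduct_hom_ext (tensorLeft (𝟙_ C)) fun q => by
    change 𝟙_ C ◁ tensorAlg.ι V q ≫ tensorAlgOne V ▷ tensorAlg V ≫ concatMul V =
      𝟙_ C ◁ tensorAlg.ι V q ≫ (λ_ (tensorAlg V)).hom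
    have h : (concat V 0 q).hom ≫ tensorAlg.ι V (0 + q) = (λ_ _).hom ≫ tensorAlg.ι V q := by
      rw [← concat_zero_left, ← eqToHom_comp_family V (Nat.zero_add q) (tensorAlg.ι V)]
      exact (Category.assoc _ _ _).symm
    rw [leftUnitor_naturality, ← MonoidalCategory.tensorHom_def'_assoc]
    exact (ι_concatMul V 0 q).trans h

theorem concatMul_one_right :
    tensorAlg V ◁ tensorAlgOne V ≫ concatMul V = (ρ_ (tensorAlg V)).hom :=
  preservesCoproduct_hom_ext (tensorRight (𝟙_ C)) fun p => by
    change tensorAlg.ι V p ▷ 𝟙_ C ≫ tensorAlg V ◁ tensorAlgOne V ≫ concatMul V =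
      tensorAlg.ι V p ▷ 𝟙_ C ≫ (ρ_ (tensorAlg V)).hom
    rw [rightUnitor_naturality, ← MonoidalCategory.tensorHom_def_assoc]
    exact ι_concatMul V p 0

theorem concatMul_assoc : concatMul V ▷ tensorAlg V ≫ concatMul V =
    (α_ _ _ _).hom ≫ tensorAlg V ◁ concatMul V ≫ concatMul V :=
  coproduct_tensor₃_hom_ext fun p q r => by
    change ((tensorAlg.ι V p ⊗ₘ tensorAlg.ι V q) ⊗ₘ tensorAlg.ι V r) ≫ _ =
      ((tensorAlg.ι V p ⊗ₘ tensorAlg.ι V q) ⊗ₘ tensorAlg.ι V r) ≫ _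
    have h1 : ((tensorAlg.ι V p ⊗ₘ tensorAlg.ι V q) ⊗ₘ tensorAlg.ι V r) ≫
        concatMul V ▷ tensorAlg V = (concat V p q).hom ▷ tensorPow V r ≫
          (tensorAlg.ι V (p + q) ⊗ₘ tensorAlg.ι V r) := by
      rw [MonoidalCategory.tensorHom_comp_whiskerRight, ι_concatMul,
        MonoidalCategory.whiskerRight_comp_tensorHom]
    have h2 : (tensorAlg.ι V p ⊗ₘ (tensorAlg.ι V q ⊗ₘ tensorAlg.ι V r)) ≫
        tensorAlg V ◁ concatMul V = tensorPow V p ◁ (concat V q r).hom ≫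
          (tensorAlg.ι V p ⊗ₘ tensorAlg.ι V (q + r)) := by
      rw [MonoidalCategory.tensorHom_comp_whiskerLeft, ι_concatMul,
        MonoidalCategory.whiskerLeft_comp_tensorHom]
    rw [reassoc_of% h1, ι_concatMul, MonoidalCategory.associator_naturality_assoc, reassoc_of% h2,
      ι_concatMul, ← eqToHom_comp_family V (Nat.add_assoc p q r) (tensorAlg.ι V)]
    have := congrArg (· ≫ tensorAlg.ι V (p + (q + r))) (concat_assoc V p q r)
    simpa only [Category.assoc] using this

variable (k : Type w) [Field k] [Preadditive C] [Linear k C]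

variable [MonoidalPreadditive C] [MonoidalLinear k C]

theorem ι_tensorAlgToCo (n : ℕ) : tensorAlg.ι V n ≫ tensorAlgToCo k V =
    algAct k V n (quantumSymmetrizer k n) ≫ tensorAlg.ι V n := by
  rw [← iterShuffle_eq]
  exact Sigma.ι_map _ _

theorem concatMul_tensorAlgToCo : concatMul V ≫ tensorAlgToCo k V =
    (tensorAlgToCo k V ⊗ₘ tensorAlgToCo k V) ≫ shuffleMul k V :=
  coproduct_tensor_hom_ext fun p q => by
    change (tensorAlg.ι V p ⊗ₘ tensorAlg.ι V q) ≫ _ = (tensorAlg.ι V p ⊗ₘ tensorAlg.ι V q) ≫ _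
    have h : (tensorAlg.ι V p ⊗ₘ tensorAlg.ι V q) ≫ shuffleMul k V = (concat V p q).hom ≫
        algAct k V (p + q) (shuffleSum k (p + q) p) ≫ tensorAlg.ι V (p + q) := ι_descTwo _ p q
    rw [reassoc_of% ι_concatMul, ι_tensorAlgToCo, reassoc_of% concat_quantumSymmetrizer,
      MonoidalCategory.tensorHom_comp_tensorHom_assoc, ι_tensorAlgToCo, ι_tensorAlgToCo,
      ← MonoidalCategory.tensorHom_comp_tensorHom_assoc, h]

end TensorAlgebra

/-! ### The algebra structure on the Nichols algebra -/

section NicholsAlgebra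

variable {C : Type u} [Category.{v} C] [HasCountableCoproducts C]
  [MonoidalCategory C] [BraidedCategory C]
  [∀ X : C, PreservesColimitsOfShape (Discrete ℕ) (tensorLeft X)]
  (k : Type w) [Field k] [Abelian C] [Linear k C]
  {V : C}

theorem proj_incl : nichols.proj k V ≫ nichols.incl k V = tensorAlgToCo k V := image.fac _

instance : Epi (nichols.proj k V) := inferInstanceAs (Epi (factorThruImage _))

instance : Mono (nichols.incl k V) := inferInstanceAs (Mono (image.ι _))

variable {t : tensorAlg V ⟶ tensorAlg V}

/-- Write `E` for `tensorAlgToCo`, the composite of `proj` and `incl`. In `E t E = E` the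
epimorphism `proj` and the monomorphism `incl` cancel. -/
theorem incl_proj
    (ht : tensorAlgToCo k V ≫ t ≫ tensorAlgToCo k V = tensorAlgToCo k V) :
    nichols.incl k V ≫ t ≫ nichols.proj k V = 𝟙 _ := by
  rw [← cancel_epi (nichols.proj k V), ← cancel_mono (nichols.incl k V), Category.assoc,
    Category.assoc, Category.assoc, proj_incl, reassoc_of% proj_incl, ht, Category.comp_id,
    proj_incl]

/-- Split epimorphisms are preserved by every functor, so `proj` stays epi after tensoring although
the tensor product need not be right exact. -/
theorem isSplitEpi_proj
    (ht : tensorAlgToCo k V ≫ t ≫ tensorAlgToCo k V = tensorAlgToCo k V) :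
    IsSplitEpi (nichols.proj k V) :=
  ⟨⟨⟨nichols.incl k V ≫ t, by rw [Category.assoc, incl_proj k ht]⟩⟩⟩

theorem epi_whiskerLeft_proj
    (ht : tensorAlgToCo k V ≫ t ≫ tensorAlgToCo k V = tensorAlgToCo k V) (X : C) : Epi (X ◁ nichols.proj k V) :=
  have := isSplitEpi_proj k ht
  inferInstanceAs (Epi ((tensorLeft X).map (nichols.proj k V)))

theorem epi_whiskerRight_proj
    (ht : tensorAlgToCo k V ≫ t ≫ tensorAlgToCo k V = tensorAlgToCo k V) (X : C) : Epi (nichols.proj k V ▷ X) :=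
  have := isSplitEpi_proj k ht
  inferInstanceAs (Epi ((tensorRight X).map (nichols.proj k V)))

variable (V t) in
/-- The product of the Nichols algebra. -/
def nicholsMul : nichols k V ⊗ nichols k V ⟶ nichols k V :=
  ((nichols.incl k V ≫ t) ⊗ₘ (nichols.incl k V ≫ t)) ≫ concatMul V ≫ nichols.proj k V

variable [MonoidalPreadditive C] [MonoidalLinear k C]

/-- The section `incl ≫ t` becomes `incl` after applying `tensorAlgToCo`, which turns concatenation
into shuffles. As `incl` is mono, the product does not depend on `t`. -/
theorem nicholsMul_incl
    (ht : tensorAlgToCo k V ≫ t ≫ tensorAlgToCo k V = tensorAlgToCo k V) :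
    nicholsMul k V t ≫ nichols.incl k V =
    (nichols.incl k V ⊗ₘ nichols.incl k V) ≫ shuffleMul k V := by
  have h : (nichols.incl k V ≫ t) ≫ tensorAlgToCo k V = nichols.incl k V := by
    have := incl_proj k ht
    rw [← proj_incl, Category.assoc, reassoc_of% this]
  rw [nicholsMul, Category.assoc, Category.assoc, proj_incl, concatMul_tensorAlgToCo,
    MonoidalCategory.tensorHom_comp_tensorHom_assoc, h]

theorem concatMul_proj
    (ht : tensorAlgToCo k V ≫ t ≫ tensorAlgToCo k V = tensorAlgToCo k V) :
    concatMul V ≫ nichols.proj k V =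
    (nichols.proj k V ⊗ₘ nichols.proj k V) ≫ nicholsMul k V t := by
  rw [← cancel_mono (nichols.incl k V), Category.assoc, Category.assoc, nicholsMul_incl k ht,
    proj_incl, concatMul_tensorAlgToCo, MonoidalCategory.tensorHom_comp_tensorHom_assoc, proj_incl]

/-- The algebra structure on the Nichols algebra. -/
@[reducible]
def nicholsMonObj
    (ht : tensorAlgToCo k V ≫ t ≫ tensorAlgToCo k V = tensorAlgToCo k V) :
    MonObj (nichols k V) where
  one := tensorAlgOne V ≫ nichols.proj k V
  mul := nicholsMul k V t
  one_mul := by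
    have := epi_whiskerLeft_proj k ht (𝟙_ C)
    -- Precomposed with the projection, each axiom becomes the corresponding axiom of the tensor
    -- algebra.
    rw [← cancel_epi (𝟙_ C ◁ nichols.proj k V), leftUnitor_naturality, ← concatMul_one_left,
      Category.assoc, concatMul_proj k ht, ← MonoidalCategory.tensorHom_def'_assoc,
      MonoidalCategory.whiskerRight_comp_tensorHom_assoc]
  mul_one := by
    have := epi_whiskerRight_proj k ht (𝟙_ C)
    rw [← cancel_epi (nichols.proj k V ▷ 𝟙_ C), rightUnitor_naturality, ← concatMul_one_right,
      Category.assoc, concatMul_proj k ht, ← MonoidalCategory.tensorHom_def_assoc,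
      MonoidalCategory.whiskerLeft_comp_tensorHom_assoc]
  mul_assoc := by
    have h1 := epi_whiskerLeft_proj k ht
    have h2 := epi_whiskerRight_proj k ht
    have h3 : Epi (nichols.proj k V ⊗ₘ nichols.proj k V) := by
      rw [MonoidalCategory.tensorHom_def]; infer_instance
    -- The threefold tensor power of `proj` is a composite of images of the split epimorphism `proj`
    -- under whiskering functors.
    have h4 : Epi ((nichols.proj k V ⊗ₘ nichols.proj k V) ⊗ₘ nichols.proj k V) := by
      have h5 : Epi ((nichols.proj k V ⊗ₘ nichols.proj k V) ▷ tensorAlg V) := by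
        rw [MonoidalCategory.tensorHom_def, comp_whiskerRight]
        have h6 : Epi (nichols.proj k V ▷ tensorAlg V ▷ tensorAlg V) := by
          have := isSplitEpi_proj k ht
          exact inferInstanceAs
            (Epi ((tensorRight (tensorAlg V) ⋙ tensorRight _).map (nichols.proj k V)))
        have h7 : Epi ((nichols k V ◁ nichols.proj k V) ▷ tensorAlg V) := by
          have := isSplitEpi_proj k ht
          exact inferInstanceAs
            (Epi ((tensorLeft (nichols k V) ⋙ tensorRight _).map (nichols.proj k V)))
        infer_instance
      rw [MonoidalCategory.tensorHom_def]
      infer_instance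
    rw [← cancel_epi ((nichols.proj k V ⊗ₘ nichols.proj k V) ⊗ₘ nichols.proj k V),
      MonoidalCategory.associator_naturality_assoc,
      MonoidalCategory.tensorHom_comp_whiskerRight_assoc,
      MonoidalCategory.tensorHom_comp_whiskerLeft_assoc, ← concatMul_proj k ht,
      ← MonoidalCategory.whiskerRight_comp_tensorHom_assoc,
      ← MonoidalCategory.whiskerLeft_comp_tensorHom_assoc, ← concatMul_proj k ht,
      reassoc_of% concatMul_assoc]

theorem isNicholsAlgebra
    (ht : tensorAlgToCo k V ≫ t ≫ tensorAlgToCo k V = tensorAlgToCo k V) :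
    @IsNicholsAlgebra C _ _ _ _ _ k _ _ _ _ V (nicholsMonObj k ht) :=
  letI := nicholsMonObj k ht
  { one_incl := by
      have h : tensorAlg.ι V 0 ≫ tensorAlgToCo k V = tensorAlg.ι V 0 := by
        rw [ι_tensorAlgToCo, quantumSymmetrizer_zero, map_one]
        exact Category.id_comp _
      refine (Category.assoc _ _ _).trans ?_
      rw [proj_incl]
      exact h
    mul_incl := nicholsMul_incl k ht
    one_proj := rfl
    mul_proj := concatMul_proj k ht }

end NicholsAlgebra

/-! ### Finitely braided objects -/

section FinitelyBraided

variable {C : Type u} [Category.{v} C] [MonoidalCategory C] [BraidedCategory C] {V : C}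

/-- The finite quotient through which the braid group acts on a tensor power. -/
def kerQuot (hV : FinitelyBraided V) (n : ℕ) : FinQuot n :=
  haveI := hV n
  .ofSubgroup (braidAct V n).ker

theorem mem_kerQuot (hV : FinitelyBraided V) {n : ℕ} {g : Braid n} :
    g ∈ (kerQuot hV n).toSubgroup ↔ braidMap V n g = 𝟙 _ := by
  have := hV n
  rw [kerQuot, FiniteIndexNormalSubgroup.toSubgroup_ofSubgroup, MonoidHom.mem_ker]
  exact ⟨fun h => congrArg Iso.hom h, fun h => Iso.ext h⟩

variable (V) in
/-- The action of the braid group on a tensor power. -/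
def endAct (n : ℕ) : Braid n →* End (tensorPow V n) where
  toFun := braidMap V n
  map_one' := braidMap_one V n
  map_mul' := braidMap_mul V n

variable (k : Type w) [Field k] [Preadditive C] [Linear k C] (hV : FinitelyBraided V)

/-- The action of the group ring of a finite quotient of the braid group on a tensor power. -/
def quotAct (n : ℕ) : QuotAlg k (kerQuot hV n) →ₐ[k] End (tensorPow V n) :=
  MonoidAlgebra.lift k _ _ (QuotientGroup.lift (kerQuot hV n).toSubgroup (endAct V n)
    fun _ hg => (mem_kerQuot hV).1 hg)

theorem quotAct_single {n : ℕ} (g : Braid n) :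
    quotAct k hV n (MonoidAlgebra.single (g : Braid n ⧸ (kerQuot hV n).toSubgroup) 1) =
      braidMap V n g :=
  (MonoidAlgebra.lift_single _ _ _).trans (one_smul _ _)

theorem quotAct_mul {n : ℕ} (x y : QuotAlg k (kerQuot hV n)) :
    quotAct k hV n (x * y) = quotAct k hV n y ≫ quotAct k hV n x := map_mul _ _ _

theorem quotAct_toQuotAlg {n : ℕ} (x : MonoidAlgebra k (Braid n)) :
    quotAct k hV n (toQuotAlg k (kerQuot hV n) x) = algAct k V n x := by
  refine LinearMap.congr_fun
    (f := (quotAct k hV n).toLinearMap ∘ₗ (toQuotAlg k (kerQuot hV n)).toLinearMap)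
    (g := (algAct k V n).toLinearMap) (linear_ext k fun g => ?_) x
  change quotAct k hV n (toQuotAlg k _ _) = algAct k V n _
  rw [toQuotAlg_single, quotAct_single, algAct_single]

variable (V) in
/-- The endomorphism of the tensor algebra given by elements of the group rings of the braid groups. -/
def tensorAlgAct [HasCountableCoproducts C] (t : ∀ n, MonoidAlgebra k (Braid n)) :
    tensorAlg V ⟶ tensorAlg V :=
  Limits.Sigma.map fun n => algAct k V n (t n)

theorem ι_tensorAlgAct [HasCountableCoproducts C] (t : ∀ n, MonoidAlgebra k (Braid n)) (n : ℕ) :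
    tensorAlg.ι V n ≫ tensorAlgAct V k t = algAct k V n (t n) ≫ tensorAlg.ι V n := Sigma.ι_map _ _

/-- In degree `n` the action factors through `k[kerQuot]`, so regularity of the symmetrizer at that
level is enough. -/
theorem tensorAlgToCo_comp_act_comp [HasCountableCoproducts C] [MonoidalPreadditive C]
    [MonoidalLinear k C] [∀ X : C, PreservesColimitsOfShape (Discrete ℕ) (tensorLeft X)]
    {t : ∀ n, MonoidAlgebra k (Braid n)}
    (ht : ∀ n, toQuotAlg k (kerQuot hV n) (quantumSymmetrizer k n * t n * quantumSymmetrizer k n) =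
      toQuotAlg k (kerQuot hV n) (quantumSymmetrizer k n)) :
    tensorAlgToCo k V ≫ tensorAlgAct V k t ≫ tensorAlgToCo k V = tensorAlgToCo k V :=
  Sigma.hom_ext _ _ fun n => by
    change tensorAlg.ι V n ≫ _ = tensorAlg.ι V n ≫ _
    have h := congrArg (quotAct k hV n) (ht n)
    rw [quotAct_toQuotAlg, quotAct_toQuotAlg, algAct_mul, algAct_mul] at h
    rw [reassoc_of% ι_tensorAlgToCo, reassoc_of% ι_tensorAlgAct, ι_tensorAlgToCo]
    conv_rhs => rw [← h]
    rw [Category.assoc, Category.assoc]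

end FinitelyBraided

/-! ### The balanced tensor products -/

section Balanced

variable {k : Type w} [Field k] {C : Type u} [Category.{v} C] [Preadditive C] [Linear k C]
  [HasCoproducts.{w} C] [HasCoequalizers C]
  {G : Type} {M : ModuleCat.{w} k} {ρ : G → (M ⟶ M)} {X : C} {a : G → (X ⟶ X)}

theorem bal.ι_zero : (bal.ι (0 : M) : X ⟶ bal M ρ a) = 0 := by
  have h := bal.ι_smul_add (ρ := ρ) (a := a) (-1) (0 : M) 0
  rwa [smul_zero, add_zero, neg_smul, one_smul, neg_add_cancel] at h

variable (M ρ a) in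
/-- The map `m ↦ (x ↦ m ⊗ x)` as a linear map. -/
def bal.ιLin : M →ₗ[k] (X ⟶ bal M ρ a) where
  toFun := bal.ι
  map_add' m m' := by
    have h := bal.ι_smul_add (ρ := ρ) (a := a) 1 m m'
    rwa [one_smul, one_smul] at h
  map_smul' c m := by
    have h := bal.ι_smul_add (ρ := ρ) (a := a) c m 0
    rwa [add_zero, bal.ι_zero, add_zero] at h

end Balanced

/-! ### Elements of the terms of `Nic[V]`. -/

section NicTerm

variable (k : Type w) [Field k] {C : Type u} [Category.{v} C] [Preadditive C] [Linear k C]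
  [HasCoproducts.{w} C] [HasCoequalizers C] [MonoidalCategory C] [BraidedCategory C] {V : C}

variable (V) in
/-- The map `v ↦ x ⊗ v` for an element `x` of the group ring of the braid group. -/
def nicι {n : ℕ} (Q : FinQuot n) (x : MonoidAlgebra k (Braid n)) :
    tensorPow V n ⟶ artinTerm (nic k) V n Q :=
  artinTerm.ι (nic k) V n Q (nicClass k x Q)

/-- The balancing relation gives `x ⊗ v = 1 ⊗ x v`. It holds at every level `Q`, even if the action
on the tensor power does not factor through `Q`. -/
theorem nicι_eq {n : ℕ} (Q : FinQuot n) (x : MonoidAlgebra k (Braid n)) :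
    nicι k V Q x = algAct k V n x ≫ nicι k V Q 1 := by
  refine LinearMap.congr_fun
    (f := bal.ιLin (((nic k).obj n).diag.obj Q) (fun g => ((nic k).act n g).app Q) (braidMap V n) ∘ₗ
      (worKer k Q).mkQ ∘ₗ (toQuotAlg k Q).toLinearMap)
    (g := Linear.rightComp k _ (nicι k V Q 1) ∘ₗ (algAct k V n).toLinearMap)
    (linear_ext k fun g => ?_) x
  change nicι k V Q (MonoidAlgebra.single g 1) = algAct k V n (MonoidAlgebra.single g 1) ≫ _
  rw [algAct_single]
  refine Eq.trans ?_ (bal.ι_act (ρ := fun g => ((nic k).act n g).app Q) g (nicClass k 1 Q))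
  refine congrArg (artinTerm.ι (nic k) V n Q) ?_
  change (worKer k Q).mkQ _ = (worKer k Q).mkQ (rightMul k Q g _)
  rw [rightMul_apply, map_one, one_mul, toQuotAlg_single]

theorem nicι_eq_of_mem {n : ℕ} (Q : FinQuot n) {x y : MonoidAlgebra k (Braid n)}
    (h : toQuotAlg k Q (x - y) ∈ worKer k Q) : nicι k V Q x = nicι k V Q y := by
  refine congrArg (artinTerm.ι (nic k) V n Q) ?_
  rw [map_sub] at h
  exact (Submodule.Quotient.eq _).2 h

/-- An equality tested only over `kerQuot` controls every level `Q`. By strictness `x - y` lifts to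
the Woronowicz kernel of `kerQuot ⊓ Q`. A representative `z` of this lift vanishes in `Nic` at level
`Q`, whereas `x` and `y + z` act identically on the tensor power. -/
theorem nicι_eq_of_quantumSymmetrizer_mul [CharZero k] (hV : FinitelyBraided V) {n : ℕ}
    (Q : FinQuot n) {x y : MonoidAlgebra k (Braid n)}
    (h : toQuotAlg k (kerQuot hV n) (quantumSymmetrizer k n * x) =
      toQuotAlg k (kerQuot hV n) (quantumSymmetrizer k n * y)) :
    nicι k V Q x = nicι k V Q y := by
  have h1 : toQuotAlg k (kerQuot hV n) (x - y) ∈ worKer k (kerQuot hV n) := by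
    rw [worKer, LinearMap.mem_ker, symMul, LinearMap.mulLeft_apply, ← map_mul, mul_sub, map_sub, h,
      sub_self]
  obtain ⟨d, hd, hd'⟩ := exists_mem_worKer k (inf_le_left : kerQuot hV n ⊓ Q ≤ _) h1
  obtain ⟨z, rfl⟩ := toQuotAlg_surjective k _ d
  rw [quotAlgMap_toQuotAlg] at hd'
  have h2 : nicι k V Q (y + z) = nicι k V Q y := nicι_eq_of_mem k Q (by
    rw [add_sub_cancel_left, ← quotAlgMap_toQuotAlg k (inf_le_right : kerQuot hV n ⊓ Q ≤ Q)]
    exact quotAlgMap_mem k _ _ hd)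
  rw [← h2, nicι_eq, nicι_eq k Q (y + z), ← quotAct_toQuotAlg k hV, ← quotAct_toQuotAlg k hV,
    map_add, hd', ← map_add, add_sub_cancel]

end NicTerm

/-! ### The Nichols module evaluates to the Nichols algebra -/

section Comparison

variable (k : Type w) [Field k] {C : Type u} [Category.{v} C] [Abelian C] [Linear k C]
  [MonoidalCategory C] [MonoidalPreadditive C] [MonoidalLinear k C] [BraidedCategory C]
  [HasCoproducts.{w} C] [HasCountableCoproducts C]
  [∀ X : C, PreservesColimitsOfShape (Discrete ℕ) (tensorLeft X)]
  {V : C} (hV : FinitelyBraided V)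

/-- The linear map `m ↦ (v ↦ m v)` with values in the maps to the Nichols algebra. -/
def quotActProj (n : ℕ) : QuotAlg k (kerQuot hV n) →ₗ[k] (tensorPow V n ⟶ nichols k V) :=
  Linear.rightComp k _ (tensorAlg.ι V n ≫ nichols.proj k V) ∘ₗ (quotAct k hV n).toLinearMap

theorem quotActProj_apply {n : ℕ} (x : QuotAlg k (kerQuot hV n)) :
    quotActProj k hV n x = quotAct k hV n x ≫ tensorAlg.ι V n ≫ nichols.proj k V := rfl

theorem quotActProj_toQuotAlg {n : ℕ} (x : MonoidAlgebra k (Braid n)) :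
    quotActProj k hV n (toQuotAlg k _ x) =
      algAct k V n x ≫ tensorAlg.ι V n ≫ nichols.proj k V := by
  rw [quotActProj_apply, quotAct_toQuotAlg]

/-- Followed by the inclusion in the tensor coalgebra, the map for `x` is the action of `S x`, which
is zero. -/
theorem worKer_le_ker (n : ℕ) : worKer k (kerQuot hV n) ≤ LinearMap.ker (quotActProj k hV n) := by
  intro x hx
  rw [worKer, LinearMap.mem_ker, symMul, LinearMap.mulLeft_apply] at hx
  rw [LinearMap.mem_ker, quotActProj_apply, ← cancel_mono (nichols.incl k V), zero_comp,
    Category.assoc, Category.assoc, proj_incl, ι_tensorAlgToCo, ← quotAct_toQuotAlg k hV,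
    ← Category.assoc, ← quotAct_mul, hx, map_zero, zero_comp]

/-- The map from a term of `Nic[V]` to the Nichols algebra, given by `m ⊗ v ↦ m v`. -/
def nicTermProj (n : ℕ) : artinTerm (nic k) V n (kerQuot hV n) ⟶ nichols k V :=
  bal.desc ((worKer k (kerQuot hV n)).liftQ (quotActProj k hV n) (worKer_le_ker k hV n))
    (fun c m m' =>
      let L := (worKer k (kerQuot hV n)).liftQ (quotActProj k hV n) (worKer_le_ker k hV n)
      (L.map_add (c • m) m').trans (congrArg (· + L m') (L.map_smul c m)))
    (fun g m => by
      obtain ⟨x, rfl⟩ := (worKer k (kerQuot hV n)).mkQ_surjective m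
      change quotActProj k hV n (rightMul k _ g x) = braidMap V n g ≫ quotActProj k hV n x
      rw [rightMul_apply, quotActProj_apply, quotActProj_apply, quotAct_mul, quotAct_single,
        Category.assoc])

theorem nicι_nicTermProj {n : ℕ} (x : MonoidAlgebra k (Braid n)) :
    nicι k V (kerQuot hV n) x ≫ nicTermProj k hV n =
      algAct k V n x ≫ tensorAlg.ι V n ≫ nichols.proj k V := by
  refine (bal.ι_desc _ _ _ _).trans ?_
  exact quotActProj_toQuotAlg k hV x

theorem nicι_map {n : ℕ} {P Q : FinQuot n} (f : P ⟶ Q) (x : MonoidAlgebra k (Braid n)) :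
    nicι k V P x ≫ artinTerm.map (nic k) V n f = nicι k V Q x :=
  (artinTerm.ι_map (nic k) V n f _).trans
    (congrArg (artinTerm.ι (nic k) V n Q) (nicClass_compat k x f))

theorem nicTerm_hom_ext {n : ℕ} {Q : FinQuot n} {Z : C} {f g : artinTerm (nic k) V n Q ⟶ Z}
    (h : ∀ x, nicι k V Q x ≫ f = nicι k V Q x ≫ g) : f = g :=
  artinTerm.hom_ext fun m => by
    obtain ⟨y, rfl⟩ := (worKer k Q).mkQ_surjective m
    obtain ⟨x, rfl⟩ := toQuotAlg_surjective k Q y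
    exact h x

variable (V) in
/-- The terms of the inverse system `Nic[V]`. -/
def nicSum (j : ∀ n, FinQuot n) : C := ∐ fun n => artinTerm (nic k) V n (j n)

variable (V) in
/-- The inclusions of the summands. -/
def nicSum.ι (j : ∀ n, FinQuot n) (n : ℕ) : artinTerm (nic k) V n (j n) ⟶ nicSum k V j :=
  Sigma.ι (fun n => artinTerm (nic k) V n (j n)) n

theorem nicSum_hom_ext {j : ∀ n, FinQuot n} {Z : C} {f g : nicSum k V j ⟶ Z}
    (h : ∀ n x, nicι k V (j n) x ≫ nicSum.ι k V j n ≫ f = nicι k V (j n) x ≫ nicSum.ι k V j n ≫ g) :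
    f = g := Sigma.hom_ext _ _ fun n => nicTerm_hom_ext k (h n)

/-- The transition maps. -/
def nicSum.map {j j' : ∀ n, FinQuot n} (f : j ⟶ j') : nicSum k V j ⟶ nicSum k V j' :=
  (artin (nic k) V).diag.map f

theorem nicSum.ι_map {j j' : ∀ n, FinQuot n} (f : j ⟶ j') (n : ℕ) :
    nicSum.ι k V j n ≫ nicSum.map k f =
      artinTerm.map (nic k) V n (f n) ≫ nicSum.ι k V j' n :=
  Sigma.ι_map (fun n => artinTerm.map (nic k) V n (f n)) n

/-- The map from a term of `Nic[V]` to the Nichols algebra. -/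
def nicSumProj : nicSum k V (kerQuot hV) ⟶ nichols k V := Sigma.desc fun n => nicTermProj k hV n

theorem ι_nicSumProj (n : ℕ) : nicSum.ι k V (kerQuot hV) n ≫ nicSumProj k hV = nicTermProj k hV n :=
  Sigma.ι_desc _ _

variable (V) in
/-- The map from the tensor algebra to a term of `Nic[V]`, given by `v ↦ 1 ⊗ v`. -/
def toNicSum (j : ∀ n, FinQuot n) : tensorAlg V ⟶ nicSum k V j :=
  Sigma.desc fun n => nicι k V (j n) 1 ≫ nicSum.ι k V j n

theorem ι_toNicSum (j : ∀ n, FinQuot n) (n : ℕ) :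
    tensorAlg.ι V n ≫ toNicSum k V j = nicι k V (j n) 1 ≫ nicSum.ι k V j n := Sigma.ι_desc _ _

theorem toNicSum_map {j j' : ∀ n, FinQuot n} (f : j ⟶ j') :
    toNicSum k V j ≫ nicSum.map k f = toNicSum k V j' :=
  Sigma.hom_ext _ _ fun n => by
    change tensorAlg.ι V n ≫ _ = tensorAlg.ι V n ≫ _
    rw [reassoc_of% ι_toNicSum, nicSum.ι_map, ι_toNicSum, ← Category.assoc, nicι_map]

theorem toNicSum_proj : toNicSum k V (kerQuot hV) ≫ nicSumProj k hV = nichols.proj k V :=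
  Sigma.hom_ext _ _ fun n => by
    change tensorAlg.ι V n ≫ _ = tensorAlg.ι V n ≫ _
    rw [reassoc_of% ι_toNicSum, ι_nicSumProj, nicι_nicTermProj, map_one]
    exact Category.id_comp _

variable {t : ∀ n, MonoidAlgebra k (Braid n)}

theorem incl_toNicSum_map {j j' : ∀ n, FinQuot n} (f : j ⟶ j') :
    (nichols.incl k V ≫ tensorAlgAct V k t ≫ toNicSum k V j) ≫ nicSum.map k f =
      nichols.incl k V ≫ tensorAlgAct V k t ≫ toNicSum k V j' := by
  rw [Category.assoc, Category.assoc, toNicSum_map]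

/-- On elements the composite is `x ⊗ v ↦ 1 ⊗ t S x v = t S x ⊗ v`, and this equals `x ⊗ v` since `S
t S x = S x` over `kerQuot`. -/
theorem map_nicSumProj_comp [CharZero k]
    (ht : ∀ n, toQuotAlg k (kerQuot hV n) (quantumSymmetrizer k n * t n * quantumSymmetrizer k n) =
      toQuotAlg k (kerQuot hV n) (quantumSymmetrizer k n))
    {l j : ∀ n, FinQuot n} (a : l ⟶ kerQuot hV) (b : l ⟶ j) :
    nicSum.map k a ≫ nicSumProj k hV ≫ nichols.incl k V ≫ tensorAlgAct V k t ≫ toNicSum k V j =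
      nicSum.map k b :=
  nicSum_hom_ext k fun n x => by
    have h : nicι k V (j n) (t n * quantumSymmetrizer k n * x) = nicι k V (j n) x :=
      nicι_eq_of_quantumSymmetrizer_mul k hV (j n) (by
        rw [← mul_assoc, ← mul_assoc, map_mul, ht, ← map_mul])
    have h1 := nicι_map (V := V) k (a n) x
    have h2 := nicι_map (V := V) k (b n) x
    rw [reassoc_of% nicSum.ι_map, nicSum.ι_map, reassoc_of% h1, reassoc_of% h2,
      reassoc_of% ι_nicSumProj, reassoc_of% nicι_nicTermProj, reassoc_of% proj_incl,
      reassoc_of% ι_tensorAlgToCo, reassoc_of% ι_tensorAlgAct, ι_toNicSum, ← h,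
      nicι_eq k (j n) (t n * _ * _), algAct_mul, algAct_mul]
    simp only [Category.assoc]

/-- The isomorphism between `Nic[V]` and the Nichols algebra. -/
def nicIso [CharZero k]
    (ht : ∀ n, toQuotAlg k (kerQuot hV n) (quantumSymmetrizer k n * t n * quantumSymmetrizer k n) =
      toQuotAlg k (kerQuot hV n) (quantumSymmetrizer k n)) :
    artin (nic k) V ≅ (Pro.const C).obj (nichols k V) where
  hom :=
    { germ := fun _ => Pro.Germ.mk (X := artin (nic k) V) (kerQuot hV) (nicSumProj k hV)
      compat := fun _ => congrArg (Pro.Germ.mk (X := artin (nic k) V) (kerQuot hV))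
        (Category.comp_id (nicSumProj k hV)) }
  inv :=
    { germ := fun j => Pro.Germ.mk (X := (Pro.const C).obj (nichols k V)) ⟨⟨⟩⟩
        (nichols.incl k V ≫ tensorAlgAct V k t ≫ toNicSum k V j)
      compat := fun {j j'} f =>
        congrArg (Pro.Germ.mk (X := (Pro.const C).obj (nichols k V)) ⟨⟨⟩⟩)
          (incl_toNicSum_map k f) }
  hom_inv_id := Pro.hom_ext fun j => by
    -- The composite is represented at level `kerQuot` and the identity at level `j`; they are
    -- compared at the degreewise meet.
    let l : ∀ n, FinQuot n := fun n => kerQuot hV n ⊓ j n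
    refine Pro.Germ.sound (X := artin (nic k) V) (l := l)
      (fun n => homOfLE (inf_le_left : l n ≤ kerQuot hV n) : l ⟶ kerQuot hV)
      (fun n => homOfLE (inf_le_right : l n ≤ j n) : l ⟶ j) ?_
    exact (map_nicSumProj_comp k hV ht _ (fun n => homOfLE (inf_le_right : l n ≤ j n))).trans
      (Category.comp_id _).symm
  inv_hom_id := Pro.hom_ext fun j =>
    congrArg (Pro.Germ.mk (X := (Pro.const C).obj (nichols k V)) ⟨⟨⟩⟩) (by
      change (nichols.incl k V ≫ tensorAlgAct V k t ≫ toNicSum k V (kerQuot hV)) ≫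
        nicSumProj k hV = 𝟙 _
      rw [Category.assoc, Category.assoc, toNicSum_proj,
        incl_proj k (tensorAlgToCo_comp_act_comp k hV ht)])

theorem nicEval_nicIso [CharZero k]
    (ht : ∀ n, toQuotAlg k (kerQuot hV n) (quantumSymmetrizer k n * t n * quantumSymmetrizer k n) =
      toQuotAlg k (kerQuot hV n) (quantumSymmetrizer k n)) {n : ℕ} (g : Braid n) :
    nicEval k V g ≫ (nicIso k hV ht).hom = (Pro.const C).map
      (braidMap V n g ≫ tensorAlg.ι V n ≫ nichols.proj k V) :=
  Pro.hom_ext fun j => congrArg (Pro.Germ.mk (X := (Pro.const C).obj (tensorPow V n)) ⟨⟨⟩⟩) (by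
    change (nicι k V (kerQuot hV n) (MonoidAlgebra.single g 1) ≫ nicSum.ι k V (kerQuot hV) n) ≫
      nicSumProj k hV = _
    rw [Category.assoc, ι_nicSumProj, nicι_nicTermProj, algAct_single]
    rfl)

open MonObj in
/-- The algebra structure on `Nic[V]` transported from the Nichols algebra is operadic. -/
theorem isNicAlgebra_ofIso [MonObj (nichols k V)] (hB : IsNicholsAlgebra k V)
    (e : artin (nic k) V ≅ (Pro.const C).obj (nichols k V))
    (he : ∀ {n : ℕ} (g : Braid n), nicEval k V g ≫ e.hom = (Pro.const C).map
      (braidMap V n g ≫ tensorAlg.ι V n ≫ nichols.proj k V))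
    [MonObj (artin (nic k) V)] [IsMonHom e.hom] : IsNicAlgebra k V where
  one := by
    refine (cancel_mono e.hom).1 ((IsMonHom.one_hom e.hom).trans (Eq.trans ?_ (he (n := 0) 1).symm))
    refine Eq.trans (Category.id_comp _) (congrArg (Pro.const C).map ?_)
    rw [← hB.one_proj, braidMap_one]
    exact (Category.id_comp _).symm
  mul {p q} g h := by
    rw [← cancel_mono e.hom, Category.assoc, IsMonHom.mul_hom,
      MonoidalCategory.tensorHom_comp_tensorHom_assoc, he, he, Category.assoc, Category.assoc, he]
    -- After the isomorphism the operadic rule becomes multiplicativity of the projection from the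
    -- tensor algebra, combined with the compatibility of concatenation and juxtaposition.
    have h1 : ((braidMap V p g ≫ tensorAlg.ι V p ≫ nichols.proj k V) ⊗ₘ
        (braidMap V q h ≫ tensorAlg.ι V q ≫ nichols.proj k V)) ≫ μ[nichols k V] =
        (concat V p q).hom ≫ braidMap V (p + q) (juxt g h) ≫ tensorAlg.ι V (p + q) ≫
          nichols.proj k V := by
      rw [← MonoidalCategory.tensorHom_comp_tensorHom, ← MonoidalCategory.tensorHom_comp_tensorHom,
        Category.assoc, Category.assoc, ← hB.mul_proj, reassoc_of% ι_concatMul,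
        reassoc_of% concat_juxt]
    rw [← Functor.map_comp, ← h1]
    refine Eq.trans ?_ (congrArg (Functor.LaxMonoidal.μ (Pro.const C) _ _ ≫ ·)
      ((Pro.const C).map_comp _ _).symm)
    rw [← Functor.LaxMonoidal.μ_natural_assoc]
    rfl

end Comparison

end

end BraidedNichols

/-! ### Assembly of the theorem. -/

theorem mainTheorem12 {k : Type w} [Field k] [CharZero k] :
    ((BraidedNichols.woronowicz k).IsStrict ∧
      BraidedNichols.IsLeftIdeal (BraidedNichols.brAssHat k) (BraidedNichols.woronowicz k)
        (BraidedNichols.woronowiczIncl k)) ∧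
    ∀ {C : Type u} [Category.{v} C] [Abelian C] [Linear k C] [MonoidalCategory C]
      [MonoidalPreadditive C] [MonoidalLinear k C] [BraidedCategory C]
      [HasCoproducts.{w} C] [HasCountableCoproducts C]
      [∀ X : C, PreservesColimitsOfShape (Discrete ℕ) (tensorLeft X)]
      (V : C), BraidedNichols.FinitelyBraided V →
      ∃ (_ : MonObj (BraidedNichols.nichols k V))
        (_ : MonObj (BraidedNichols.artin (BraidedNichols.nic k) V)),
        BraidedNichols.IsNicholsAlgebra k V ∧ BraidedNichols.IsNicAlgebra k V ∧
        ∃ e : BraidedNichols.artin (BraidedNichols.nic k) V ≅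
            (BraidedNichols.Pro.const C).obj (BraidedNichols.nichols k V),
          IsMonHom e.hom ∧
          ∀ n, BraidedNichols.nicEval k V (1 : BraidedNichols.Braid n) ≫ e.hom =
            (BraidedNichols.Pro.const C).map
              (BraidedNichols.tensorAlg.ι V n ≫ BraidedNichols.nichols.proj k V) := by
  refine ⟨⟨BraidedNichols.woronowicz_isStrict k, BraidedNichols.isLeftIdeal_woronowicz k⟩, ?_⟩
  intro C _ _ _ _ _ _ _ _ _ _ V hV
  -- One family of quasi-inverses serves both to split the projection to the Nichols algebra and to
  -- invert the comparison map.
  choose t ht using fun n => BraidedNichols.exists_regular k (BraidedNichols.kerQuot hV n)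
  have hE := BraidedNichols.tensorAlgToCo_comp_act_comp k hV ht
  let e := BraidedNichols.nicIso k hV ht
  let _ := BraidedNichols.nicholsMonObj k hE
  -- The product on `Nic[V]` is transported from the Nichols algebra; it is then shown to satisfy
  -- the operadic rule.
  let _ := MonObj.ofIso e.symm
  have he : IsMonHom e.symm.hom := isMonHom_ofIso e.symm
  have he' : IsMonHom e.hom := inferInstanceAs (IsMonHom e.symm.inv)
  have hB := BraidedNichols.isNicholsAlgebra k hE
  refine ⟨inferInstance, inferInstance, hB,
    BraidedNichols.isNicAlgebra_ofIso k hB e (BraidedNichols.nicEval_nicIso k hV ht), e, he',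
    fun n => ?_⟩
  rw [BraidedNichols.nicEval_nicIso, BraidedNichols.braidMap_one, Category.id_comp]
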